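/- Let $d\ge 1$, $\Omega=[0,1)^d$, and let $(\cdot,\cdot)$, linear in the first argument, be the inner product of the complex space $L_2(\Omega)$. Let $a\in L_1(\mathbb R^d)$ satisfy $a\ge 0$, $a(-\mathbf x)=a(\mathbf x)$ and $\operatorname{mes}\{a\neq 0\}>0$. Let $\mu:\mathbb R^d\times\mathbb R^d\to\mathbb R$ be measurable, with $\mu(\mathbf x,\mathbf y)=\mu(\mathbf y,\mathbf x)$, $\mu(\mathbf x+\mathbf m,\mathbf y+\mathbf n)=\mu(\mathbf x,\mathbf y)$ for $\mathbf m,\mathbf n\in\mathbb Z^d$, and $0<\mu_-\le\mu\le\mu_+<\infty$. Put $M_k=\int_{\mathbb R^d}|\mathbf x|^k a(\mathbf x)\,d\mathbf x$ and assume $M_4<\infty$. For $\boldsymbol\xi\in\mathbb R^d$ let $\mathbb A(\boldsymbol\xi)$ be the bounded operator in $L_2(\Omega)$ $$\mathbb A(\boldsymbol\xi)u(\mathbf x)=p(\mathbf x)u(\mathbf x)-\int_\Omega \widetilde a(\boldsymbol\xi,\mathbf x-\mathbf y)\mu(\mathbf x,\mathbf y)u(\mathbf y)\,d\mathbf y,$$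 where $p(\mathbf x)=\int_{\mathbb R^d}a(\mathbf x-\mathbf y)\mu(\mathbf x,\mathbf y)\,d\mathbf y$ and $\widetilde a(\boldsymbol\xi,\mathbf z)=\sum_{\mathbf n\in\mathbb Z^d}a(\mathbf z+\mathbf n)e^{-i\langle\boldsymbol\xi,\mathbf z+\mathbf n\rangle}$. Let $d_0$ be the distance from $0$ to $\sigma(\mathbb A(\mathbf 0))\setminus\{0\}$, and let $P=(\cdot,\mathbf 1_\Omega)\mathbf 1_\Omega$ be the orthogonal projection onto the constants. Put $$\widehat A(\mathbf y)=\int_{\mathbb R^d}(1-\cos\langle \mathbf z,\mathbf y\rangle)a(\mathbf z)\,d\mathbf z,\quad \mathcal C_r=\inf_{|\mathbf y|\ge r}\widehat A(\mathbf y),\quad \mathcal M=\min_{|\boldsymbol\theta|=1}\int_{\mathbb R^d} a(\mathbf z)\langle \mathbf z,\boldsymbol\theta\rangle^2d\mathbf z,\quad r=\frac{3\mathcal M}{2M_3},$$ $$C=\min\Bigl\{\tfrac14\mathcal M,\ \frac{\mathcal C_r}{\pi^2 d},\ \frac{\mathcal C_\pi}{\pi^2d}\Bigr\},\qquad \delta_0=\frac{\mu_-\mathcal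 C_\pi}{3M_1\mu_+}.$$ For each $j=1,\dots,d$ there is a real $\mathbb Z^d$-periodic function $v_j\in L_2(\Omega)$, unique up to null sets, such that $$\int_{\mathbb R^d}a(\mathbf x-\mathbf y)\mu(\mathbf x,\mathbf y)(v_j(\mathbf x)-v_j(\mathbf y))\,d\mathbf y=\int_{\mathbb R^d}a(\mathbf x-\mathbf y)\mu(\mathbf x,\mathbf y)(x_j-y_j)\,d\mathbf y\ \text{ for a.e. }\mathbf x\in\Omega,\qquad \int_\Omega v_j\,d\mathbf x=0.$$ Let $g^0$ be the $d\times d$ matrix with entries $$\tfrac12\int_\Omega d\mathbf x\int_{\mathbb R^d}d\mathbf y\,\bigl((x_k-y_k)(x_l-y_l)-v_k(\mathbf x)(x_l-y_l)-v_l(\mathbf x)(x_k-y_k)\bigr)a(\mathbf x-\mathbf y)\mu(\mathbf x,\mathbf y),$$ and let $[F]_1(\boldsymbol\xi)=\sum_{j=1}^d\xi_jF_j$, where $F_j=i(\cdot,v_j)\mathbf 1_\Omega-i(\cdot,\mathbf 1_\Omega)v_j$. **Theorem.** For all $\varepsilon>0$ and $|\boldsymbol\xi|\le\delta_0$, the operator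 $\mathbb A(\boldsymbol\xi)+\varepsilon^2I$ is invertible, $\langle g^0\boldsymbol\xi,\boldsymbol\xi\rangle+\varepsilon^2>0$, and $$(\mathbb A(\boldsymbol\xi)+\varepsilon^2I)^{-1}=(\langle g^0\boldsymbol\xi,\boldsymbol\xi\rangle+\varepsilon^2)^{-1}P+[F]_1(\boldsymbol\xi)(\langle g^0\boldsymbol\xi,\boldsymbol\xi\rangle+\varepsilon^2)^{-1}P+(\langle g^0\boldsymbol\xi,\boldsymbol\xi\rangle+\varepsilon^2)^{-1}P[F]_1(\boldsymbol\xi)+Y(\boldsymbol\xi,\varepsilon)$$ with $\|Y(\boldsymbol\xi,\varepsilon)\|\le C_6$, where $$C_6=\frac3{d_0}+\frac{2C_1^2+2C_2}{\mu_-C}+\frac{3C_1C_3+C_4}{(\mu_-C)^2}+\frac{C_3^2}{(\mu_-C)^3},$$ $$C_1=\frac{6(\pi+2)\mu_+M_1}{\pi d_0},\qquad C_2=\frac{\pi+2}{\pi}\Bigl(\frac{36\mu_+^2M_1^2}{d_0^2}+\frac{3\mu_+M_2}{d_0}\Bigr),$$ $$C_3=\frac{\pi+2}{2\pi}\Bigl(\frac{6^3\mu_+^3M_1^3}{d_0^2}+\mu_+M_3+\frac{36\mu_+^2M_1M_2}{d_0}\Bigr),$$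 $$C_4=\frac{\pi+2}{2\pi}\Bigl(\frac{6^4\mu_+^4M_1^4}{d_0^3}+\frac{\mu_+M_4}{4}+\frac{\mu_+^2(12M_1M_3+9M_2^2)}{d_0}+\frac{6^4\mu_+^3M_1^2M_2}{4d_0^2}\Bigr).$$ Moreover $d_0\ge\mu_-\mathcal C_\pi>0$, and $C_6$ does not exceed the value of the same expression with $d_0$ replaced by $\mu_-\mathcal C_\pi$; hence $C_6$ is bounded by a constant depending only on $d,\mu_\pm,M_1,M_2,M_3,M_4,\mathcal M,\mathcal C_\pi,\mathcal C_r$. -/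

import Mathlib

open MeasureTheory
open scoped ENNReal NNReal RealInnerProductSpace

namespace NonlocalHom

/-- Hypotheses of the Schur test. -/
structure SchurKernel {α : Type*} [MeasurableSpace α] (ν : Measure α) (k : α → α → ℂ) : Prop where
  aesm : AEStronglyMeasurable (Function.uncurry k) (ν.prod ν)
  bound : ∃ M : ℝ≥0, (∀ᵐ x ∂ν, ∫⁻ y, ‖k x y‖ₑ ∂ν ≤ M) ∧ (∀ᵐ y ∂ν, ∫⁻ x, ‖k x y‖ₑ ∂ν ≤ M)

theorem schur_lintegral {α : Type*} [MeasurableSpace α] {ν : Measure α} [SFinite ν]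
    {k : α → α → ℂ} (hk : AEStronglyMeasurable (Function.uncurry k) (ν.prod ν)) {M : ℝ≥0}
    (h1 : ∀ᵐ x ∂ν, ∫⁻ y, ‖k x y‖ₑ ∂ν ≤ M) (h2 : ∀ᵐ y ∂ν, ∫⁻ x, ‖k x y‖ₑ ∂ν ≤ M)
    {u : α → ℂ} (hu : AEStronglyMeasurable u ν) :
    ∫⁻ x, (∫⁻ y, ‖k x y * u y‖ₑ ∂ν) ^ 2 ∂ν ≤ (M : ℝ≥0∞) ^ 2 * ∫⁻ y, ‖u y‖ₑ ^ 2 ∂ν := by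
  have hsec : ∀ᵐ x ∂ν, AEStronglyMeasurable (k x) ν := hk.prodMk_left
  have hm : AEMeasurable (Function.uncurry fun x y => ‖k x y‖ₑ * ‖u y‖ₑ ^ 2) (ν.prod ν) :=
    hk.enorm.mul ((hu.comp_snd).enorm.pow_const 2)
  calc ∫⁻ x, (∫⁻ y, ‖k x y * u y‖ₑ ∂ν) ^ 2 ∂ν
      ≤ ∫⁻ x, M * ∫⁻ y, ‖k x y‖ₑ * ‖u y‖ₑ ^ 2 ∂ν ∂ν := by
        apply lintegral_mono_ae
        filter_upwards [hsec, h1] with x hx hx1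
        have hf : AEMeasurable (fun y => ‖k x y‖ₑ ^ (1/2 : ℝ)) ν := hx.enorm.pow_const _
        have hg : AEMeasurable (fun y => ‖k x y‖ₑ ^ (1/2 : ℝ) * ‖u y‖ₑ) ν := hf.mul hu.enorm
        have H := ENNReal.lintegral_mul_le_Lp_mul_Lq ν Real.HolderConjugate.two_two hf hg
        have e0 : ∀ t : ℝ≥0∞, (t ^ (1/2 : ℝ)) ^ (2 : ℝ) = t := fun t => by
          rw [← ENNReal.rpow_mul]; norm_num
        have e1 : ∀ t : ℝ≥0∞, t ^ (1/2 : ℝ) * t ^ (1/2 : ℝ) = t := fun t => by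
          rw [← ENNReal.rpow_add_of_nonneg _ _ (by norm_num) (by norm_num)]; norm_num
        have l : ∫⁻ y, ‖k x y * u y‖ₑ ∂ν ≤ (∫⁻ y, ‖k x y‖ₑ ∂ν) ^ (1/2 : ℝ) *
            (∫⁻ y, ‖k x y‖ₑ * ‖u y‖ₑ ^ 2 ∂ν) ^ (1/2 : ℝ) := by
          refine le_trans (le_of_eq ?_) (H.trans (le_of_eq ?_))
          · refine lintegral_congr fun y => ?_
            simp only [Pi.mul_apply, enorm_mul]
            rw [← mul_assoc, e1]
          · simp only [e0, ENNReal.mul_rpow_of_nonneg _ _ (zero_le_two : (0 : ℝ) ≤ 2)]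
            simp only [ENNReal.rpow_two]
        calc (∫⁻ y, ‖k x y * u y‖ₑ ∂ν) ^ 2
            ≤ ((∫⁻ y, ‖k x y‖ₑ ∂ν) ^ (1/2 : ℝ) *
              (∫⁻ y, ‖k x y‖ₑ * ‖u y‖ₑ ^ 2 ∂ν) ^ (1/2 : ℝ)) ^ 2 := by gcongr
          _ = (∫⁻ y, ‖k x y‖ₑ ∂ν) * ∫⁻ y, ‖k x y‖ₑ * ‖u y‖ₑ ^ 2 ∂ν := by
              rw [← ENNReal.rpow_two, ENNReal.mul_rpow_of_nonneg _ _ (zero_le_two : (0 : ℝ) ≤ 2),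
                e0, e0]
          _ ≤ _ := by gcongr
    _ = M * ∫⁻ y, ∫⁻ x, ‖k x y‖ₑ * ‖u y‖ₑ ^ 2 ∂ν ∂ν := by
        rw [lintegral_const_mul' _ _ ENNReal.coe_ne_top, lintegral_lintegral_swap hm]
    _ ≤ M * ∫⁻ y, M * ‖u y‖ₑ ^ 2 ∂ν := by
        gcongr 1
        apply lintegral_mono_ae
        have hsec2 : ∀ᵐ y ∂ν, AEStronglyMeasurable (fun x => k x y) ν := hk.prod_swap.prodMk_left
        filter_upwards [h2, hsec2] with y hy hy2
        rw [lintegral_mul_const'' _ hy2.enorm]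
        gcongr
    _ = _ := by
        rw [lintegral_const_mul' _ _ ENNReal.coe_ne_top, ← mul_assoc, sq]

theorem SchurKernel.integrable {α : Type*} [MeasurableSpace α] {ν : Measure α} [SFinite ν]
    {k : α → α → ℂ} (h : SchurKernel ν k) {u : α → ℂ} (hu : MemLp u 2 ν) :
    ∀ᵐ x ∂ν, Integrable (fun y => k x y * u y) ν := by
  obtain ⟨M, h1, h2⟩ := h.bound
  have H := schur_lintegral h.aesm h1 h2 hu.1
  have hfin : ∫⁻ y, ‖u y‖ₑ ^ 2 ∂ν < ∞ := by
    have := lintegral_rpow_enorm_lt_top_of_eLpNorm_lt_top (by norm_num) (by norm_num) hu.2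
    simpa using this
  have hlt : ∫⁻ x, (∫⁻ y, ‖k x y * u y‖ₑ ∂ν) ^ 2 ∂ν < ∞ :=
    lt_of_le_of_lt H (ENNReal.mul_lt_top (by simp) hfin)
  have hm : AEMeasurable (fun x => (∫⁻ y, ‖k x y * u y‖ₑ ∂ν) ^ 2) ν :=
    (AEMeasurable.lintegral_prod_right (f := fun x y => ‖k x y * u y‖ₑ)
      (h.aesm.mul hu.1.comp_snd).enorm).pow_const 2
  filter_upwards [ae_lt_top' hm hlt.ne, h.aesm.prodMk_left] with x hx hx2
  refine ⟨hx2.mul hu.1, ?_⟩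
  simpa [HasFiniteIntegral] using hx

theorem SchurKernel.eLpNorm_le {α : Type*} [MeasurableSpace α] {ν : Measure α} [SFinite ν]
    {k : α → α → ℂ} (h : SchurKernel ν k) : ∃ M : ℝ≥0, ∀ u : α → ℂ, MemLp u 2 ν →
      eLpNorm (fun x => ∫ y, k x y * u y ∂ν) 2 ν ≤ M * eLpNorm u 2 ν := by
  obtain ⟨M, h1, h2⟩ := h.bound
  refine ⟨M, fun u hu => ?_⟩
  have H := schur_lintegral h.aesm h1 h2 hu.1
  have e0 : ∀ t : ℝ≥0∞, (t ^ 2) ^ (1/2 : ℝ) = t := fun t => by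
    rw [← ENNReal.rpow_two, ← ENNReal.rpow_mul]; norm_num
  rw [eLpNorm_eq_lintegral_rpow_enorm_toReal (by norm_num) (by norm_num),
    eLpNorm_eq_lintegral_rpow_enorm_toReal (by norm_num) (by norm_num)]
  simp only [ENNReal.toReal_ofNat, ENNReal.rpow_two]
  calc (∫⁻ x, ‖∫ y, k x y * u y ∂ν‖ₑ ^ 2 ∂ν) ^ (1/2 : ℝ)
      ≤ ((M : ℝ≥0∞) ^ 2 * ∫⁻ y, ‖u y‖ₑ ^ 2 ∂ν) ^ (1/2 : ℝ) := by
        refine ENNReal.rpow_le_rpow (le_trans (lintegral_mono fun x => ?_) H) (by norm_num)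
        gcongr
        exact enorm_integral_le_lintegral_enorm _
    _ = _ := by rw [ENNReal.mul_rpow_of_nonneg _ _ (by norm_num), e0]

theorem SchurKernel.memLp {α : Type*} [MeasurableSpace α] {ν : Measure α} [SFinite ν]
    {k : α → α → ℂ} (h : SchurKernel ν k) {u : α → ℂ} (hu : MemLp u 2 ν) :
    MemLp (fun x => ∫ y, k x y * u y ∂ν) 2 ν := by
  obtain ⟨M, hM⟩ := h.eLpNorm_le
  exact ⟨(h.aesm.mul hu.1.comp_snd).integral_prod_right',
    lt_of_le_of_lt (hM u hu) (ENNReal.mul_lt_top (by simp) hu.2)⟩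

/-- The bounded integral operator `u ↦ ∫ k(·, y) u(y) dy` on `L²`. -/
noncomputable def integralOp {α : Type*} [MeasurableSpace α] {ν : Measure α} [SFinite ν]
    {k : α → α → ℂ} (h : SchurKernel ν k) : Lp ℂ 2 ν →L[ℂ] Lp ℂ 2 ν :=
  LinearMap.mkContinuousOfExistsBound
    { toFun := fun u => (h.memLp (Lp.memLp u)).toLp (fun x => ∫ y, k x y * u y ∂ν)
      map_add' := fun u v => by
        rw [← MemLp.toLp_add]
        refine MemLp.toLp_congr _ _ ?_
        filter_upwards [h.integrable (Lp.memLp u), h.integrable (Lp.memLp v)] with x hx hy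
        rw [Pi.add_apply, ← integral_add hx hy]
        refine integral_congr_ae ?_
        filter_upwards [Lp.coeFn_add u v] with y e
        rw [e, Pi.add_apply, mul_add]
      map_smul' := fun c u => by
        rw [RingHom.id_apply, ← MemLp.toLp_const_smul]
        refine MemLp.toLp_congr _ _ (Filter.Eventually.of_forall fun x => ?_)
        simp only [Pi.smul_apply, ← integral_smul]
        refine integral_congr_ae ?_
        filter_upwards [Lp.coeFn_smul c u] with y e
        rw [e, Pi.smul_apply, smul_eq_mul, smul_eq_mul]
        ring }
    (by
      obtain ⟨M, hM⟩ := h.eLpNorm_le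
      refine ⟨M, fun u => ?_⟩
      simp only [LinearMap.coe_mk, AddHom.coe_mk, Lp.norm_toLp]
      have := ENNReal.toReal_mono (ENNReal.mul_ne_top (by simp) (Lp.memLp u).2.ne)
        (hM u (Lp.memLp u))
      simpa [Lp.norm_def] using this)

theorem integralOp_apply {α : Type*} [MeasurableSpace α] {ν : Measure α} [SFinite ν]
    {k : α → α → ℂ} (h : SchurKernel ν k) (u : Lp ℂ 2 ν) :
    integralOp h u =ᵐ[ν] fun x => ∫ y, k x y * u y ∂ν :=
  (h.memLp (Lp.memLp u)).coeFn_toLp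

/-- Multiplication by a bounded function on `L²`. -/
noncomputable def mulOp {α : Type*} [MeasurableSpace α] {ν : Measure α}
    {p : α → ℂ} (hp : MemLp p ∞ ν) : Lp ℂ 2 ν →L[ℂ] Lp ℂ 2 ν :=
  (ContinuousLinearMap.mul ℂ ℂ).holderL ν ∞ 2 2 (hp.toLp p)

theorem mulOp_apply {α : Type*} [MeasurableSpace α] {ν : Measure α}
    {p : α → ℂ} (hp : MemLp p ∞ ν) (u : Lp ℂ 2 ν) :
    mulOp hp u =ᵐ[ν] fun x => p x * u x := by
  filter_upwards [(ContinuousLinearMap.mul ℂ ℂ).coeFn_holder (r := 2) (hp.toLp p) u,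
    hp.coeFn_toLp] with x h1 h2
  simp only [mulOp]
  refine h1.trans ?_
  simp [h2]


/-- Euclidean space `ℝ^d`. -/
abbrev Rd (d : ℕ) : Type := EuclideanSpace ℝ (Fin d)

/-- The lattice vector with integer coordinates `n`. -/
noncomputable def latVec {d : ℕ} (n : Fin d → ℤ) : Rd d := WithLp.toLp 2 fun i => (n i : ℝ)

/-- The periodicity cell `Ω = [0,1)^d`. -/
def cell (d : ℕ) : Set (Rd d) := {x | ∀ i, 0 ≤ x i ∧ x i < 1}

/-- Lebesgue measure on `Ω`. -/
noncomputable abbrev cellMeasure (d : ℕ) : Measure (Rd d) := (volume : Measure (Rd d)).restrict (cell d)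

/-- The complex Hilbert space `L_2(Ω)`. -/
abbrev L2cell (d : ℕ) : Type := Lp ℂ 2 (cellMeasure d)

theorem measurableSet_cell (d : ℕ) : MeasurableSet (cell d) := by
  have : cell d = ⋂ i, {x : Rd d | 0 ≤ x i ∧ x i < 1} := by ext x; simp [cell]
  rw [this]
  refine MeasurableSet.iInter fun i => ?_
  have hc : Measurable fun x : Rd d => x i := by fun_prop
  exact (measurableSet_le measurable_const hc).inter (measurableSet_lt hc measurable_const)

instance instFiniteCell (d : ℕ) : IsFiniteMeasure (cellMeasure d) := by
  refine ⟨?_⟩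
  rw [Measure.restrict_apply_univ]
  refine lt_of_le_of_lt (measure_mono (t := Metric.closedBall 0 (Real.sqrt d)) ?_)
    measure_closedBall_lt_top
  intro x hx
  rw [mem_closedBall_zero_iff, EuclideanSpace.norm_eq]
  apply Real.sqrt_le_sqrt
  calc ∑ i, ‖x i‖ ^ 2 ≤ ∑ _i : Fin d, (1 : ℝ) := by
        refine Finset.sum_le_sum fun i _ => ?_
        obtain ⟨h0, h1⟩ := hx i
        rw [Real.norm_eq_abs, sq_abs]
        nlinarith
    _ = d := by simp

/-- Translates of the cell by lattice vectors are disjoint. -/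
theorem cell_translate_sum_le {d : ℕ} (f : Rd d → ℝ≥0∞) :
    ∑' n : Fin d → ℤ, ∫⁻ y in cell d, f (y + latVec n) ≤ ∫⁻ y, f y := by
  have hmp : ∀ n : Fin d → ℤ, ∫⁻ y in cell d, f (y + latVec n) =
      ∫⁻ y in (fun y => y - latVec n) ⁻¹' cell d, f y := by
    intro n
    have h := (measurePreserving_add_right (volume : Measure (Rd d)) (latVec n)).setLIntegral_comp_preimage_emb
      (MeasurableEquiv.addRight (latVec n)).measurableEmbedding f
      ((fun y => y - latVec n) ⁻¹' cell d)
    rw [← h]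
    congr 2
    ext y; simp
  simp_rw [hmp]
  rw [← lintegral_iUnion]
  · exact setLIntegral_le_lintegral _ _
  · intro n; exact (measurable_sub_const _) (measurableSet_cell d)
  · intro m n hmn
    refine Set.disjoint_left.mpr fun y hy hz => hmn ?_
    funext i
    have h1 := hy i
    have h2 := hz i
    simp only [latVec, PiLp.sub_apply] at h1 h2
    have : |((m i : ℝ) - n i)| < 1 := by rw [abs_lt]; constructor <;> linarith
    have h3 : |m i - n i| < 1 := by exact_mod_cast this
    rw [Int.abs_lt_one_iff] at h3
    omega

/-- Standing conditions on the coefficients: `a ∈ L_1` is nonnegative, even and not a.e. zero;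
`μ` is measurable, symmetric, `ℤ^d`-periodic in each variable, and `0 < μ₋ ≤ μ ≤ μ₊`. -/
structure Admissible {d : ℕ} (a : Rd d → ℝ) (μ : Rd d → Rd d → ℝ) (μm μp : ℝ) : Prop where
  integrable : Integrable a
  support_pos : 0 < volume {x | a x ≠ 0}
  nonneg : ∀ x, 0 ≤ a x
  even : ∀ x, a (-x) = a x
  aesm : AEStronglyMeasurable (Function.uncurry μ) (volume.prod volume)
  pos : 0 < μm
  lower : ∀ x y, μm ≤ μ x y
  upper : ∀ x y, μ x y ≤ μp
  symm : ∀ x y, μ x y = μ y x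
  periodic : ∀ x y (m n : Fin d → ℤ), μ (x + latVec m) (y + latVec n) = μ x y

/-- The moment `M_k(a)`. -/
noncomputable def moment {d : ℕ} (a : Rd d → ℝ) (k : ℕ) : ℝ := ∫ x, ‖x‖ ^ k * a x

/-- The potential `p(x) = ∫ a(x - y) μ(x, y) dy`. -/
noncomputable def potential {d : ℕ} (a : Rd d → ℝ) (μ : Rd d → Rd d → ℝ) (x : Rd d) : ℝ :=
  ∫ y, a (x - y) * μ x y

/-- `ã(ξ, z) = ∑_{n ∈ ℤ^d} a(z + n) exp(-i⟨ξ, z + n⟩)`. -/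
noncomputable def aTilde {d : ℕ} (a : Rd d → ℝ) (ξ z : Rd d) : ℂ :=
  ∑' n : Fin d → ℤ, (a (z + latVec n) : ℂ) * Complex.exp (-Complex.I * (⟪ξ, z + latVec n⟫ : ℝ))

theorem Admissible.abs_le {d : ℕ} {a : Rd d → ℝ} {μ : Rd d → Rd d → ℝ} {μm μp : ℝ}
    (h : Admissible a μ μm μp) (x y : Rd d) : ‖μ x y‖ ≤ μp := by
  rw [Real.norm_eq_abs, _root_.abs_le]
  constructor <;> linarith [h.pos, h.lower x y, h.upper x y]

theorem aTilde_enorm_le {d : ℕ} (a : Rd d → ℝ) (ξ z : Rd d) :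
    ‖aTilde a ξ z‖ₑ ≤ ∑' n : Fin d → ℤ, ‖a (z + latVec n)‖ₑ := by
  refine enorm_tsum_le_tsum_enorm.trans (le_of_eq (tsum_congr fun n => ?_))
  rw [enorm_mul]
  have : ‖Complex.exp (-Complex.I * (⟪ξ, z + latVec n⟫ : ℝ))‖ = 1 := by
    rw [Complex.norm_exp]; simp
  rw [← ofReal_norm (Complex.exp _), this, ← ofReal_norm, Complex.norm_real, ofReal_norm]
  simp

theorem aesm_translate {d : ℕ} {a : Rd d → ℝ} (ha : Integrable a) (v : Rd d) :
    AEStronglyMeasurable (fun z => a (z + v)) volume :=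
  ha.1.comp_quasiMeasurePreserving
    (measurePreserving_add_right (volume : Measure (Rd d)) v).quasiMeasurePreserving

/-- The series defining `ã` converges absolutely almost everywhere. -/
theorem aTilde_summable {d : ℕ} {a : Rd d → ℝ} (ha : Integrable a) :
    ∀ᵐ z : Rd d, ∑' n : Fin d → ℤ, ‖a (z + latVec n)‖ₑ < ∞ := by
  have hloc : ∀ m : Fin d → ℤ, ∀ᵐ z : Rd d, z ∈ (fun y => y - latVec m) ⁻¹' cell d →
      ∑' n : Fin d → ℤ, ‖a (z + latVec n)‖ₑ < ∞ := by
    intro m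
    rw [← ae_restrict_iff' ((measurable_sub_const _) (measurableSet_cell d))]
    have hm : ∀ n : Fin d → ℤ, AEMeasurable (fun z : Rd d => ‖a (z + latVec n)‖ₑ)
        (volume.restrict ((fun y => y - latVec m) ⁻¹' cell d)) :=
      fun n => (aesm_translate ha _).enorm.restrict
    refine ae_lt_top' (AEMeasurable.tsum hm) (ne_of_lt ?_)
    rw [lintegral_tsum hm]
    have e : ∀ n : Fin d → ℤ, ∫⁻ z in (fun y => y - latVec m) ⁻¹' cell d, ‖a (z + latVec n)‖ₑ =
        ∫⁻ z in cell d, ‖a (z + latVec (m + n))‖ₑ := by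
      intro n
      have h := (measurePreserving_add_right (volume : Measure (Rd d)) (latVec m)).setLIntegral_comp_preimage_emb
        (MeasurableEquiv.addRight (latVec m)).measurableEmbedding (fun z => ‖a (z + latVec n)‖ₑ)
        ((fun y => y - latVec m) ⁻¹' cell d)
      rw [← h]
      have e1 : (fun x => x + latVec m) ⁻¹' ((fun y => y - latVec m) ⁻¹' cell d) = cell d := by
        ext y; simp
      rw [e1]
      refine lintegral_congr fun y => ?_
      congr 2
      ext i; simp [latVec]; ring
    simp_rw [e]
    have e2 := (Equiv.addLeft m).tsum_eq (fun n => ∫⁻ z in cell d, ‖a (z + latVec n)‖ₑ)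
    simp only [Equiv.coe_addLeft] at e2
    rw [e2]
    exact lt_of_le_of_lt (cell_translate_sum_le fun z => ‖a z‖ₑ) ha.2
  filter_upwards [ae_all_iff.mpr hloc] with z hz
  refine hz (fun i => ⌊z i⌋) fun i => ?_
  simp only [latVec, PiLp.sub_apply]
  exact ⟨by linarith [Int.floor_le (z i)], by linarith [Int.lt_floor_add_one (z i)]⟩

theorem aTilde_aesm {d : ℕ} {a : Rd d → ℝ} (ha : Integrable a) (ξ : Rd d) :
    AEStronglyMeasurable (aTilde a ξ) volume := by
  refine aestronglyMeasurable_of_tendsto_ae (Filter.atTop : Filter (Finset (Fin d → ℤ)))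
    (f := fun s z => ∑ n ∈ s, (a (z + latVec n) : ℂ) *
      Complex.exp (-Complex.I * (⟪ξ, z + latVec n⟫ : ℝ))) ?_ ?_
  · intro s
    refine Finset.aestronglyMeasurable_fun_sum _ fun n _ => ?_
    refine AEStronglyMeasurable.mul ?_ (Continuous.aestronglyMeasurable (by fun_prop))
    exact Complex.continuous_ofReal.comp_aestronglyMeasurable (aesm_translate ha _)
  · filter_upwards [aTilde_summable ha] with z hz
    refine Summable.hasSum (Summable.of_norm ?_)
    have hs : Summable fun n : Fin d → ℤ => ‖a (z + latVec n)‖₊ :=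
      tsum_enorm_ne_top_iff_summable_nnnorm.mp hz.ne
    refine (NNReal.summable_coe.mpr hs).congr fun n => ?_
    rw [norm_mul, Complex.norm_exp, Complex.norm_real]
    simp

theorem cell_aTilde_le {d : ℕ} {a : Rd d → ℝ} (ha : Integrable a) (ξ x : Rd d) :
    ∫⁻ y in cell d, ‖aTilde a ξ (y - x)‖ₑ ≤ ∫⁻ y, ‖a y‖ₑ := by
  have hm : ∀ n : Fin d → ℤ, AEMeasurable (fun y : Rd d => ‖a (y - x + latVec n)‖ₑ)
      (volume.restrict (cell d)) := fun n => by
    have := (aesm_translate ha (latVec n - x)).enorm.restrict (s := cell d)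
    refine this.congr (Filter.Eventually.of_forall fun y => ?_)
    simp only
    congr 2; abel
  calc ∫⁻ y in cell d, ‖aTilde a ξ (y - x)‖ₑ
      ≤ ∫⁻ y in cell d, ∑' n : Fin d → ℤ, ‖a (y - x + latVec n)‖ₑ :=
        lintegral_mono fun y => aTilde_enorm_le a ξ _
    _ = ∑' n : Fin d → ℤ, ∫⁻ y in cell d, ‖a ((y + latVec n) - x)‖ₑ := by
        rw [lintegral_tsum hm]
        refine tsum_congr fun n => lintegral_congr fun y => ?_
        congr 2; abel
    _ ≤ ∫⁻ y, ‖a (y - x)‖ₑ := cell_translate_sum_le fun y => ‖a (y - x)‖ₑ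
    _ = _ := lintegral_sub_right_eq_self (fun y => ‖a y‖ₑ) x

theorem cell_aTilde_le' {d : ℕ} {a : Rd d → ℝ} (ha : Integrable a) (ξ x : Rd d) :
    ∫⁻ y in cell d, ‖aTilde a ξ (x - y)‖ₑ ≤ ∫⁻ y, ‖a y‖ₑ := by
  have hneg : ∀ z, aTilde a ξ z = aTilde (fun z => a (-z)) (-ξ) (-z) := by
    intro z
    unfold aTilde
    rw [← (Equiv.neg (Fin d → ℤ)).tsum_eq]
    refine tsum_congr fun n => ?_
    have e : -z + latVec n = -(z + latVec (-n)) := by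
      ext i; simp [latVec]; ring
    simp only [Equiv.neg_apply, e, neg_neg, inner_neg_neg]
  have := cell_aTilde_le ha.comp_neg (-ξ) x
  rw [lintegral_neg_eq_self (fun y => ‖a y‖ₑ)] at this
  refine le_trans (le_of_eq (lintegral_congr fun y => ?_)) this
  rw [hneg, neg_sub]

theorem quasi_sub {d : ℕ} : Measure.QuasiMeasurePreserving (fun q : Rd d × Rd d => q.1 - q.2)
    ((cellMeasure d).prod (cellMeasure d)) volume :=
  (quasiMeasurePreserving_sub (volume : Measure (Rd d)) volume).mono_left
    (Measure.prod_mono Measure.restrict_le_self Measure.restrict_le_self).absolutelyContinuous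

/-- The kernel of `𝔹(ξ)`. -/
noncomputable def fiberKernel {d : ℕ} (a : Rd d → ℝ) (μ : Rd d → Rd d → ℝ) (ξ x y : Rd d) : ℂ :=
  aTilde a ξ (x - y) * (μ x y : ℂ)

theorem fiberKernel_schur {d : ℕ} {a : Rd d → ℝ} {μ : Rd d → Rd d → ℝ} {μm μp : ℝ}
    (h : Admissible a μ μm μp) (ξ : Rd d) : SchurKernel (cellMeasure d) (fiberKernel a μ ξ) := by
  have hA : ∫⁻ y, ‖a y‖ₑ ≠ ∞ := h.integrable.2.ne
  have hb : ∀ x y, ‖fiberKernel a μ ξ x y‖ₑ ≤ ENNReal.ofReal μp * ‖aTilde a ξ (x - y)‖ₑ := by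
    intro x y
    rw [fiberKernel, enorm_mul, mul_comm]
    gcongr
    rw [← ofReal_norm, Complex.norm_real]
    exact ENNReal.ofReal_le_ofReal (h.abs_le x y)
  refine ⟨?_, (ENNReal.ofReal μp * ∫⁻ y, ‖a y‖ₑ).toNNReal, ?_, ?_⟩
  · have h1 : AEStronglyMeasurable (fun q : Rd d × Rd d => aTilde a ξ (q.1 - q.2))
        ((cellMeasure d).prod (cellMeasure d)) :=
      (aTilde_aesm h.integrable ξ).comp_quasiMeasurePreserving quasi_sub
    refine h1.mul (Complex.continuous_ofReal.comp_aestronglyMeasurable ?_)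
    exact h.aesm.mono_measure (Measure.prod_mono Measure.restrict_le_self Measure.restrict_le_self)
  · refine Filter.Eventually.of_forall fun x => ?_
    rw [ENNReal.coe_toNNReal (ENNReal.mul_ne_top ENNReal.ofReal_ne_top hA)]
    refine (lintegral_mono fun y => hb x y).trans ?_
    rw [lintegral_const_mul' _ _ ENNReal.ofReal_ne_top]
    refine mul_le_mul_right ?_ _
    exact cell_aTilde_le' h.integrable ξ x
  · refine Filter.Eventually.of_forall fun y => ?_
    rw [ENNReal.coe_toNNReal (ENNReal.mul_ne_top ENNReal.ofReal_ne_top hA)]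
    refine (lintegral_mono fun x => hb x y).trans ?_
    rw [lintegral_const_mul' _ _ ENNReal.ofReal_ne_top]
    refine mul_le_mul_right ?_ _
    exact cell_aTilde_le h.integrable ξ y

theorem potential_memLp {d : ℕ} {a : Rd d → ℝ} {μ : Rd d → Rd d → ℝ} {μm μp : ℝ}
    (h : Admissible a μ μm μp) :
    MemLp (fun x => (potential a μ x : ℂ)) ∞ (cellMeasure d) := by
  refine memLp_top_of_bound ?_ (μp * ∫ y, ‖a y‖) (Filter.Eventually.of_forall fun x => ?_)
  · have h1 : AEStronglyMeasurable (fun q : Rd d × Rd d => a (q.1 - q.2)) (volume.prod volume) :=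
      h.integrable.1.comp_quasiMeasurePreserving (quasiMeasurePreserving_sub volume volume)
    have h2 : AEStronglyMeasurable (potential a μ) volume := (h1.mul h.aesm).integral_prod_right'
    exact (Complex.continuous_ofReal.comp_aestronglyMeasurable h2).restrict
  · rw [Complex.norm_real, potential]
    have hi : Integrable fun y => ‖a (x - y)‖ := (h.integrable.comp_sub_left x).norm
    calc ‖∫ y, a (x - y) * μ x y‖ ≤ ∫ y, μp * ‖a (x - y)‖ := by
          refine norm_integral_le_of_norm_le (hi.const_mul _) (Filter.Eventually.of_forall fun y => ?_)
          rw [norm_mul, mul_comm]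
          exact mul_le_mul_of_nonneg_right (h.abs_le x y) (norm_nonneg _)
      _ = μp * ∫ y, ‖a y‖ := by
          rw [integral_const_mul, integral_sub_left_eq_self (fun y => ‖a y‖) volume x]

/-- The fiber operator `𝔸(ξ) = p - 𝔹(ξ)` on `L_2(Ω)`. -/
noncomputable def fiberOp {d : ℕ} {a : Rd d → ℝ} {μ : Rd d → Rd d → ℝ} {μm μp : ℝ}
    (h : Admissible a μ μm μp) (ξ : Rd d) : L2cell d →L[ℂ] L2cell d :=
  mulOp (potential_memLp h) - integralOp (fiberKernel_schur h ξ)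

theorem fiberOp_apply {d : ℕ} {a : Rd d → ℝ} {μ : Rd d → Rd d → ℝ} {μm μp : ℝ}
    (h : Admissible a μ μm μp) (ξ : Rd d) (u : L2cell d) :
    fiberOp h ξ u =ᵐ[cellMeasure d] fun x =>
      (potential a μ x : ℂ) * u x - ∫ y in cell d, aTilde a ξ (x - y) * (μ x y : ℂ) * u y := by
  filter_upwards [Lp.coeFn_sub (mulOp (potential_memLp h) u)
    (integralOp (fiberKernel_schur h ξ) u), mulOp_apply (potential_memLp h) u,
    integralOp_apply (fiberKernel_schur h ξ) u] with x h1 h2 h3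
  refine h1.trans ?_
  rw [Pi.sub_apply, h2, h3]
  rfl

/-- The constant function `1_Ω` as an element of `L_2(Ω)`. -/
noncomputable def oneCell (d : ℕ) : L2cell d :=
  (memLp_const (1 : ℂ) : MemLp (fun _ => (1 : ℂ)) 2 (cellMeasure d)).toLp _

/-- The orthogonal projection `P` of `L_2(Ω)` onto the span of `1_Ω`. -/
noncomputable def projConst (d : ℕ) : L2cell d →L[ℂ] L2cell d :=
  (Submodule.span ℂ {oneCell d}).starProjection

/-- `v` is a real periodic `L_2(Ω)` solution of the `j`-th cell problem. -/
structure IsCellSolution {d : ℕ} (a : Rd d → ℝ) (μ : Rd d → Rd d → ℝ) (j : Fin d)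
    (v : Rd d → ℝ) : Prop where
  periodic : ∀ (x : Rd d) (n : Fin d → ℤ), v (x + latVec n) = v x
  memLp : MemLp v 2 (cellMeasure d)
  eqn : ∀ᵐ x ∂cellMeasure d,
    ∫ y, a (x - y) * μ x y * (v x - v y) = ∫ y, a (x - y) * μ x y * (x j - y j)
  mean_zero : ∫ x in cell d, v x = 0

/-- The effective matrix `g⁰` built from the cell solutions `v`. -/
noncomputable def effMatrix {d : ℕ} (a : Rd d → ℝ) (μ : Rd d → Rd d → ℝ) (v : Fin d → Rd d → ℝ) :
    Matrix (Fin d) (Fin d) ℝ :=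
  Matrix.of fun k l => (1 / 2 : ℝ) * ∫ x in cell d, ∫ y,
    ((x k - y k) * (x l - y l) - v k x * (x l - y l) - v l x * (x k - y k)) *
      a (x - y) * μ x y

/-- The quadratic form `⟨g⁰ ξ, ξ⟩`. -/
noncomputable def effForm {d : ℕ} (a : Rd d → ℝ) (μ : Rd d → Rd d → ℝ) (v : Fin d → Rd d → ℝ)
    (ξ : Rd d) : ℝ :=
  ∑ k, ∑ l, effMatrix a μ v k l * ξ k * ξ l

/-- `F_j = i (·, v) 1_Ω - i (·, 1_Ω) v`; here `rankOne x y` is the operator `u ↦ (u, y) x`, the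
inner product `(u, y) = ∫_Ω u ȳ` being linear in `u`. -/
noncomputable def corrOp {d : ℕ} {v : Rd d → ℝ} (hv : MemLp v 2 (cellMeasure d)) :
    L2cell d →L[ℂ] L2cell d :=
  Complex.I • InnerProductSpace.rankOne ℂ (oneCell d) ((hv.ofReal (K := ℂ)).toLp _) -
    Complex.I • InnerProductSpace.rankOne ℂ ((hv.ofReal (K := ℂ)).toLp _) (oneCell d)

/-- `[F]_1(ξ) = ∑_j ξ_j F_j`. -/
noncomputable def firstOrder {d : ℕ} {a : Rd d → ℝ} {μ : Rd d → Rd d → ℝ} {v : Fin d → Rd d → ℝ}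
    (hv : ∀ j, IsCellSolution a μ j (v j)) (ξ : Rd d) : L2cell d →L[ℂ] L2cell d :=
  ∑ j, (ξ j : ℂ) • corrOp (hv j).memLp

/-- `d_0`: the distance from `0` to the rest of the spectrum of `𝔸(0)`. -/
noncomputable def spectralGap {d : ℕ} {a : Rd d → ℝ} {μ : Rd d → Rd d → ℝ} {μm μp : ℝ}
    (h : Admissible a μ μm μp) : ℝ :=
  Metric.infDist (0 : ℂ) (spectrum ℂ (fiberOp h 0) \ {0})

/-- The symbol `Â(y) = ∫ (1 - cos⟨z, y⟩) a(z) dz`. -/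
noncomputable def symbolA {d : ℕ} (a : Rd d → ℝ) (y : Rd d) : ℝ :=
  ∫ z, (1 - Real.cos ⟪z, y⟫) * a z

/-- `𝒞_r(a)`, the minimum of `Â` over `|y| ≥ r`. -/
noncomputable def tailMin {d : ℕ} (a : Rd d → ℝ) (r : ℝ) : ℝ :=
  ⨅ y : {y : Rd d // r ≤ ‖y‖}, symbolA a y

/-- `ℳ(a)`, the minimum over `|θ| = 1` of `∫ a(z) ⟨z, θ⟩² dz`. -/
noncomputable def sphereMin {d : ℕ} (a : Rd d → ℝ) : ℝ :=
  ⨅ θ : Metric.sphere (0 : Rd d) 1, ∫ z, a z * ⟪z, (θ : Rd d)⟫ ^ 2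

/-- `r(a) = 3 ℳ(a) / (2 M_3(a))`. -/
noncomputable def radius {d : ℕ} (a : Rd d → ℝ) : ℝ := 3 * sphereMin a / (2 * moment a 3)

/-- `δ_0(a, μ) = μ₋ 𝒞_π(a) / (3 M_1(a) μ₊)`. -/
noncomputable def delta0 {d : ℕ} (a : Rd d → ℝ) (μm μp : ℝ) : ℝ :=
  μm * tailMin a Real.pi / (3 * moment a 1 * μp)

/-- `C(a)` as a function of `d, ℳ(a), 𝒞_π(a), 𝒞_{r(a)}(a)`. -/
noncomputable def constC (d : ℕ) (Ms Cpi Cr : ℝ) : ℝ :=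
  min (Ms / 4) (min (Cr / (Real.pi ^ 2 * d)) (Cpi / (Real.pi ^ 2 * d)))

/-- The constant `C_1`. -/
noncomputable def constC1 (μp M1 d0 : ℝ) : ℝ :=
  6 * (Real.pi + 2) * μp * M1 / (Real.pi * d0)

/-- The constant `C_2`. -/
noncomputable def constC2 (μp M1 M2 d0 : ℝ) : ℝ :=
  (Real.pi + 2) / Real.pi * (36 * μp ^ 2 * M1 ^ 2 / d0 ^ 2 + 3 * μp * M2 / d0)

/-- The constant `C_3`. -/
noncomputable def constC3 (μp M1 M2 M3 d0 : ℝ) : ℝ :=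
  (Real.pi + 2) / (2 * Real.pi) *
    (6 ^ 3 * μp ^ 3 * M1 ^ 3 / d0 ^ 2 + μp * M3 + 36 * μp ^ 2 * M1 * M2 / d0)

/-- The constant `C_4`. -/
noncomputable def constC4 (μp M1 M2 M3 M4 d0 : ℝ) : ℝ :=
  (Real.pi + 2) / (2 * Real.pi) *
    (6 ^ 4 * μp ^ 4 * M1 ^ 4 / d0 ^ 3 + μp * M4 / 4 +
      μp ^ 2 * (12 * M1 * M3 + 9 * M2 ^ 2) / d0 + 6 ^ 4 * μp ^ 3 * M1 ^ 2 * M2 / (4 * d0 ^ 2))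

/-- The constant `C_6` as an explicit function of the parameters it depends on and of `d_0`. -/
noncomputable def constC6 (d : ℕ) (μm μp M1 M2 M3 M4 Ms Cpi Cr d0 : ℝ) : ℝ :=
  3 / d0 +
    (2 * constC1 μp M1 d0 ^ 2 + 2 * constC2 μp M1 M2 d0) / (μm * constC d Ms Cpi Cr) +
    (3 * constC1 μp M1 d0 * constC3 μp M1 M2 M3 d0 + constC4 μp M1 M2 M3 M4 d0) /
      (μm * constC d Ms Cpi Cr) ^ 2 +
    constC3 μp M1 M2 M3 d0 ^ 2 / (μm * constC d Ms Cpi Cr) ^ 3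

/-- `constC6` evaluated at the data of `(a, μ)`, with the last argument left free. -/
noncomputable def C6 {d : ℕ} (a : Rd d → ℝ) (μm μp d0 : ℝ) : ℝ :=
  constC6 d μm μp (moment a 1) (moment a 2) (moment a 3) (moment a 4) (sphereMin a)
    (tailMin a Real.pi) (tailMin a (radius a)) d0

end NonlocalHom

open NonlocalHom

/-! Write e for the constant function on Ω. The operator 𝔸(0) is symmetric and nonnegative,
annihilates e, and is bounded below by d₀ on e^⊥. The resolvent is treated by a Schur complement
with respect to e; no contour integrals or spectral projections of 𝔸(ξ) are needed.

Put T = 𝔸(ξ) + ε². There are b ⊥ e and S > 0 with T(e + b) = S e (`exists_schur_vector`). Then T⁻¹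
is S⁻¹ times the rank-one operator of e + b plus an operator with values in e^⊥ and norm at most
3/(2d₀), because for |ξ| ≤ δ₀ a gap 2d₀/3 survives on e^⊥. So b is needed only to second order, and
S only up to errors of size |ξ|⁴ + ε²|ξ|²: both S and ⟨g⁰ξ,ξ⟩ + ε² dominate a multiple of |ξ|² plus
ε², and dividing by them leaves bounded quantities.

Both approximations come from one trial vector e + b₁ with b₁ = -i ∑ ξ_j v_j, for which 𝔸(ξ)e +
𝔸(0)b₁ is of second order. Since T(e + b) is parallel to e, the error c = b₁ - b is orthogonal to
T(e + b), so the form of T at e + b₁ equals S + (Tc, c): the error in S is quadratic in c. The form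
of 𝔸(ξ) at e + b₁ is ⟨g⁰ξ,ξ⟩ up to |ξ|⁴, the odd orders dropping out because a is even and the v_j
are real. These two halves are `resolvent_approx` and `abs_form_sub_effForm_le`.

The lower bounds use that the form of 𝔸(ξ) is the integral of μ against a nonnegative density, so μ
may be replaced by μ₋ (`re_inner_fiberOp_ge`). For μ = 1 the operator is diagonal in the Fourier
basis with eigenvalues Â(ξ + 2πn) (`fiberOp_unit_cellBasis`), which gives `fiberOp_lower` and
`fiberOp_gap`. The actual distance d₀ enters through `infDist_spectrum_gap`, and coercivity of g⁰
follows from that of 𝔸(ξ) by scaling ξ to 0 (`effForm_ge`). The constant so obtained lies below C₆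
(`remainder_le_constC6`). -/

namespace NonlocalHom

/-! ### Schur complement and resolvent approximation in a Hilbert space. -/

section Abstract

variable {H : Type*} [NormedAddCommGroup H] [InnerProductSpace ℂ H] [CompleteSpace H]

theorem isUnit_of_re_inner_ge (T : H →L[ℂ] H) {c : ℝ} (hc : 0 < c)
    (h : ∀ u, c * ‖u‖ ^ 2 ≤ (inner ℂ (T u) u).re) : IsUnit T := by
  refine T.isUnit_of_forall_le_norm_inner_map (c := NNReal.mk c hc.le) hc fun u => ?_
  rw [NNReal.coe_mk, mul_comm]
  exact (h u).trans (Complex.re_le_norm _)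

/-- The Schur complement of a coercive symmetric operator with respect to a unit vector. -/
theorem exists_schur_vector (T : H →L[ℂ] H) (hT : ∀ x y, (inner ℂ (T x) y) = (inner ℂ x (T y)))
    {e : H} (he : ‖e‖ = 1) {c : ℝ} (hc : 0 < c) (h : ∀ u, c * ‖u‖ ^ 2 ≤ (inner ℂ (T u) u).re) :
    ∃ (S : ℝ) (b : H), c ≤ S ∧ (inner ℂ e b) = 0 ∧ T (e + b) = (S : ℂ) • e := by
  obtain ⟨X, hX⟩ := (isUnit_of_re_inner_ge T hc h)
  set p : H := (↑X⁻¹ : H →L[ℂ] H) e with hp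
  have hTp : T p = e := by
    have : (T * (↑X⁻¹ : H →L[ℂ] H)) e = e := by rw [← hX, Units.mul_inv]; rfl
    simpa using this
  set s : ℝ := (inner ℂ e p).re with hs
  have hreal : (inner ℂ e p) = (s : ℂ) := by
    have h1 : (inner ℂ e p) = (inner ℂ p e) := by
      conv_lhs => rw [← hTp]
      rw [hT, hTp]
    have h2 : (starRingEnd ℂ) (inner ℂ e p) = (inner ℂ e p) := by rw [inner_conj_symm, ← h1]
    exact (Complex.conj_eq_iff_re.mp h2).symm
  have hp0 : p ≠ 0 := by
    intro h0
    rw [h0, map_zero] at hTp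
    rw [← hTp] at he
    simp at he
  have hpn : 0 < ‖p‖ := norm_pos_iff.mpr hp0
  have hsp : s ≤ ‖p‖ := by
    have := Complex.re_le_norm (inner ℂ e p)
    have h2 := norm_inner_le_norm (𝕜 := ℂ) e p
    rw [he, one_mul] at h2
    exact this.trans h2
  have hcp : c * ‖p‖ ^ 2 ≤ s := by simpa [hTp] using h p
  have hs0 : 0 < s := lt_of_lt_of_le (by positivity) hcp
  -- Here p = T⁻¹e; dividing it by s = (e, p) makes its component along e equal to 1. The bound c ≤
  -- S is s ≤ ‖p‖ ≤ 1/c.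
  refine ⟨s⁻¹, ((s⁻¹ : ℝ) : ℂ) • p - e, ?_, ?_, ?_⟩
  · rw [le_inv_comm₀ hc hs0, ]
    have h3 : c * ‖p‖ ≤ 1 := by
      by_contra! h4
      nlinarith
    calc s ≤ ‖p‖ := hsp
      _ ≤ c⁻¹ := by rw [le_inv_comm₀ hpn hc, ← one_div, le_div_iff₀ hpn]; exact h3
  · rw [inner_sub_right, inner_smul_right, hreal, inner_self_eq_norm_sq_to_K, he]
    have : (s : ℂ) ≠ 0 := by exact_mod_cast hs0.ne'
    push_cast
    field_simp
    simp
  · rw [add_sub_cancel, map_smul, hTp]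

/-- Cauchy–Schwarz and division by ‖x‖. Only the pairing of y with x matters, so y may replace the
image of x under the operator whenever the two differ by something orthogonal to x. -/
theorem norm_le_of_coercive {H : Type*} [NormedAddCommGroup H] [InnerProductSpace ℂ H] {c r : ℝ} (hc : 0 < c) {x y : H} (h1 : c * ‖x‖ ^ 2 ≤ (inner ℂ y x).re)
    (h2 : ‖y‖ ≤ r) : ‖x‖ ≤ r / c := by
  have h3 : (inner ℂ y x).re ≤ r * ‖x‖ :=
    (Complex.re_le_norm _).trans ((norm_inner_le_norm y x).trans
      (mul_le_mul_of_nonneg_right h2 (norm_nonneg _)))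
  rw [le_div_iff₀ hc]
  rcases (norm_nonneg x).eq_or_lt with h | h
  · rw [← h, zero_mul]; exact (norm_nonneg y).trans h2
  · by_contra! h4
    nlinarith

/-- Scalar estimate behind `resolvent_approx`. -/
theorem resolvent_scalar_bound {D m₁ m₂ t K η ε S G β ρ nb nc : ℝ} (hD : 0 < D)
    (hm₁ : 0 ≤ m₁) (ht : 0 ≤ t)
    (hK : 0 < K) (hη : 0 ≤ η) (hε : 0 < ε) (hS : K * t ^ 2 + ε ^ 2 ≤ S)
    (hG : K * t ^ 2 + ε ^ 2 ≤ G) (hβ : β = m₁ * t / D) (hβ3 : β ≤ 1 / 3)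
    (hρ : ρ = (m₁ ^ 2 / D + m₂ / 2) * t ^ 2) (hm₂ : 0 ≤ m₂)
    (hSG : |S - G| ≤ η * t ^ 4 + 3 * ε ^ 2 * β ^ 2 + 3 / D * ρ ^ 2)
    (hnb : nb ≤ 3 / 2 * β) (hnb0 : 0 ≤ nb)
    (hnc : nc ≤ 3 / (2 * D) * (ρ + ε ^ 2 * β)) :
    3 / (2 * D) + |S⁻¹ - G⁻¹| * 2 + G⁻¹ * (2 * nc) + S⁻¹ * nb ^ 2 ≤
      5 / (2 * D) + (45 / 4 * m₁ ^ 2 / D ^ 2 + 3 / 2 * m₂ / D) / K +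
        2 * (η + 3 / D * (m₁ ^ 2 / D + m₂ / 2) ^ 2) / K ^ 2 := by
  have hE : 0 < ε ^ 2 := by positivity
  have hKt : 0 ≤ K * t ^ 2 := by positivity
  have hS0 : 0 < S := by linarith
  have hG0 : 0 < G := by linarith
  have ht2S : t ^ 2 * S⁻¹ ≤ K⁻¹ := by
    rw [← div_eq_mul_inv, div_le_iff₀ hS0, inv_mul_eq_div, le_div_iff₀ hK]; nlinarith
  have ht2G : t ^ 2 * G⁻¹ ≤ K⁻¹ := by
    rw [← div_eq_mul_inv, div_le_iff₀ hG0, inv_mul_eq_div, le_div_iff₀ hK]; nlinarith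
  have hεG : ε ^ 2 * G⁻¹ ≤ 1 := by
    rw [← div_eq_mul_inv, div_le_one hG0]; linarith
  have hSi : 0 < S⁻¹ := inv_pos.mpr hS0
  have hGi : 0 < G⁻¹ := inv_pos.mpr hG0
  have hβ0 : 0 ≤ β := by rw [hβ]; positivity
  have hdiff : |S⁻¹ - G⁻¹| = |S - G| * (S⁻¹ * G⁻¹) := by
    rw [inv_sub_inv hS0.ne' hG0.ne', abs_div, abs_of_pos (mul_pos hS0 hG0), abs_sub_comm,
      div_eq_mul_inv, mul_inv]
  set L : ℝ := m₁ ^ 2 / D + m₂ / 2 with hL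
  have hL0 : 0 ≤ L := by positivity
  -- Each t⁴ is shared between S⁻¹ and G⁻¹, and each ε²t² gives t² to one and ε² to the other; thus
  -- no negative power of t or ε remains.
  have hq : (t ^ 2 * S⁻¹) * (t ^ 2 * G⁻¹) ≤ K⁻¹ * K⁻¹ :=
    mul_le_mul ht2S ht2G (by positivity) (by positivity)
  have hq2 : (t ^ 2 * S⁻¹) * (ε ^ 2 * G⁻¹) ≤ K⁻¹ * 1 :=
    mul_le_mul ht2S hεG (by positivity) (by positivity)
  have b1 : |S⁻¹ - G⁻¹| ≤ (η + 3 / D * L ^ 2) * (K⁻¹ * K⁻¹) + 3 * (m₁ / D) ^ 2 * K⁻¹ := by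
    rw [hdiff]
    calc |S - G| * (S⁻¹ * G⁻¹)
        ≤ (η * t ^ 4 + 3 * ε ^ 2 * β ^ 2 + 3 / D * ρ ^ 2) * (S⁻¹ * G⁻¹) := by gcongr
      _ = (η + 3 / D * L ^ 2) * ((t ^ 2 * S⁻¹) * (t ^ 2 * G⁻¹)) +
          3 * (m₁ / D) ^ 2 * ((t ^ 2 * S⁻¹) * (ε ^ 2 * G⁻¹)) := by rw [hβ, hρ]; ring
      _ ≤ _ := by
          have : 0 ≤ η + 3 / D * L ^ 2 := by positivity
          have h2 : 0 ≤ 3 * (m₁ / D) ^ 2 := by positivity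
          have := mul_le_mul_of_nonneg_left hq this
          have := mul_le_mul_of_nonneg_left hq2 h2
          linarith
  -- The term 3/D · β is reduced to 1/D by β ≤ 1/3; with the initial 3/(2D) this makes the final
  -- 5/(2D).
  have b2 : G⁻¹ * (2 * nc) ≤ 3 / D * L * K⁻¹ + 1 / D := by
    calc G⁻¹ * (2 * nc) ≤ G⁻¹ * (2 * (3 / (2 * D) * (ρ + ε ^ 2 * β))) := by gcongr
      _ = 3 / D * L * (t ^ 2 * G⁻¹) + 3 / D * (ε ^ 2 * G⁻¹) * β := by rw [hρ]; ring
      _ ≤ 3 / D * L * K⁻¹ + 3 / D * 1 * (1 / 3) := by gcongr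
      _ = _ := by ring
  have b3 : S⁻¹ * nb ^ 2 ≤ 9 / 4 * (m₁ / D) ^ 2 * K⁻¹ := by
    calc S⁻¹ * nb ^ 2 ≤ S⁻¹ * (3 / 2 * β) ^ 2 := by gcongr
      _ = 9 / 4 * (m₁ / D) ^ 2 * (t ^ 2 * S⁻¹) := by rw [hβ]; ring
      _ ≤ _ := by gcongr
  calc _ ≤ 3 / (2 * D) + ((η + 3 / D * L ^ 2) * (K⁻¹ * K⁻¹) + 3 * (m₁ / D) ^ 2 * K⁻¹) * 2 +
        (3 / D * L * K⁻¹ + 1 / D) + 9 / 4 * (m₁ / D) ^ 2 * K⁻¹ := by linarith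
    _ = _ := by rw [hL]; field_simp; ring

set_option maxHeartbeats 1000000 in
/-- Two-sided approximation of the resolvent of a symmetric operator near a simple bottom
eigenvalue of an unperturbed operator `A₀`, in terms of a first-order corrector `b₁`. -/
theorem resolvent_approx (A A₀ : H →L[ℂ] H) (hA : ∀ x y, (inner ℂ (A x) y) = (inner ℂ x (A y)))
    {e b₁ : H} (he : ‖e‖ = 1) (heb : (inner ℂ e b₁) = 0)
    {D m₁ m₂ t K η g ε : ℝ} (hD : 0 < D) (hm₁ : 0 ≤ m₁) (hm₂ : 0 ≤ m₂) (ht : 0 ≤ t) (hK : 0 < K)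
    (hη : 0 ≤ η) (hε : 0 < ε) (hA₀e : A₀ e = 0)
    (hgap : ∀ u, (inner ℂ e u) = 0 → D * ‖u‖ ^ 2 ≤ (inner ℂ (A₀ u) u).re)
    (hdiff : ‖A - A₀‖ ≤ m₁ * t) (hsmall : m₁ * t ≤ D / 3)
    (hlow : ∀ u, K * t ^ 2 * ‖u‖ ^ 2 ≤ (inner ℂ (A u) u).re)
    (hb₁ : ‖A₀ b₁‖ ≤ m₁ * t) (hfirst : ‖A e + A₀ b₁‖ ≤ m₂ * t ^ 2 / 2)
    (hform : |(inner ℂ (A (e + b₁)) (e + b₁)).re - g| ≤ η * t ^ 4) (hg : K * t ^ 2 ≤ g) :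
    IsUnit (A + ((ε ^ 2 : ℝ) : ℂ) • (1 : H →L[ℂ] H)) ∧
    ‖Ring.inverse (A + ((ε ^ 2 : ℝ) : ℂ) • (1 : H →L[ℂ] H)) -
      (((g + ε ^ 2)⁻¹ : ℝ) : ℂ) • (InnerProductSpace.rankOne ℂ e e +
        InnerProductSpace.rankOne ℂ b₁ e + InnerProductSpace.rankOne ℂ e b₁)‖ ≤
      5 / (2 * D) + (45 / 4 * m₁ ^ 2 / D ^ 2 + 3 / 2 * m₂ / D) / K +
        2 * (η + 3 / D * (m₁ ^ 2 / D + m₂ / 2) ^ 2) / K ^ 2 := by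
  set T : H →L[ℂ] H := A + ((ε ^ 2 : ℝ) : ℂ) • (1 : H →L[ℂ] H) with hTdef
  have hTapp : ∀ u, T u = A u + ((ε ^ 2 : ℝ) : ℂ) • u := fun u => by simp [hTdef]
  have hT : ∀ x y, (inner ℂ (T x) y) = (inner ℂ x (T y)) := fun x y => by
    rw [hTapp, hTapp, inner_add_left, inner_add_right, hA, inner_smul_left, inner_smul_right,
      Complex.conj_ofReal]
  have hre : ∀ u, (inner ℂ (T u) u).re = (inner ℂ (A u) u).re + ε ^ 2 * ‖u‖ ^ 2 := fun u => by
    rw [hTapp, inner_add_left, inner_smul_left, Complex.conj_ofReal, Complex.add_re,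
      Complex.re_ofReal_mul, inner_self_eq_norm_sq_to_K]
    norm_cast
  have hE : 0 < ε ^ 2 := by positivity
  have hKt : 0 ≤ K * t ^ 2 := by positivity
  have hTlow : ∀ u, (K * t ^ 2 + ε ^ 2) * ‖u‖ ^ 2 ≤ (inner ℂ (T u) u).re := fun u => by
    rw [hre]; linarith [hlow u]
  have hunit : IsUnit T := isUnit_of_re_inner_ge T (by positivity) hTlow
  refine ⟨hunit, ?_⟩
  obtain ⟨S, b, hS, heb', hTq⟩ := exists_schur_vector T hT he (by positivity) hTlow
  have hS0 : 0 < S := by linarith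
  -- On e^⊥ the perturbation consumes at most a third of the gap D.
  have hTperp : ∀ u, (inner ℂ e u) = 0 → (2 * D / 3 + ε ^ 2) * ‖u‖ ^ 2 ≤ (inner ℂ (T u) u).re := by
    intro u hu
    rw [hre]
    have h1 : (inner ℂ ((A - A₀) u) u).re = (inner ℂ (A u) u).re - (inner ℂ (A₀ u) u).re := by
      rw [_root_.sub_apply, inner_sub_left, Complex.sub_re]
    have h2 : |(inner ℂ ((A - A₀) u) u).re| ≤ D / 3 * ‖u‖ ^ 2 := by
      calc |(inner ℂ ((A - A₀) u) u).re| ≤ ‖(inner ℂ ((A - A₀) u) u)‖ := Complex.abs_re_le_norm _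
        _ ≤ ‖(A - A₀) u‖ * ‖u‖ := norm_inner_le_norm _ _
        _ ≤ (‖A - A₀‖ * ‖u‖) * ‖u‖ := by gcongr; exact ContinuousLinearMap.le_opNorm _ _
        _ ≤ (D / 3 * ‖u‖) * ‖u‖ := by gcongr; linarith
        _ = _ := by ring
    have := (abs_le.mp h2).1
    linarith [hgap u hu]
  set β : ℝ := m₁ * t / D with hβ
  have hβ0 : 0 ≤ β := by positivity
  have hβ3 : β ≤ 1 / 3 := by rw [hβ, div_le_iff₀ hD]; linarith
  have hb₁n : ‖b₁‖ ≤ β := norm_le_of_coercive hD (hgap b₁ heb) hb₁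
  have hc0 : 0 < 2 * D / 3 + ε ^ 2 := by positivity
  have hinv : (2 * D / 3 + ε ^ 2)⁻¹ ≤ 3 / (2 * D) := by
    rw [inv_le_comm₀ hc0 (by positivity), inv_div]; linarith
  have hΔ : ∀ u, ‖(A - A₀) u‖ ≤ m₁ * t * ‖u‖ := fun u =>
    (ContinuousLinearMap.le_opNorm _ _).trans (by gcongr)
  have hbn : ‖b‖ ≤ 3 / 2 * β := by
    -- Since A₀e = 0, T b is a multiple of e minus (A - A₀)e, and the multiple of e disappears
    -- against b.
    have h1 : (inner ℂ (T b) b).re = (inner ℂ (-(A - A₀) e) b).re := by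
      have : T b = (S : ℂ) • e - ((ε ^ 2 : ℝ) : ℂ) • e - (A - A₀) e := by
        have h3 : T b = (S : ℂ) • e - T e := by rw [← hTq, map_add]; abel
        rw [h3, hTapp, _root_.sub_apply, hA₀e]; abel
      rw [this, inner_sub_left, inner_sub_left, inner_smul_left, inner_smul_left, heb',
        inner_neg_left]
      simp
    have h2 : ‖-(A - A₀) e‖ ≤ m₁ * t := by
      have := hΔ e
      rwa [he, mul_one, ← norm_neg] at this
    have h3 := hTperp b heb'
    rw [h1] at h3
    calc ‖b‖ ≤ m₁ * t / (2 * D / 3 + ε ^ 2) := norm_le_of_coercive hc0 h3 h2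
      _ ≤ m₁ * t * (3 / (2 * D)) := by rw [div_eq_mul_inv]; gcongr
      _ = _ := by rw [hβ]; field_simp
  set c : H := b₁ - b with hcdef
  have hec : (inner ℂ e c) = 0 := by rw [hcdef, inner_sub_right, heb, heb', sub_zero]
  have hce : (inner ℂ c e) = 0 := by rw [← inner_conj_symm, hec, map_zero]
  set ρ : ℝ := (m₁ ^ 2 / D + m₂ / 2) * t ^ 2 with hρ
  -- Up to a multiple of e, w is T c. Its first bracket is small by the choice of b₁, its second is
  -- a product of two first-order quantities, its third carries ε².
  set w : H := (A e + A₀ b₁) + (A - A₀) b₁ + ((ε ^ 2 : ℝ) : ℂ) • b₁ with hw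
  have hwn : ‖w‖ ≤ ρ + ε ^ 2 * β := by
    calc ‖w‖ ≤ ‖A e + A₀ b₁‖ + ‖(A - A₀) b₁‖ + ‖((ε ^ 2 : ℝ) : ℂ) • b₁‖ := norm_add₃_le
      _ ≤ m₂ * t ^ 2 / 2 + m₁ * t * β + ε ^ 2 * β := by
          gcongr
          · exact (hΔ b₁).trans (by gcongr)
          · rw [norm_smul, Complex.norm_real, Real.norm_of_nonneg hE.le]; gcongr
      _ = _ := by rw [hρ, hβ]; ring
  have hzq : e + b₁ = (e + b) + c := by rw [hcdef]; abel
  have hTc : (inner ℂ (T c) c) = (inner ℂ w c) := by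
    have : T c = w + (((ε ^ 2 : ℝ) : ℂ) • e - (S : ℂ) • e) := by
      have h3 : T c = T (e + b₁) - (S : ℂ) • e := by rw [← hTq, hzq, map_add]; abel
      rw [h3, hTapp, hw, map_add, smul_add, _root_.sub_apply]; abel
    rw [this, inner_add_left, inner_sub_left, inner_smul_left, inner_smul_left, hec]
    simp
  have hcn' : ‖c‖ ≤ (ρ + ε ^ 2 * β) / (2 * D / 3 + ε ^ 2) := by
    have h3 := hTperp c hec
    rw [hTc] at h3
    exact norm_le_of_coercive hc0 h3 hwn
  have hρ0 : 0 ≤ ρ := by positivity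
  have hcn : ‖c‖ ≤ 3 / (2 * D) * (ρ + ε ^ 2 * β) := by
    refine hcn'.trans ?_
    rw [div_eq_mul_inv, mul_comm]
    gcongr
  -- Use (x + y)² ≤ 2x² + 2y²; the denominator is bounded below by 2D/3 for the ρ² part and by ε²
  -- for the ε⁴β² part, which leaves only ε²β².
  have hTcup : (inner ℂ (T c) c).re ≤ 3 / D * ρ ^ 2 + 2 * ε ^ 2 * β ^ 2 := by
    have h1 : (inner ℂ (T c) c).re ≤ (ρ + ε ^ 2 * β) * ((ρ + ε ^ 2 * β) / (2 * D / 3 + ε ^ 2)) := by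
      rw [hTc]
      refine (Complex.re_le_norm _).trans ((norm_inner_le_norm _ _).trans ?_)
      gcongr
    refine h1.trans ?_
    rw [← mul_div_assoc, div_le_iff₀ hc0]
    have e1 : 3 / D * ρ ^ 2 * (2 * D / 3) = 2 * ρ ^ 2 := by field_simp
    have h4 : 0 ≤ 3 / D * ρ ^ 2 * ε ^ 2 := by positivity
    have h5 : 0 ≤ 2 * ε ^ 2 * β ^ 2 * (2 * D / 3) := by positivity
    nlinarith [sq_nonneg (ρ - ε ^ 2 * β)]
  have hTc0 : 0 ≤ (inner ℂ (T c) c).re := le_trans (by positivity) (hTperp c hec)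
  -- The cross terms vanish because T(e + b) = S e and c ⊥ e; hence S is approximated with an error
  -- quadratic in c.
  have hexp : (inner ℂ (T (e + b₁)) (e + b₁)).re = S + (inner ℂ (T c) c).re := by
    have h2 : (inner ℂ (T c) (e + b)) = 0 := by rw [hT, hTq, inner_smul_right, hce, mul_zero]
    rw [hzq, map_add, inner_add_left, inner_add_right, inner_add_right (T c), hTq, h2,
      inner_smul_left, inner_smul_left, hec, inner_add_right, heb', inner_self_eq_norm_sq_to_K, he]
    simp
  have hnz : ‖e + b₁‖ ^ 2 = 1 + ‖b₁‖ ^ 2 := by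
    have := norm_add_sq (𝕜 := ℂ) e b₁
    rw [heb, he] at this
    simpa using this
  -- The factor 3 is 2 from (T c, c) plus 1 from ε²‖b₁‖².
  have hSG : |S - (g + ε ^ 2)| ≤ η * t ^ 4 + 3 * ε ^ 2 * β ^ 2 + 3 / D * ρ ^ 2 := by
    have h1 := hre (e + b₁)
    rw [hexp, hnz] at h1
    have h2 := abs_le.mp hform
    have h3 : ε ^ 2 * ‖b₁‖ ^ 2 ≤ ε ^ 2 * β ^ 2 := by gcongr
    have h4 : 0 ≤ ε ^ 2 * ‖b₁‖ ^ 2 := by positivity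
    have h5 : 0 ≤ 3 / D * ρ ^ 2 := by positivity
    rw [abs_le]
    constructor <;> nlinarith
  have hG : K * t ^ 2 + ε ^ 2 ≤ g + ε ^ 2 := by linarith
  set G : ℝ := g + ε ^ 2
  have hG0 : 0 < G := by linarith
  have hbnd := resolvent_scalar_bound hD hm₁ ht hK hη hε hS hG hβ hβ3 hρ hm₂ hSG hbn
    (norm_nonneg b) hcn
  refine le_trans (ContinuousLinearMap.opNorm_le_bound _ (by positivity) fun f => ?_) hbnd
  obtain ⟨X, hX⟩ := hunit
  have hXinv : Ring.inverse T = (↑X⁻¹ : H →L[ℂ] H) := by rw [← hX, Ring.inverse_unit]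
  set p : H := Ring.inverse T f with hp
  have hTp : T p = f := by
    have : (T * (↑X⁻¹ : H →L[ℂ] H)) f = f := by rw [← hX, Units.mul_inv]; rfl
    rw [hp, hXinv]; simpa using this
  -- Removing the rank-one part along e + b leaves the component of the resolvent in e^⊥. Its image
  -- under T is f minus a multiple of e, so the gap controls it.
  set h : H := p - ((S⁻¹ : ℝ) : ℂ) • (inner ℂ (e + b) f) • (e + b) with hh
  have hSc : (S : ℂ) ≠ 0 := by exact_mod_cast hS0.ne'
  have hpe : (inner ℂ e p) = ((S⁻¹ : ℝ) : ℂ) * (inner ℂ (e + b) f) := by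
    have h1 : (inner ℂ (e + b) f) = (S : ℂ) * (inner ℂ e p) := by
      rw [← hTp, ← hT, hTq, inner_smul_left, Complex.conj_ofReal]
    rw [h1]; push_cast; field_simp
  have heh : (inner ℂ e h) = 0 := by
    rw [hh, inner_sub_right, hpe, inner_smul_right, inner_smul_right, inner_add_right, heb',
      inner_self_eq_norm_sq_to_K, he]
    simp
  have hTh : T h = f - (inner ℂ (e + b) f) • e := by
    rw [hh, map_sub, hTp, map_smul, map_smul, hTq, smul_smul, smul_smul]
    congr 2
    push_cast; field_simp
  have hhn : ‖h‖ ≤ 3 / (2 * D) * ‖f‖ := by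
    have h3 := hTperp h heh
    have h4 : (inner ℂ (T h) h) = (inner ℂ f h) := by
      rw [hTh, inner_sub_left, inner_smul_left, heh, mul_zero, sub_zero]
    rw [h4] at h3
    refine (norm_le_of_coercive hc0 h3 le_rfl).trans ?_
    rw [div_eq_mul_inv, mul_comm]
    gcongr
  have hef : ‖(inner ℂ e f)‖ ≤ ‖f‖ := by simpa [he] using norm_inner_le_norm (𝕜 := ℂ) e f
  have hbf : ‖(inner ℂ b f)‖ ≤ ‖b‖ * ‖f‖ := norm_inner_le_norm b f
  have hcf : ‖(inner ℂ c f)‖ ≤ ‖c‖ * ‖f‖ := norm_inner_le_norm c f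
  have hb12 : ‖b‖ ≤ 1 / 2 := by linarith
  -- With b₁ = b + c the difference splits into the part in e^⊥, the change of scalar from S⁻¹ to
  -- G⁻¹, the corrector error c, and the quadratic term in b missing from the approximation.
  have key : (Ring.inverse T - ((G⁻¹ : ℝ) : ℂ) • (InnerProductSpace.rankOne ℂ e e +
        InnerProductSpace.rankOne ℂ b₁ e + InnerProductSpace.rankOne ℂ e b₁)) f =
      h + ((S⁻¹ - G⁻¹ : ℝ) : ℂ) • ((inner ℂ e f) • e + (inner ℂ e f) • b + (inner ℂ b f) • e) -
        ((G⁻¹ : ℝ) : ℂ) • ((inner ℂ e f) • c + (inner ℂ c f) • e) +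
        ((S⁻¹ : ℝ) : ℂ) • (inner ℂ b f) • b := by
    have hpeq : p = h + ((S⁻¹ : ℝ) : ℂ) • (inner ℂ (e + b) f) • (e + b) := by rw [hh]; abel
    have hb₁eq : b₁ = b + c := by rw [hcdef]; abel
    rw [_root_.sub_apply, ← hp, hpeq, hb₁eq]
    simp only [_root_.smul_apply, _root_.add_apply,
      InnerProductSpace.rankOne_apply, inner_add_left, smul_add, add_smul, Complex.ofReal_sub,
      sub_smul]
    abel
  rw [key]
  have n1 : ‖(inner ℂ e f) • e + (inner ℂ e f) • b + (inner ℂ b f) • e‖ ≤ 2 * ‖f‖ := by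
    refine norm_add₃_le.trans ?_
    simp only [norm_smul, he]
    have := norm_nonneg f
    have h1 : ‖(inner ℂ e f)‖ * ‖b‖ ≤ ‖f‖ * (1 / 2) := by gcongr
    have h2 : ‖b‖ * ‖f‖ ≤ 1 / 2 * ‖f‖ := by gcongr
    linarith
  have n2 : ‖(inner ℂ e f) • c + (inner ℂ c f) • e‖ ≤ 2 * ‖c‖ * ‖f‖ := by
    refine (norm_add_le _ _).trans ?_
    simp only [norm_smul, he]
    have h1 : ‖(inner ℂ e f)‖ * ‖c‖ ≤ ‖f‖ * ‖c‖ := by gcongr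
    linarith
  have n3 : ‖(inner ℂ b f) • b‖ ≤ ‖b‖ ^ 2 * ‖f‖ := by
    rw [norm_smul]
    calc _ ≤ (‖b‖ * ‖f‖) * ‖b‖ := by gcongr
      _ = _ := by ring
  calc _ ≤ ‖h‖ + ‖((S⁻¹ - G⁻¹ : ℝ) : ℂ) • ((inner ℂ e f) • e + (inner ℂ e f) • b + (inner ℂ b f) • e)‖ +
        ‖((G⁻¹ : ℝ) : ℂ) • ((inner ℂ e f) • c + (inner ℂ c f) • e)‖ + ‖((S⁻¹ : ℝ) : ℂ) • (inner ℂ b f) • b‖ :=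
        (norm_add_le _ _).trans (add_le_add_left ((norm_sub_le _ _).trans
          (add_le_add_left (norm_add_le _ _) _)) _)
    _ ≤ 3 / (2 * D) * ‖f‖ + |S⁻¹ - G⁻¹| * (2 * ‖f‖) + G⁻¹ * (2 * ‖c‖ * ‖f‖) +
        S⁻¹ * (‖b‖ ^ 2 * ‖f‖) := by
        rw [norm_smul _ (_ + _ + _), norm_smul _ (_ + _), norm_smul ((S⁻¹ : ℝ) : ℂ),
          Complex.norm_real, Complex.norm_real,
          Complex.norm_real, Real.norm_eq_abs, Real.norm_of_nonneg (inv_pos.mpr hG0).le,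
          Real.norm_of_nonneg (inv_pos.mpr hS0).le]
        gcongr
    _ = _ := by ring

end Abstract

/-! ### Spectral gap above a simple zero eigenvalue. -/

section Gap

variable {H : Type*} [NormedAddCommGroup H] [InnerProductSpace ℂ H]

theorem rankOne_self_mul_self {e : H} (he : ‖e‖ = 1) :
    InnerProductSpace.rankOne ℂ e e * InnerProductSpace.rankOne ℂ e e =
      InnerProductSpace.rankOne ℂ e e := by
  ext u
  simp [InnerProductSpace.rankOne_apply, inner_self_eq_norm_sq_to_K, he]

/-- As the projection P is idempotent, the inverse is 1 - c/(1 + c) P. -/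
theorem isUnit_one_add_smul_rankOne {e : H} (he : ‖e‖ = 1) {c : ℂ} (hc : 1 + c ≠ 0) :
    IsUnit (1 + c • InnerProductSpace.rankOne ℂ e e : H →L[ℂ] H) := by
  have hP := rankOne_self_mul_self he
  set P : H →L[ℂ] H := InnerProductSpace.rankOne ℂ e e
  have key : ∀ x y : ℂ, x + y + x * y = 0 → (1 + x • P) * (1 + y • P) = 1 := fun x y h => by
    have : (1 + x • P) * (1 + y • P) = 1 + (x + y + x * y) • P := by
      rw [mul_add, add_mul, add_mul, smul_mul_smul_comm, hP, add_smul, add_smul]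
      simp only [one_mul, mul_one]
      abel
    rw [this, h, zero_smul, add_zero]
  refine ⟨⟨_, 1 + (-c / (1 + c)) • P, key _ _ ?_, key _ _ ?_⟩, rfl⟩ <;> field_simp <;> ring

/-- Because A e = 0, z - (A + αP) factors as (z - A)(1 - (α/z)P) with invertible second factor.
Adding αP moves the eigenvalue at e from 0 to α and alters no other spectrum. -/
theorem isUnit_shift_iff {A : H →L[ℂ] H} {e : H} (he : ‖e‖ = 1) (hAe : A e = 0) {z α : ℂ}
    (hz : z ≠ 0) (hzα : z ≠ α) :
    IsUnit (algebraMap ℂ (H →L[ℂ] H) z - (A + α • InnerProductSpace.rankOne ℂ e e)) ↔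
      IsUnit (algebraMap ℂ (H →L[ℂ] H) z - A) := by
  have hu := isUnit_one_add_smul_rankOne he (c := -α / z)
    (by rw [Ne, div_eq_mul_inv]; intro h; field_simp at h; exact hzα (by linear_combination h))
  have hf : algebraMap ℂ (H →L[ℂ] H) z - (A + α • InnerProductSpace.rankOne ℂ e e) =
      (algebraMap ℂ (H →L[ℂ] H) z - A) * (1 + (-α / z) • InnerProductSpace.rankOne ℂ e e) := by
    ext u
    simp only [Algebra.algebraMap_eq_smul_one, _root_.sub_apply, _root_.smul_apply,
      _root_.add_apply, mul_apply_eq_comp, one_apply_eq_self,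
      InnerProductSpace.rankOne_apply, map_add, map_smul, hAe, sub_zero, smul_smul]
    have : -α / z * inner ℂ e u * z = -(α * inner ℂ e u) := by field_simp
    rw [this]
    module
  rw [hf, hu.mul_right_iff]

/-- The form of A does not see the e-component of u, so αP supplies exactly the coercivity missing
there. -/
theorem re_inner_add_rankOne {A : H →L[ℂ] H} (hA : ∀ x y, inner ℂ (A x) y = inner ℂ x (A y))
    {e : H} (he : ‖e‖ = 1) (hAe : A e = 0) {γ : ℝ}
    (hgap : ∀ u, inner ℂ e u = 0 → γ * ‖u‖ ^ 2 ≤ (inner ℂ (A u) u).re) {α : ℝ} (hα : γ ≤ α)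
    (u : H) :
    γ * ‖u‖ ^ 2 ≤
      (inner ℂ ((A + (α : ℂ) • InnerProductSpace.rankOne ℂ e e : H →L[ℂ] H) u) u).re := by
  set s : ℂ := inner ℂ e u with hs
  set w : H := u - s • e with hw
  have hee : inner ℂ e e = (1 : ℂ) := by rw [inner_self_eq_norm_sq_to_K, he]; simp
  have hew : inner ℂ e w = (0 : ℂ) := by
    rw [hw, inner_sub_right, inner_smul_right, hee, ← hs]; simp
  have hu : u = s • e + w := by rw [hw]; abel
  have hAu : A u = A w := by rw [hu, map_add, map_smul, hAe]; simp
  have h1 : inner ℂ (A u) u = inner ℂ (A w) w := by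
    rw [hAu]; nth_rw 1 [hu]
    rw [inner_add_right, inner_smul_right, hA w e, hAe, inner_zero_right]; simp
  have hn : ‖u‖ ^ 2 = ‖s‖ ^ 2 + ‖w‖ ^ 2 := by
    have h0 := norm_add_sq (𝕜 := ℂ) (s • e) w
    rw [← hu, inner_smul_left, hew, norm_smul, he] at h0
    simpa using h0
  have h2 : (inner ℂ ((A + (α : ℂ) • InnerProductSpace.rankOne ℂ e e : H →L[ℂ] H) u) u) =
      inner ℂ (A w) w + ((α * ‖s‖ ^ 2 : ℝ) : ℂ) := by
    rw [_root_.add_apply, inner_add_left, h1, _root_.smul_apply, InnerProductSpace.rankOne_apply,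
      inner_smul_left, inner_smul_left, ← hs, Complex.conj_ofReal, mul_comm (starRingEnd ℂ s),
      Complex.mul_conj, Complex.normSq_eq_norm_sq]
    push_cast; ring
  rw [h2, Complex.add_re, Complex.ofReal_re, hn]
  nlinarith [hgap w hew, sq_nonneg ‖s‖]

variable [CompleteSpace H]

/-- After the zero eigenvalue is moved to γ the operator is bounded below by γ, hence remains
invertible after subtraction of any z with |z| < γ. -/
theorem le_norm_of_mem_spectrum {A : H →L[ℂ] H} (hA : ∀ x y, inner ℂ (A x) y = inner ℂ x (A y))
    {e : H} (he : ‖e‖ = 1) (hAe : A e = 0) {γ : ℝ}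
    (hgap : ∀ u, inner ℂ e u = 0 → γ * ‖u‖ ^ 2 ≤ (inner ℂ (A u) u).re) {z : ℂ}
    (hz : z ∈ spectrum ℂ A) (hz0 : z ≠ 0) : γ ≤ ‖z‖ := by
  by_contra! h
  refine hz ?_
  rw [spectrum.mem_resolventSet_iff]
  have hne : z ≠ (γ : ℂ) := by
    rintro rfl
    rw [Complex.norm_real, Real.norm_eq_abs] at h
    exact absurd (le_abs_self γ) (not_le.mpr h)
  rw [← isUnit_shift_iff he hAe hz0 hne, ← IsUnit.neg_iff]
  refine isUnit_of_re_inner_ge _ (c := γ - ‖z‖) (by linarith) fun u => ?_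
  rw [neg_sub, _root_.sub_apply, inner_sub_left, Complex.sub_re, Algebra.algebraMap_eq_smul_one]
  have h1 := re_inner_add_rankOne hA he hAe hgap le_rfl u
  have h2 : (inner ℂ ((z • (1 : H →L[ℂ] H)) u) u).re ≤ ‖z‖ * ‖u‖ ^ 2 := by
    refine (Complex.re_le_norm _).trans ((norm_inner_le_norm _ _).trans (le_of_eq ?_))
    rw [_root_.smul_apply, one_apply_eq_self, norm_smul]; ring
  linarith

/-- For a self-adjoint operator the spectral radius is the norm. Nonemptiness is needed to bound the
distance from below, since `Metric.infDist` to the empty set is 0. -/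
theorem spectrum_diff_zero_nonempty {A : H →L[ℂ] H}
    (hA : ∀ x y, inner ℂ (A x) y = inner ℂ x (A y)) (h0 : A ≠ 0) :
    (spectrum ℂ A \ {0}).Nonempty := by
  by_contra hempty
  rw [Set.not_nonempty_iff_eq_empty, Set.sdiff_eq_empty] at hempty
  have hsa : IsSelfAdjoint A := ContinuousLinearMap.isSelfAdjoint_iff_isSymmetric.mpr hA
  have h1 := hsa.spectralRadius_eq_nnnorm
  have h2 : spectralRadius ℂ A = 0 := by
    rw [spectralRadius]
    refine le_antisymm (iSup₂_le fun k hk => ?_) zero_le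
    have := hempty hk
    rw [Set.mem_singleton_iff] at this
    simp [this]
  rw [h2] at h1
  exact h0 (by simpa using h1.symm)

/-- Improves an a priori gap γ to the sharp one, the distance δ itself: moving the zero eigenvalue
to δ puts the whole spectrum in [δ, ∞), which for a self-adjoint operator is an inequality between
forms. -/
theorem infDist_spectrum_gap {A : H →L[ℂ] H} (hA : ∀ x y, inner ℂ (A x) y = inner ℂ x (A y))
    {e : H} (he : ‖e‖ = 1) (hAe : A e = 0) {γ : ℝ} (hγ : 0 < γ)
    (hgap : ∀ u, inner ℂ e u = 0 → γ * ‖u‖ ^ 2 ≤ (inner ℂ (A u) u).re) (u : H)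
    (hu : inner ℂ e u = 0) :
    Metric.infDist (0 : ℂ) (spectrum ℂ A \ {0}) * ‖u‖ ^ 2 ≤ (inner ℂ (A u) u).re := by
  set δ := Metric.infDist (0 : ℂ) (spectrum ℂ A \ {0}) with hδ
  -- The first case also absorbs an empty punctured spectrum, where δ = 0.
  rcases le_or_gt δ γ with h | hδγ
  · exact (mul_le_mul_of_nonneg_right h (by positivity)).trans (hgap u hu)
  set B : H →L[ℂ] H := A + (δ : ℂ) • InnerProductSpace.rankOne ℂ e e with hB
  have hBsym : ∀ x y, inner ℂ (B x) y = inner ℂ x (B y) := fun x y => by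
    simp only [hB, _root_.add_apply, _root_.smul_apply, InnerProductSpace.rankOne_apply,
      inner_add_left, inner_add_right, inner_smul_left, inner_smul_right, hA, Complex.conj_ofReal,
      inner_conj_symm]
    ring
  have hBsa : IsSelfAdjoint B := ContinuousLinearMap.isSelfAdjoint_iff_isSymmetric.mpr hBsym
  have hle : algebraMap ℝ (H →L[ℂ] H) δ ≤ B := by
    rw [algebraMap_le_iff_le_spectrum hBsa]
    intro l hl
    by_contra! hlt
    refine hl ?_
    rw [spectrum.mem_resolventSet_iff]
    have hcast : algebraMap ℝ (H →L[ℂ] H) l = algebraMap ℂ (H →L[ℂ] H) (l : ℂ) := by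
      rw [Algebra.algebraMap_eq_smul_one, Algebra.algebraMap_eq_smul_one]; rfl
    rw [hcast]
    -- Nonpositive l are excluded by coercivity with the a priori γ; for 0 < l < δ the shift leads
    -- back to A, where l is closer to 0 than any nonzero spectral point.
    rcases le_or_gt l 0 with hl0 | hl0
    · rw [← IsUnit.neg_iff]
      refine isUnit_of_re_inner_ge _ hγ fun w => ?_
      rw [neg_sub, _root_.sub_apply, inner_sub_left, Complex.sub_re,
        Algebra.algebraMap_eq_smul_one, _root_.smul_apply, one_apply_eq_self,
        inner_smul_left, inner_self_eq_norm_sq_to_K, Complex.conj_ofReal]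
      have h1 := re_inner_add_rankOne hA he hAe hgap hδγ.le w
      have h2 : ((l : ℂ) * ((‖w‖ : ℝ) : ℂ) ^ 2).re = l * ‖w‖ ^ 2 := by norm_cast
      have h3 : l * ‖w‖ ^ 2 ≤ 0 := mul_nonpos_of_nonpos_of_nonneg hl0 (by positivity)
      have h4 : (((l : ℂ) * ((‖w‖ : ℂ)) ^ 2)).re ≤ 0 := by rw [h2]; exact h3
      simp only [Complex.coe_algebraMap] at *
      linarith
    · rw [isUnit_shift_iff he hAe (by exact_mod_cast hl0.ne') (by exact_mod_cast hlt.ne)]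
      by_contra hnu
      have hmem : (l : ℂ) ∈ spectrum ℂ A \ {0} :=
        ⟨hnu, by simpa using hl0.ne'⟩
      have := Metric.infDist_le_dist_of_mem (x := (0 : ℂ)) hmem
      rw [dist_zero_left, Complex.norm_real, Real.norm_of_nonneg hl0.le] at this
      linarith
  have hpos := ((ContinuousLinearMap.le_def _ _).mp hle).re_inner_nonneg_left u
  have hBu : B u = A u := by
    rw [hB, _root_.add_apply, _root_.smul_apply, InnerProductSpace.rankOne_apply, hu]; simp
  rw [_root_.sub_apply, hBu, inner_sub_left, Algebra.algebraMap_eq_smul_one, _root_.smul_apply,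
    one_apply_eq_self, ← Complex.coe_smul, inner_smul_left,
    inner_self_eq_norm_sq_to_K, Complex.conj_ofReal] at hpos
  have h2 : RCLike.re ((δ : ℂ) * ((‖u‖ : ℝ) : ℂ) ^ 2) = δ * ‖u‖ ^ 2 := by norm_cast
  have h4 : RCLike.re ((δ : ℂ) * ((‖u‖ : ℂ)) ^ 2) = δ * ‖u‖ ^ 2 := h2
  rw [map_sub] at hpos
  simp only [Complex.coe_algebraMap] at *
  rw [h4] at hpos
  simpa using hpos

/-- Fredholm alternative: solve with the coercive operator A + γP instead. Pairing the equation with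
e then shows that the added term is zero. -/
theorem exists_solution_of_gap {A : H →L[ℂ] H}
    (hA : ∀ x y, inner ℂ (A x) y = inner ℂ x (A y))
    {e : H} (he : ‖e‖ = 1) (hAe : A e = 0) {γ : ℝ} (hγ : 0 < γ)
    (hgap : ∀ u, inner ℂ e u = 0 → γ * ‖u‖ ^ 2 ≤ (inner ℂ (A u) u).re) {f : H}
    (hf : inner ℂ e f = 0) : ∃ u, A u = f ∧ inner ℂ e u = 0 := by
  obtain ⟨X, hX⟩ := isUnit_of_re_inner_ge _ hγ (re_inner_add_rankOne hA he hAe hgap le_rfl)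
  set u : H := (↑X⁻¹ : H →L[ℂ] H) f with hu
  have hTu : (A + (γ : ℂ) • InnerProductSpace.rankOne ℂ e e : H →L[ℂ] H) u = f := by
    rw [← hX, hu, ← mul_apply_eq_comp, Units.mul_inv, one_apply_eq_self]
  rw [_root_.add_apply, _root_.smul_apply, InnerProductSpace.rankOne_apply] at hTu
  have heu : inner ℂ e u = (0 : ℂ) := by
    have h1 := hf
    rw [← hTu, inner_add_right, ← hA, hAe, inner_zero_left, inner_smul_right, inner_smul_right,
      inner_self_eq_norm_sq_to_K, he] at h1
    have : (γ : ℂ) ≠ 0 := by exact_mod_cast hγ.ne'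
    simpa [this] using h1
  refine ⟨u, ?_, heu⟩
  rwa [heu, zero_smul, smul_zero, add_zero] at hTu

end Gap

/-! ### Quadratic forms and norms of integral operators. -/

section Schur

variable {α : Type*} [MeasurableSpace α] {ν : Measure α} [SFinite ν]

theorem ennreal_sq_rpow_half (t : ℝ≥0∞) : (t ^ 2) ^ (1 / 2 : ℝ) = t := by
  rw [← ENNReal.rpow_two, ← ENNReal.rpow_mul]; norm_num

theorem eLpNorm_two_eq {α : Type*} [MeasurableSpace α] {ν : Measure α} (u : α → ℂ) :
    eLpNorm u 2 ν = (∫⁻ x, ‖u x‖ₑ ^ 2 ∂ν) ^ (1 / 2 : ℝ) := by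
  rw [eLpNorm_eq_lintegral_rpow_enorm_toReal (by norm_num) (by norm_num)]
  simp only [ENNReal.toReal_ofNat, ENNReal.rpow_two]

/-- The Schur test for the sesquilinear form of a kernel. -/
theorem schur_form_le {k : α → α → ℂ}
    (hk : AEStronglyMeasurable (Function.uncurry k) (ν.prod ν)) {M : ℝ≥0}
    (h1 : ∀ᵐ x ∂ν, ∫⁻ y, ‖k x y‖ₑ ∂ν ≤ M) (h2 : ∀ᵐ y ∂ν, ∫⁻ x, ‖k x y‖ₑ ∂ν ≤ M)
    {u w : α → ℂ} (hu : AEStronglyMeasurable u ν) (hw : AEStronglyMeasurable w ν) :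
    ∫⁻ q, ‖k q.1 q.2 * u q.2 * w q.1‖ₑ ∂(ν.prod ν) ≤ M * eLpNorm u 2 ν * eLpNorm w 2 ν := by
  have hm : AEMeasurable (fun q : α × α => ‖k q.1 q.2 * u q.2‖ₑ) (ν.prod ν) :=
    (hk.mul hu.comp_snd).enorm
  have hm2 : AEMeasurable (fun q : α × α => ‖k q.1 q.2 * u q.2 * w q.1‖ₑ) (ν.prod ν) :=
    ((hk.mul hu.comp_snd).mul hw.comp_fst).enorm
  rw [lintegral_prod _ hm2]
  have hin : AEMeasurable (fun x => ∫⁻ y, ‖k x y * u y‖ₑ ∂ν) ν := hm.lintegral_prod_right'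
  calc ∫⁻ x, ∫⁻ y, ‖k x y * u y * w x‖ₑ ∂ν ∂ν
      = ∫⁻ x, (∫⁻ y, ‖k x y * u y‖ₑ ∂ν) * ‖w x‖ₑ ∂ν := by
        refine lintegral_congr fun x => ?_
        rw [← lintegral_mul_const' _ _ enorm_ne_top]
        simp only [enorm_mul]
    _ ≤ (∫⁻ x, (∫⁻ y, ‖k x y * u y‖ₑ ∂ν) ^ (2 : ℝ) ∂ν) ^ (1 / 2 : ℝ) *
        (∫⁻ x, ‖w x‖ₑ ^ (2 : ℝ) ∂ν) ^ (1 / 2 : ℝ) :=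
        ENNReal.lintegral_mul_le_Lp_mul_Lq ν Real.HolderConjugate.two_two hin hw.enorm
    _ ≤ ((M : ℝ≥0∞) ^ 2 * ∫⁻ y, ‖u y‖ₑ ^ 2 ∂ν) ^ (1 / 2 : ℝ) *
        (∫⁻ x, ‖w x‖ₑ ^ (2 : ℝ) ∂ν) ^ (1 / 2 : ℝ) := by
        gcongr
        simp only [ENNReal.rpow_two]
        exact schur_lintegral hk h1 h2 hu
    _ = _ := by
        rw [ENNReal.mul_rpow_of_nonneg _ _ (by norm_num), ennreal_sq_rpow_half, eLpNorm_two_eq,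
          eLpNorm_two_eq]
        simp only [ENNReal.rpow_two]

/-- This is what permits Fubini whenever a form is written as a double integral. -/
theorem SchurKernel.integrable_form {k : α → α → ℂ} (h : SchurKernel ν k) {u w : α → ℂ}
    (hu : MemLp u 2 ν) (hw : MemLp w 2 ν) :
    Integrable (fun q : α × α => k q.1 q.2 * u q.2 * w q.1) (ν.prod ν) := by
  obtain ⟨M, h1, h2⟩ := h.bound
  refine ⟨(h.aesm.mul hu.1.comp_snd).mul hw.1.comp_fst, ?_⟩
  exact lt_of_le_of_lt (schur_form_le h.aesm h1 h2 hu.1 hw.1)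
    (ENNReal.mul_lt_top (ENNReal.mul_lt_top (by simp) hu.2) hw.2)

/-- Serves the diagonal part of the form, where v is the integrable function |u|² and only the row
bound is required. -/
theorem SchurKernel.integrable_fst {k : α → α → ℂ} (h : SchurKernel ν k) {v : α → ℂ}
    (hv : Integrable v ν) : Integrable (fun q : α × α => k q.1 q.2 * v q.1) (ν.prod ν) := by
  obtain ⟨M, h1, -⟩ := h.bound
  have hm : AEStronglyMeasurable (fun q : α × α => k q.1 q.2 * v q.1) (ν.prod ν) :=
    h.aesm.mul hv.1.comp_fst
  refine ⟨hm, ?_⟩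
  rw [HasFiniteIntegral, lintegral_prod _ hm.enorm]
  calc ∫⁻ x, ∫⁻ y, ‖k x y * v x‖ₑ ∂ν ∂ν ≤ ∫⁻ x, M * ‖v x‖ₑ ∂ν := by
        refine lintegral_mono_ae ?_
        filter_upwards [h1] with x hx
        simp only [enorm_mul]
        rw [lintegral_mul_const' _ _ enorm_ne_top]
        gcongr
    _ = M * ∫⁻ x, ‖v x‖ₑ ∂ν := lintegral_const_mul' _ _ ENNReal.coe_ne_top
    _ < ∞ := ENNReal.mul_lt_top (by simp) hv.2

theorem inner_integralOp {k : α → α → ℂ} (h : SchurKernel ν k) (u w : Lp ℂ 2 ν) :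
    inner ℂ w (integralOp h u) =
      ∫ q, k q.1 q.2 * u q.2 * (starRingEnd ℂ) (w q.1) ∂(ν.prod ν) := by
  have hw : MemLp (fun x => (starRingEnd ℂ) (w x)) 2 ν := (Lp.memLp w).star
  rw [integral_prod _ (h.integrable_form (Lp.memLp u) hw), L2.inner_def]
  refine integral_congr_ae ?_
  filter_upwards [integralOp_apply h u] with x hx
  rw [hx, RCLike.inner_apply, integral_mul_const]

theorem integralOp_symm {k : α → α → ℂ} (h : SchurKernel ν k)
    (hs : ∀ x y, k y x = (starRingEnd ℂ) (k x y)) (u w : Lp ℂ 2 ν) :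
    inner ℂ (integralOp h u) w = inner ℂ u (integralOp h w) := by
  rw [← inner_conj_symm, inner_integralOp, inner_integralOp, ← integral_conj,
    ← integral_prod_swap]
  refine integral_congr_ae (Filter.Eventually.of_forall fun q => ?_)
  simp only [Prod.fst_swap, Prod.snd_swap, map_mul, Complex.conj_conj, hs q.1 q.2]
  ring

/-- Makes the Schur constant explicit; the construction of `integralOp` retains only that some bound
exists. -/
theorem norm_integralOp_le {k : α → α → ℂ} (h : SchurKernel ν k) {M : ℝ≥0}
    (h1 : ∀ᵐ x ∂ν, ∫⁻ y, ‖k x y‖ₑ ∂ν ≤ M) (h2 : ∀ᵐ y ∂ν, ∫⁻ x, ‖k x y‖ₑ ∂ν ≤ M) :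
    ‖integralOp h‖ ≤ M := by
  refine ContinuousLinearMap.opNorm_le_bound _ M.2 fun u => ?_
  rw [Lp.norm_def, Lp.norm_def, eLpNorm_congr_ae (integralOp_apply h u), ← ENNReal.coe_toReal,
    ← ENNReal.toReal_mul]
  refine ENNReal.toReal_mono (ENNReal.mul_ne_top (by simp) (Lp.memLp u).2.ne) ?_
  rw [eLpNorm_two_eq]
  calc (∫⁻ x, ‖∫ y, k x y * u y ∂ν‖ₑ ^ 2 ∂ν) ^ (1/2 : ℝ)
      ≤ ((M : ℝ≥0∞) ^ 2 * ∫⁻ y, ‖u y‖ₑ ^ 2 ∂ν) ^ (1/2 : ℝ) := by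
        refine ENNReal.rpow_le_rpow (le_trans (lintegral_mono fun x => ?_)
          (schur_lintegral h.aesm h1 h2 (Lp.memLp u).1)) (by norm_num)
        gcongr
        exact enorm_integral_le_lintegral_enorm _
    _ = _ := by rw [ENNReal.mul_rpow_of_nonneg _ _ (by norm_num), ennreal_sq_rpow_half,
                  eLpNorm_two_eq]

theorem SchurKernel.sub {k₁ k₂ : α → α → ℂ} (h₁ : SchurKernel ν k₁) (h₂ : SchurKernel ν k₂) :
    SchurKernel ν (fun x y => k₁ x y - k₂ x y) := by
  obtain ⟨M, a1, a2⟩ := h₁.bound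
  obtain ⟨N, b1, b2⟩ := h₂.bound
  refine ⟨h₁.aesm.sub h₂.aesm, M + N, ?_, ?_⟩
  · filter_upwards [a1, b1, h₁.aesm.prodMk_left] with x ha hb hm
    calc ∫⁻ y, ‖k₁ x y - k₂ x y‖ₑ ∂ν ≤ ∫⁻ y, (‖k₁ x y‖ₑ + ‖k₂ x y‖ₑ) ∂ν :=
          lintegral_mono fun y => enorm_sub_le
      _ = ∫⁻ y, ‖k₁ x y‖ₑ ∂ν + ∫⁻ y, ‖k₂ x y‖ₑ ∂ν := lintegral_add_left' hm.enorm _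
      _ ≤ _ := by push_cast; gcongr
  · filter_upwards [a2, b2, h₁.aesm.prod_swap.prodMk_left] with y ha hb hm
    calc ∫⁻ x, ‖k₁ x y - k₂ x y‖ₑ ∂ν ≤ ∫⁻ x, (‖k₁ x y‖ₑ + ‖k₂ x y‖ₑ) ∂ν :=
          lintegral_mono fun x => enorm_sub_le
      _ = ∫⁻ x, ‖k₁ x y‖ₑ ∂ν + ∫⁻ x, ‖k₂ x y‖ₑ ∂ν := lintegral_add_left' hm.enorm _
      _ ≤ _ := by push_cast; gcongr

theorem integralOp_sub {k₁ k₂ : α → α → ℂ} (h₁ : SchurKernel ν k₁) (h₂ : SchurKernel ν k₂) :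
    integralOp h₁ - integralOp h₂ = integralOp (h₁.sub h₂) := by
  ext1 u
  refine Lp.ext ?_
  filter_upwards [Lp.coeFn_sub (integralOp h₁ u) (integralOp h₂ u), integralOp_apply h₁ u,
    integralOp_apply h₂ u, integralOp_apply (h₁.sub h₂) u, h₁.integrable (Lp.memLp u),
    h₂.integrable (Lp.memLp u)] with x e0 e1 e2 e3 i1 i2
  rw [_root_.sub_apply, e0, Pi.sub_apply, e1, e2, e3, ← integral_sub i1 i2]
  simp only [sub_mul]

end Schur

/-! ### Tiling of ℝ^d by translates of the cell, and periodic functions. -/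

section Unfold

variable {d : ℕ}

theorem exists_mem_cell_translate (y : Rd d) : ∃ n : Fin d → ℤ, y - latVec n ∈ cell d := by
  refine ⟨fun i => ⌊y i⌋, fun i => ?_⟩
  simp only [latVec, PiLp.sub_apply]
  exact ⟨by linarith [Int.floor_le (y i)], by linarith [Int.lt_floor_add_one (y i)]⟩

theorem iUnion_cell_translate :
    (⋃ n : Fin d → ℤ, (fun y : Rd d => y - latVec n) ⁻¹' cell d) = Set.univ := by
  refine Set.eq_univ_of_forall fun y => ?_
  obtain ⟨n, hn⟩ := exists_mem_cell_translate y
  exact Set.mem_iUnion.mpr ⟨n, hn⟩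

theorem measurableSet_cell_translate (n : Fin d → ℤ) :
    MeasurableSet ((fun y : Rd d => y - latVec n) ⁻¹' cell d) :=
  (measurable_sub_const _) (measurableSet_cell d)

theorem pairwise_disjoint_cell_translate :
    Pairwise (Function.onFun Disjoint
      fun n : Fin d → ℤ => (fun y : Rd d => y - latVec n) ⁻¹' cell d) := by
  intro m n hmn
  refine Set.disjoint_left.mpr fun y hy hz => hmn ?_
  funext i
  have h1 := hy i
  have h2 := hz i
  simp only [latVec, PiLp.sub_apply] at h1 h2
  have : |((m i : ℝ) - n i)| < 1 := by rw [abs_lt]; constructor <;> linarith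
  have h3 : |m i - n i| < 1 := by exact_mod_cast this
  rw [Int.abs_lt_one_iff] at h3
  omega

theorem measurePreserving_cell_translate (n : Fin d → ℤ) :
    MeasurePreserving (fun y : Rd d => y + latVec n) (cellMeasure d)
      (volume.restrict ((fun y : Rd d => y - latVec n) ⁻¹' cell d)) := by
  have h := (measurePreserving_add_right (volume : Measure (Rd d)) (latVec n)).restrict_preimage
    (measurableSet_cell_translate n)
  have e : (fun y : Rd d => y + latVec n) ⁻¹' ((fun y : Rd d => y - latVec n) ⁻¹' cell d) =
      cell d := by ext y; simp
  rwa [e] at h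

theorem lintegral_unfold (f : Rd d → ℝ≥0∞) :
    ∫⁻ y, f y = ∑' n : Fin d → ℤ, ∫⁻ y in cell d, f (y + latVec n) := by
  rw [← setLIntegral_univ, ← iUnion_cell_translate,
    lintegral_iUnion measurableSet_cell_translate pairwise_disjoint_cell_translate]
  refine tsum_congr fun n => ?_
  exact ((measurePreserving_cell_translate n).lintegral_comp_emb
    (MeasurableEquiv.addRight (latVec n)).measurableEmbedding f).symm

theorem aesm_comp_translate {E : Type*} [NormedAddCommGroup E] {f : Rd d → E}
    (hf : AEStronglyMeasurable f volume) (v : Rd d) :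
    AEStronglyMeasurable (fun z => f (z + v)) volume :=
  hf.comp_quasiMeasurePreserving
    (measurePreserving_add_right (volume : Measure (Rd d)) v).quasiMeasurePreserving

/-- The cells tile the space without overlap; integrability of f allows sum and integral to be
interchanged. -/
theorem integral_unfold {E : Type*} [NormedAddCommGroup E] [NormedSpace ℝ E] {f : Rd d → E}
    (hf : Integrable f) :
    ∫ y, f y = ∫ y in cell d, ∑' n : Fin d → ℤ, f (y + latVec n) := by
  rw [integral_tsum (fun n => (aesm_comp_translate hf.1 _).restrict)
    (by rw [← lintegral_unfold fun y => ‖f y‖ₑ]; exact hf.2.ne), ← setIntegral_univ,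
    ← iUnion_cell_translate, integral_iUnion measurableSet_cell_translate
    pairwise_disjoint_cell_translate hf.integrableOn]
  refine tsum_congr fun n => ?_
  exact ((measurePreserving_cell_translate n).integral_comp
    (MeasurableEquiv.addRight (latVec n)).measurableEmbedding f).symm

theorem latVec_neg (n : Fin d → ℤ) : latVec (-n) = -latVec n := by
  ext i; simp [latVec]

theorem latVec_zero : latVec (0 : Fin d → ℤ) = 0 := by
  ext i; simp [latVec]

/-- Sums over lattice translates along `x - y`, as a function of `y`. -/
theorem lintegral_cell_sub_tsum {g : Rd d → ℝ≥0∞} (hg : AEMeasurable g) (x : Rd d) :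
    ∫⁻ y in cell d, ∑' n : Fin d → ℤ, g (x - y + latVec n) = ∫⁻ z, g z := by
  have hm : ∀ n : Fin d → ℤ, AEMeasurable (fun y : Rd d => g (x - y + latVec n))
      (volume.restrict (cell d)) := fun n =>
    (hg.comp_quasiMeasurePreserving
      ((measurePreserving_add_right (volume : Measure (Rd d)) (latVec n)).comp
        (Measure.measurePreserving_sub_left volume x)).quasiMeasurePreserving).restrict
  -- Moving y by n moves x - y by -n, hence the reindexing by negation.
  rw [lintegral_tsum hm, ← lintegral_sub_left_eq_self g x, lintegral_unfold,
    ← (Equiv.neg (Fin d → ℤ)).tsum_eq]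
  refine tsum_congr fun n => lintegral_congr fun y => ?_
  rw [Equiv.neg_apply, latVec_neg]
  congr 1; abel

theorem lintegral_cell_sub_tsum' {g : Rd d → ℝ≥0∞} (hg : AEMeasurable g) (y : Rd d) :
    ∫⁻ x in cell d, ∑' n : Fin d → ℤ, g (x - y + latVec n) = ∫⁻ z, g z := by
  have hm : ∀ n : Fin d → ℤ, AEMeasurable (fun x : Rd d => g (x - y + latVec n))
      (volume.restrict (cell d)) := fun n =>
    (hg.comp_quasiMeasurePreserving
      ((measurePreserving_add_right (volume : Measure (Rd d)) (latVec n)).comp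
        (measurePreserving_sub_right volume y)).quasiMeasurePreserving).restrict
  rw [lintegral_tsum hm, ← lintegral_sub_right_eq_self g y, lintegral_unfold]
  refine tsum_congr fun n => lintegral_congr fun x => ?_
  congr 1; abel

/-- The periodic extension of a function on the cell. -/
noncomputable def periodize {E : Type*} (u : Rd d → E) (x : Rd d) : E :=
  u (x - latVec fun i => ⌊x i⌋)

theorem periodize_add {E : Type*} (u : Rd d → E) (x : Rd d) (n : Fin d → ℤ) :
    periodize u (x + latVec n) = periodize u x := by
  unfold periodize
  congr 1
  ext i; simp [latVec]

theorem periodize_of_mem {E : Type*} (u : Rd d → E) {x : Rd d} (hx : x ∈ cell d) :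
    periodize u x = u x := by
  unfold periodize
  congr 1
  ext i
  have := Int.floor_eq_zero_iff.mpr (hx i)
  simp [latVec, this]

/-- Countably many translates cover the space, and a translation-invariant property holds almost
everywhere on each of them. -/
theorem ae_of_ae_cell {p : Rd d → Prop} (hp : ∀ x (n : Fin d → ℤ), p (x + latVec n) ↔ p x)
    (h : ∀ᵐ x ∂cellMeasure d, p x) : ∀ᵐ x : Rd d, p x := by
  have h1 : ∀ n : Fin d → ℤ,
      ∀ᵐ x ∂(volume.restrict ((fun y : Rd d => y - latVec n) ⁻¹' cell d)), p x := fun n => by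
    have hemb : MeasurableEmbedding (fun y : Rd d => y + latVec n) :=
      (MeasurableEquiv.addRight (latVec n)).measurableEmbedding
    rw [← (measurePreserving_cell_translate n).map_eq, hemb.ae_map_iff]
    filter_upwards [h] with x hx using (hp x n).mpr hx
  rw [← Measure.restrict_univ (μ := (volume : Measure (Rd d))), ← iUnion_cell_translate,
    ae_restrict_iUnion_iff]
  exact h1

theorem aesm_of_periodic {E : Type*} [NormedAddCommGroup E] {ψ : Rd d → E}
    (hp : ∀ x (n : Fin d → ℤ), ψ (x + latVec n) = ψ x)
    (hm : AEStronglyMeasurable ψ (cellMeasure d)) : AEStronglyMeasurable ψ volume := by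
  rw [← Measure.restrict_univ (μ := (volume : Measure (Rd d))), ← iUnion_cell_translate,
    aestronglyMeasurable_iUnion_iff]
  intro n
  rw [← (measurePreserving_cell_translate n).aestronglyMeasurable_comp_iff
    (MeasurableEquiv.addRight (latVec n)).measurableEmbedding]
  refine hm.congr (Filter.Eventually.of_forall fun x => (hp x n).symm)

end Unfold

/-! ### The fiber operator: periodic representation, symmetry, kernel estimates. -/

section Fiber

variable {d : ℕ} {a : Rd d → ℝ} {μ : Rd d → Rd d → ℝ} {μm μp : ℝ}

theorem norm_exp_phase (s : ℝ) : ‖Complex.exp (-Complex.I * (s : ℂ))‖ = 1 := by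
  rw [Complex.norm_exp]; simp

theorem summable_of_enorm {z : Rd d} (hz : ∑' n : Fin d → ℤ, ‖a (z + latVec n)‖ₑ < ∞) :
    Summable fun n : Fin d → ℤ => a (z + latVec n) := by
  refine Summable.of_norm ?_
  exact NNReal.summable_coe.mpr (tsum_enorm_ne_top_iff_summable_nnnorm.mp hz.ne)

theorem summable_phase {z : Rd d} (hz : ∑' n : Fin d → ℤ, ‖a (z + latVec n)‖ₑ < ∞) (ξ : Rd d) :
    Summable fun n : Fin d → ℤ => (a (z + latVec n) : ℂ) *
      Complex.exp (-Complex.I * (⟪ξ, z + latVec n⟫ : ℝ)) := by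
  refine Summable.of_norm ?_
  refine (summable_of_enorm hz).norm.congr fun n => ?_
  rw [norm_mul, norm_exp_phase, Complex.norm_real, mul_one]

theorem aTilde_zero (a : Rd d → ℝ) (z : Rd d) :
    aTilde a 0 z = ((∑' n : Fin d → ℤ, a (z + latVec n) : ℝ) : ℂ) := by
  rw [Complex.ofReal_tsum]
  exact tsum_congr fun n => by simp

/-- The phases have modulus 1 and a ≥ 0, so the triangle inequality compares with ξ = 0.
Nonnegativity of the form density rests on this. -/
theorem aTilde_norm_le (ha : ∀ x, 0 ≤ a x) {z : Rd d}
    (hz : ∑' n : Fin d → ℤ, ‖a (z + latVec n)‖ₑ < ∞) (ξ : Rd d) :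
    ‖aTilde a ξ z‖ ≤ (aTilde a 0 z).re := by
  rw [aTilde_zero, Complex.ofReal_re]
  have hs : Summable fun n : Fin d → ℤ => ‖(a (z + latVec n) : ℂ) *
      Complex.exp (-Complex.I * (⟪ξ, z + latVec n⟫ : ℝ))‖ := (summable_phase hz ξ).norm
  refine (norm_tsum_le_tsum_norm hs).trans (le_of_eq (tsum_congr fun n => ?_))
  rw [norm_mul, norm_exp_phase, Complex.norm_real, mul_one, Real.norm_of_nonneg (ha _)]

theorem enorm_aTilde_zero (ha : ∀ x, 0 ≤ a x) {z : Rd d}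
    (hz : ∑' n : Fin d → ℤ, ‖a (z + latVec n)‖ₑ < ∞) :
    ‖aTilde a 0 z‖ₑ = ∑' n : Fin d → ℤ, ‖a (z + latVec n)‖ₑ := by
  have hnn : ∀ n : Fin d → ℤ, ‖a (z + latVec n)‖ₑ = ENNReal.ofReal (a (z + latVec n)) :=
    fun n => by rw [← ofReal_norm, Real.norm_of_nonneg (ha _)]
  rw [aTilde_zero, ← ofReal_norm, Complex.norm_real,
    Real.norm_of_nonneg (tsum_nonneg fun n => ha _),
    ENNReal.ofReal_tsum_of_nonneg (fun n => ha _) (summable_of_enorm hz)]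
  exact tsum_congr fun n => (hnn n).symm

/-- Reindex by n ↦ -n and use evenness of a. With the symmetry of μ this makes the kernel Hermitian.
-/
theorem aTilde_neg (he : ∀ x, a (-x) = a x) (ξ z : Rd d) :
    aTilde a ξ (-z) = (starRingEnd ℂ) (aTilde a ξ z) := by
  unfold aTilde
  rw [Complex.conj_tsum, ← (Equiv.neg (Fin d → ℤ)).tsum_eq]
  refine tsum_congr fun n => ?_
  have e : -z + latVec (-n) = -(z + latVec n) := by rw [latVec_neg]; abel
  rw [Equiv.neg_apply, e, he, map_mul, Complex.conj_ofReal, ← Complex.exp_conj, map_mul,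
    map_neg, Complex.conj_I, Complex.conj_ofReal, inner_neg_right]
  push_cast; ring_nf

theorem fiberKernel_swap (h : Admissible a μ μm μp) (ξ x y : Rd d) :
    fiberKernel a μ ξ y x = (starRingEnd ℂ) (fiberKernel a μ ξ x y) := by
  rw [fiberKernel, fiberKernel, map_mul, Complex.conj_ofReal, ← aTilde_neg h.even, neg_sub,
    h.symm y x]

theorem ae_summable_sub (ha : Integrable a) (x : Rd d) :
    ∀ᵐ y ∂cellMeasure d, ∑' n : Fin d → ℤ, ‖a (x - y + latVec n)‖ₑ < ∞ :=
  ae_restrict_of_ae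
    ((Measure.measurePreserving_sub_left volume x).quasiMeasurePreserving.ae (aTilde_summable ha))

theorem aesm_mu (h : Admissible a μ μm μp) :
    ∀ᵐ x ∂cellMeasure d, AEStronglyMeasurable (μ x) volume :=
  ae_restrict_of_ae h.aesm.prodMk_left

/-- Integrability over the whole space against a periodic `L²` function. -/
theorem integrable_mul_periodic (h : Admissible a μ μm μp) {ψ : Rd d → ℂ}
    (hp : ∀ x (n : Fin d → ℤ), ψ (x + latVec n) = ψ x) (hψ : MemLp ψ 2 (cellMeasure d)) :
    ∀ᵐ x ∂cellMeasure d, Integrable fun y => ((a (x - y) * μ x y : ℝ) : ℂ) * ψ y := by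
  filter_upwards [aesm_mu h, (fiberKernel_schur h 0).integrable hψ] with x hm hi
  have hax : AEStronglyMeasurable (fun y => a (x - y)) volume :=
    (h.integrable.comp_sub_left x).1
  refine ⟨(Complex.continuous_ofReal.comp_aestronglyMeasurable (hax.mul hm)).mul
    (aesm_of_periodic hp hψ.1), ?_⟩
  rw [HasFiniteIntegral, lintegral_unfold,
    ← lintegral_tsum fun n => ?_]
  · refine lt_of_le_of_lt (le_of_eq (lintegral_congr_ae ?_)) hi.2
    filter_upwards [ae_summable_sub h.integrable x] with y hy
    rw [fiberKernel, enorm_mul, enorm_mul, enorm_aTilde_zero h.nonneg hy, mul_assoc,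
      ← ENNReal.tsum_mul_right, ← (Equiv.neg (Fin d → ℤ)).tsum_eq]
    refine tsum_congr fun n => ?_
    have e1 : x - (y + latVec (-n)) = x - y + latVec n := by rw [latVec_neg]; abel
    have e2 : μ x (y + latVec (-n)) = μ x y := by
      have := h.periodic x y 0 (-n)
      rwa [latVec_zero, add_zero] at this
    rw [Equiv.neg_apply, e1, e2, hp, enorm_mul, Complex.ofReal_mul, enorm_mul, mul_assoc]
    congr 1
    rw [← ofReal_norm, Complex.norm_real, ofReal_norm]
  · exact (aesm_comp_translate ((Complex.continuous_ofReal.comp_aestronglyMeasurable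
      (hax.mul hm)).mul (aesm_of_periodic hp hψ.1)) _).enorm.restrict

/-- The unfolding read backwards: μ(x, ·) and ψ are periodic, so they come out of the lattice sum,
which then is the one defining ã. -/
theorem integral_cell_aTilde (h : Admissible a μ μm μp) (ξ x : Rd d) {ψ : Rd d → ℂ}
    (hp : ∀ x (n : Fin d → ℤ), ψ (x + latVec n) = ψ x)
    (hi : Integrable fun y => ((a (x - y) * μ x y : ℝ) : ℂ) *
      (Complex.exp (-Complex.I * (⟪ξ, x - y⟫ : ℝ)) * ψ y)) :
    ∫ y in cell d, aTilde a ξ (x - y) * (μ x y : ℂ) * ψ y =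
      ∫ y, ((a (x - y) * μ x y : ℝ) : ℂ) *
        (Complex.exp (-Complex.I * (⟪ξ, x - y⟫ : ℝ)) * ψ y) := by
  rw [integral_unfold hi]
  refine integral_congr_ae ?_
  filter_upwards [ae_summable_sub h.integrable x] with y hy
  rw [aTilde, mul_assoc, ← tsum_mul_right, ← (Equiv.neg (Fin d → ℤ)).tsum_eq]
  refine tsum_congr fun n => ?_
  have e1 : x - (y + latVec n) = x - y + latVec (-n) := by rw [latVec_neg]; abel
  have e2 : μ x (y + latVec n) = μ x y := by
    have := h.periodic x y 0 n
    rwa [latVec_zero, add_zero] at this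
  rw [Equiv.neg_apply, e1, e2, hp]
  push_cast; ring

theorem integrable_phase {f : Rd d → ℂ} (hf : Integrable f) (ξ x : Rd d) :
    Integrable fun y => Complex.exp (-Complex.I * (⟪ξ, x - y⟫ : ℝ)) * f y := by
  refine hf.bdd_mul (c := 1) (Continuous.aestronglyMeasurable (by fun_prop))
    (Filter.Eventually.of_forall fun y => (norm_exp_phase _).le)

theorem integrable_kernel_of_aesm (h : Admissible a μ μm μp) {x : Rd d}
    (hx : AEStronglyMeasurable (μ x) volume) {φ : Rd d → ℝ}
    (hφ : Integrable fun z => a z * φ z) : Integrable fun y => a (x - y) * μ x y * φ (x - y) := by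
  have h1 : Integrable fun y => μ x y * (a (x - y) * φ (x - y)) :=
    (hφ.comp_sub_left x).bdd_mul (c := μp) hx (Filter.Eventually.of_forall fun y => h.abs_le x y)
  refine h1.congr (Filter.Eventually.of_forall fun y => ?_)
  simp only; ring

/-- The fiber operator as an integral over the whole space against a periodic representative. -/
theorem fiberOp_apply_periodic (h : Admissible a μ μm μp) (ξ : Rd d) {u : L2cell d} {ψ : Rd d → ℂ}
    (hp : ∀ x (n : Fin d → ℤ), ψ (x + latVec n) = ψ x) (hψ : u =ᵐ[cellMeasure d] ψ) :
    fiberOp h ξ u =ᵐ[cellMeasure d] fun x => ∫ y, ((a (x - y) * μ x y : ℝ) : ℂ) *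
      (ψ x - Complex.exp (-Complex.I * (⟪ξ, x - y⟫ : ℝ)) * ψ y) := by
  have hmem : MemLp ψ 2 (cellMeasure d) := (memLp_congr_ae hψ).mp (Lp.memLp u)
  filter_upwards [fiberOp_apply h ξ u, hψ, integrable_mul_periodic h hp hmem,
    aesm_mu h] with x h1 h2 h3 h4
  have h5 : ∫ y in cell d, aTilde a ξ (x - y) * (μ x y : ℂ) * u y =
      ∫ y in cell d, aTilde a ξ (x - y) * (μ x y : ℂ) * ψ y := by
    refine integral_congr_ae ?_
    filter_upwards [hψ] with y hy
    rw [hy]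
  have hi : Integrable fun y => ((a (x - y) * μ x y : ℝ) : ℂ) *
      (Complex.exp (-Complex.I * (⟪ξ, x - y⟫ : ℝ)) * ψ y) :=
    (integrable_phase h3 ξ x).congr (Filter.Eventually.of_forall fun y => by simp only; ring)
  have ha : Integrable fun y => ((a (x - y) * μ x y : ℝ) : ℂ) := by
    have := integrable_kernel_of_aesm h h4 (φ := fun _ => 1) (by simpa using h.integrable)
    simp only [mul_one] at this
    exact this.ofReal
  rw [h1, h5, integral_cell_aTilde h ξ x hp hi, h2, potential, ← integral_complex_ofReal,
    ← integral_mul_const, ← integral_sub (ha.mul_const _) hi]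
  simp only [mul_sub]

theorem fiberOp_symm (h : Admissible a μ μm μp) (ξ : Rd d) (u w : L2cell d) :
    inner ℂ (fiberOp h ξ u) w = inner ℂ u (fiberOp h ξ w) := by
  rw [fiberOp, _root_.sub_apply, _root_.sub_apply, inner_sub_left, inner_sub_right,
    integralOp_symm _ (fiberKernel_swap h ξ)]
  congr 1
  rw [L2.inner_def, L2.inner_def]
  refine integral_congr_ae ?_
  filter_upwards [mulOp_apply (potential_memLp h) u, mulOp_apply (potential_memLp h) w]
    with x h1 h2
  rw [h1, h2, RCLike.inner_apply, RCLike.inner_apply, map_mul, Complex.conj_ofReal]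
  ring

theorem oneCell_coe : oneCell d =ᵐ[cellMeasure d] fun _ => (1 : ℂ) :=
  (memLp_const (1 : ℂ)).coeFn_toLp

theorem fiberOp_zero_one (h : Admissible a μ μm μp) : fiberOp h 0 (oneCell d) = 0 := by
  refine Lp.ext ?_
  filter_upwards [fiberOp_apply_periodic h 0 (ψ := fun _ => 1) (fun _ _ => rfl) oneCell_coe,
    Lp.coeFn_zero ℂ 2 (cellMeasure d)] with x h1 h2
  rw [h1, h2]
  simp

/-- This is 𝔸(0)1 = 0 read pointwise. It brings the potential under the same double integral as the
kernel. -/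
theorem ae_potential_eq (h : Admissible a μ μm μp) : ∀ᵐ x ∂cellMeasure d,
    (potential a μ x : ℂ) = ∫ y in cell d, fiberKernel a μ 0 x y := by
  have h0 : fiberOp h 0 (oneCell d) =ᵐ[cellMeasure d] 0 := by
    rw [fiberOp_zero_one]; exact Lp.coeFn_zero ℂ 2 (cellMeasure d)
  filter_upwards [fiberOp_apply h 0 (oneCell d), h0, oneCell_coe] with x h1 h2 h3
  rw [h2, h3, Pi.zero_apply, mul_one] at h1
  rw [← sub_eq_zero, h1]
  congr 1
  refine integral_congr_ae ?_
  filter_upwards [oneCell_coe] with y hy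
  rw [hy, mul_one, fiberKernel]

/-! ### Perturbation of the fiber operator -/

theorem norm_mu_mul_le (h : Admissible a μ μm μp) (x y : Rd d) (z : ℂ) :
    ‖z * (μ x y : ℂ)‖ₑ ≤ ENNReal.ofReal μp * ‖z‖ₑ := by
  rw [enorm_mul, mul_comm]
  gcongr
  rw [← ofReal_norm, Complex.norm_real]
  exact ENNReal.ofReal_le_ofReal (h.abs_le x y)

/-- Term by term, |exp(-is) - 1| ≤ |s|. -/
theorem aTilde_sub_enorm_le {z : Rd d} (hz : ∑' n : Fin d → ℤ, ‖a (z + latVec n)‖ₑ < ∞)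
    (ξ : Rd d) :
    ‖aTilde a ξ z - aTilde a 0 z‖ₑ ≤ ∑' n : Fin d → ℤ, ENNReal.ofReal
      |a (z + latVec n) * ⟪ξ, z + latVec n⟫| := by
  rw [aTilde, aTilde, ← (summable_phase hz ξ).tsum_sub (summable_phase hz 0)]
  refine enorm_tsum_le_tsum_enorm.trans (ENNReal.tsum_le_tsum fun n => ?_)
  rw [← mul_sub, ← ofReal_norm, norm_mul, abs_mul, Complex.norm_real, Real.norm_eq_abs]
  refine ENNReal.ofReal_le_ofReal (mul_le_mul_of_nonneg_left ?_ (abs_nonneg _))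
  have := Real.norm_exp_I_mul_ofReal_sub_one_le (x := -⟪ξ, z + latVec n⟫)
  rw [norm_neg, Real.norm_eq_abs] at this
  refine le_trans (le_of_eq ?_) this
  simp

/-- The first-order part of exp(-is) - 1 is imaginary; its real part cos s - 1 lies between -s²/2
and 0. This gains one order in ξ. -/
theorem aTilde_sub_re_enorm_le {z : Rd d} (hz : ∑' n : Fin d → ℤ, ‖a (z + latVec n)‖ₑ < ∞)
    (ξ : Rd d) :
    ‖(aTilde a ξ z - aTilde a 0 z).re‖ₑ ≤ ∑' n : Fin d → ℤ, ENNReal.ofReal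
      |a (z + latVec n) * (⟪ξ, z + latVec n⟫ ^ 2 / 2)| := by
  have hs := (summable_phase hz ξ).sub (summable_phase hz 0)
  rw [aTilde, aTilde, ← (summable_phase hz ξ).tsum_sub (summable_phase hz 0), Complex.re_tsum hs]
  refine enorm_tsum_le_tsum_enorm.trans (ENNReal.tsum_le_tsum fun n => ?_)
  rw [← mul_sub, Complex.re_ofReal_mul, ← ofReal_norm, Real.norm_eq_abs, abs_mul, abs_mul]
  refine ENNReal.ofReal_le_ofReal (mul_le_mul_of_nonneg_left ?_ (abs_nonneg _))
  have e1 : (Complex.exp (-Complex.I * (⟪ξ, z + latVec n⟫ : ℝ))).re =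
      Real.cos ⟪ξ, z + latVec n⟫ := by
    have : -Complex.I * ((⟪ξ, z + latVec n⟫ : ℝ) : ℂ) =
      ((-⟪ξ, z + latVec n⟫ : ℝ) : ℂ) * Complex.I := by push_cast; ring
    rw [this, Complex.exp_ofReal_mul_I_re, Real.cos_neg]
  have e2 : (Complex.exp (-Complex.I * ((⟪(0 : Rd d), z + latVec n⟫ : ℝ) : ℂ))).re = 1 := by simp
  rw [Complex.sub_re, e1, e2, abs_sub_comm, abs_of_nonneg (by linarith [Real.cos_le_one ⟪ξ, z + latVec n⟫]),
    abs_of_nonneg (by positivity)]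
  linarith [Real.one_sub_sq_div_two_le_cos (x := ⟪ξ, z + latVec n⟫)]

theorem ae_summable_sub' (ha : Integrable a) (y : Rd d) :
    ∀ᵐ x ∂cellMeasure d, ∑' n : Fin d → ℤ, ‖a (x - y + latVec n)‖ₑ < ∞ :=
  ae_restrict_of_ae
    ((measurePreserving_sub_right volume y).quasiMeasurePreserving.ae (aTilde_summable ha))

theorem lintegral_ofReal_abs_le {f : Rd d → ℝ} {M : ℝ} (hf : Integrable f) (hM : ∫ z, |f z| ≤ M) :
    ∫⁻ z, ENNReal.ofReal |f z| ≤ ENNReal.ofReal M := by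
  rw [← ofReal_integral_eq_lintegral_ofReal hf.abs (Filter.Eventually.of_forall fun z => abs_nonneg _)]
  exact ENNReal.ofReal_le_ofReal hM

/-- Schur bounds for a kernel dominated by lattice sums of an integrable function. -/
theorem schur_bounds_of_dominated (h : Admissible a μ μm μp) {k : Rd d → Rd d → ℂ} {f : Rd d → ℝ} {M : ℝ}
    (hf : Integrable f) (hM : ∫ z, |f z| ≤ M)
    (hk : ∀ x y, ∑' n : Fin d → ℤ, ‖a (x - y + latVec n)‖ₑ < ∞ →
      ‖k x y‖ₑ ≤ ENNReal.ofReal μp * ∑' n : Fin d → ℤ, ENNReal.ofReal |f (x - y + latVec n)|) :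
    (∀ᵐ x ∂cellMeasure d, ∫⁻ y in cell d, ‖k x y‖ₑ ≤ (μp * M).toNNReal) ∧
    (∀ᵐ y ∂cellMeasure d, ∫⁻ x in cell d, ‖k x y‖ₑ ≤ (μp * M).toNNReal) := by
  have hμp : 0 ≤ μp := h.pos.le.trans ((h.lower 0 0).trans (h.upper 0 0))
  have hm : AEMeasurable (fun z => ENNReal.ofReal |f z|) :=
    hf.1.aemeasurable.abs.ennreal_ofReal
  have hcast : ((μp * M).toNNReal : ℝ≥0∞) = ENNReal.ofReal μp * ENNReal.ofReal M := by
    rw [← ENNReal.ofReal_mul hμp]; rfl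
  rw [hcast]
  constructor
  · refine Filter.Eventually.of_forall fun x => ?_
    calc ∫⁻ y in cell d, ‖k x y‖ₑ
        ≤ ∫⁻ y in cell d, ENNReal.ofReal μp *
          ∑' n : Fin d → ℤ, ENNReal.ofReal |f (x - y + latVec n)| := by
          refine lintegral_mono_ae ?_
          filter_upwards [ae_summable_sub h.integrable x] with y hy using hk x y hy
      _ = ENNReal.ofReal μp * ∫⁻ z, ENNReal.ofReal |f z| := by
          rw [lintegral_const_mul' _ _ ENNReal.ofReal_ne_top, lintegral_cell_sub_tsum hm x]
      _ ≤ _ := by gcongr; exact lintegral_ofReal_abs_le hf hM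
  · refine Filter.Eventually.of_forall fun y => ?_
    calc ∫⁻ x in cell d, ‖k x y‖ₑ
        ≤ ∫⁻ x in cell d, ENNReal.ofReal μp *
          ∑' n : Fin d → ℤ, ENNReal.ofReal |f (x - y + latVec n)| := by
          refine lintegral_mono_ae ?_
          filter_upwards [ae_summable_sub' h.integrable y] with x hx using hk x y hx
      _ = ENNReal.ofReal μp * ∫⁻ z, ENNReal.ofReal |f z| := by
          rw [lintegral_const_mul' _ _ ENNReal.ofReal_ne_top, lintegral_cell_sub_tsum' hm y]
      _ ≤ _ := by gcongr; exact lintegral_ofReal_abs_le hf hM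

end Fiber

/-! ### Dependence on ξ, and comparison with μ = 1. -/

section Perturbation

variable {d : ℕ} {a : Rd d → ℝ} {μ : Rd d → Rd d → ℝ} {μm μp : ℝ}

theorem Admissible.upper_nonneg (h : Admissible a μ μm μp) : 0 ≤ μp :=
  h.pos.le.trans ((h.lower 0 0).trans (h.upper 0 0))

/-- Finiteness of the lower moments. -/
theorem integrable_moment (h : Admissible a μ μm μp)
    (hM : Integrable fun x : Rd d => ‖x‖ ^ 4 * a x) {k : ℕ} (hk : k ≤ 4) :
    Integrable fun x : Rd d => ‖x‖ ^ k * a x := by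
  refine (h.integrable.add hM).mono ?_ (Filter.Eventually.of_forall fun x => ?_)
  · exact (Continuous.aestronglyMeasurable (by fun_prop)).mul h.integrable.1
  · have ha := h.nonneg x
    rw [Pi.add_apply, Real.norm_of_nonneg (by positivity), Real.norm_of_nonneg (by positivity)]
    have : ‖x‖ ^ k ≤ 1 + ‖x‖ ^ 4 := by
      rcases le_total ‖x‖ 1 with h1 | h1
      · have := pow_le_one₀ (n := k) (norm_nonneg x) h1
        have := pow_nonneg (norm_nonneg x) 4
        linarith
      · have := pow_le_pow_right₀ h1 hk
        linarith
    nlinarith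

theorem moment_nonneg (h : Admissible a μ μm μp) (k : ℕ) : 0 ≤ moment a k :=
  integral_nonneg fun x => mul_nonneg (by positivity) (h.nonneg x)

theorem integrable_inner_pow (h : Admissible a μ μm μp)
    (hM : Integrable fun x : Rd d => ‖x‖ ^ 4 * a x) (ξ : Rd d) {k : ℕ} (hk : k ≤ 4) :
    Integrable fun z => a z * ⟪ξ, z⟫ ^ k := by
  refine ((integrable_moment h hM hk).const_mul (‖ξ‖ ^ k)).mono
    (h.integrable.1.mul (Continuous.aestronglyMeasurable (by fun_prop)))
    (Filter.Eventually.of_forall fun x => ?_)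
  have ha := h.nonneg x
  rw [norm_mul, norm_pow, Real.norm_of_nonneg ha,
    Real.norm_of_nonneg (show 0 ≤ ‖ξ‖ ^ k * (‖x‖ ^ k * a x) by positivity),
    ← mul_assoc, ← mul_pow, mul_comm]
  gcongr
  exact norm_inner_le_norm ξ x

theorem integral_abs_inner_pow_le (h : Admissible a μ μm μp)
    (hM : Integrable fun x : Rd d => ‖x‖ ^ 4 * a x) (ξ : Rd d) {k : ℕ} (hk : k ≤ 4) :
    ∫ z, |a z * ⟪ξ, z⟫ ^ k| ≤ ‖ξ‖ ^ k * moment a k := by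
  rw [moment, ← integral_const_mul]
  refine integral_mono (integrable_inner_pow h hM ξ hk).abs
    ((integrable_moment h hM hk).const_mul _) fun x => ?_
  have ha := h.nonneg x
  simp only
  rw [abs_mul, abs_pow, abs_of_nonneg ha, ← mul_assoc, ← mul_pow, mul_comm]
  gcongr
  exact abs_real_inner_le_norm ξ x

theorem fiberOp_sub (h : Admissible a μ μm μp) (ξ : Rd d) :
    fiberOp h ξ - fiberOp h 0 =
      -integralOp ((fiberKernel_schur h ξ).sub (fiberKernel_schur h 0)) := by
  rw [← integralOp_sub (fiberKernel_schur h ξ) (fiberKernel_schur h 0), fiberOp, fiberOp]; abel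

/-- The Schur test for the kernel difference, dominated by the lattice sum of |a(z)⟨ξ, z⟩|. -/
theorem norm_fiberOp_sub_le (h : Admissible a μ μm μp)
    (hM : Integrable fun x : Rd d => ‖x‖ ^ 4 * a x) (ξ : Rd d) :
    ‖fiberOp h ξ - fiberOp h 0‖ ≤ μp * moment a 1 * ‖ξ‖ := by
  have hb := schur_bounds_of_dominated h
    (k := fun x y => fiberKernel a μ ξ x y - fiberKernel a μ 0 x y)
    (integrable_inner_pow h hM ξ (k := 1) (by norm_num))
    (integral_abs_inner_pow_le h hM ξ (k := 1) (by norm_num)) (fun x y hxy => by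
      simp only [fiberKernel, ← sub_mul, pow_one]
      refine (norm_mu_mul_le h x y _).trans ?_
      gcongr
      exact aTilde_sub_enorm_le hxy ξ)
  rw [fiberOp_sub, norm_neg]
  refine (norm_integralOp_le _ hb.1 hb.2).trans (le_of_eq ?_)
  rw [Real.coe_toNNReal _ (mul_nonneg h.upper_nonneg
    (mul_nonneg (by positivity) (moment_nonneg h 1)))]
  ring

/-- The class in `L_2(Ω)` of a real function. -/
noncomputable def realClass {f : Rd d → ℝ} (hf : MemLp f 2 (cellMeasure d)) : L2cell d :=
  (hf.ofReal (K := ℂ)).toLp _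

theorem realClass_coe {f : Rd d → ℝ} (hf : MemLp f 2 (cellMeasure d)) :
    realClass hf =ᵐ[cellMeasure d] fun x => (f x : ℂ) := (hf.ofReal (K := ℂ)).coeFn_toLp

/-- For real f the kernel is paired with the real function f(x)f(y), so only its real part counts
and the bound is of order |ξ|², not |ξ|. Applied to the corrector, itself of first order, it yields
a fourth-order term. -/
theorem abs_re_inner_fiberOp_sub_le (h : Admissible a μ μm μp)
    (hM : Integrable fun x : Rd d => ‖x‖ ^ 4 * a x) (ξ : Rd d) {f : Rd d → ℝ}
    (hf : MemLp f 2 (cellMeasure d)) :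
    |(inner ℂ ((fiberOp h ξ - fiberOp h 0) (realClass hf)) (realClass hf)).re| ≤
      μp * moment a 2 * ‖ξ‖ ^ 2 / 2 * ‖realClass hf‖ ^ 2 := by
  have hμp := h.upper_nonneg
  have hM2 := moment_nonneg h 2
  set F := realClass hf with hF
  set k : Rd d → Rd d → ℂ := fun x y => fiberKernel a μ ξ x y - fiberKernel a μ 0 x y with hk
  have hS : SchurKernel (cellMeasure d) k := (fiberKernel_schur h ξ).sub (fiberKernel_schur h 0)
  have hint : Integrable fun z => a z * (⟪ξ, z⟫ ^ 2 / 2) :=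
    ((integrable_inner_pow h hM ξ (k := 2) (by norm_num)).div_const 2).congr
      (Filter.Eventually.of_forall fun z => by simp only; ring)
  have hbd : ∫ z, |a z * (⟪ξ, z⟫ ^ 2 / 2)| ≤ ‖ξ‖ ^ 2 * moment a 2 / 2 := by
    have := integral_abs_inner_pow_le h hM ξ (k := 2) (by norm_num)
    calc ∫ z, |a z * (⟪ξ, z⟫ ^ 2 / 2)| = ∫ z, |a z * ⟪ξ, z⟫ ^ 2| / 2 := by
          refine integral_congr_ae (Filter.Eventually.of_forall fun z => ?_)
          simp only
          rw [← mul_div_assoc, abs_div]; norm_num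
      _ = (∫ z, |a z * ⟪ξ, z⟫ ^ 2|) / 2 := integral_div _ _
      _ ≤ _ := by linarith
  have hb := schur_bounds_of_dominated h (k := fun x y => ((k x y).re : ℂ)) hint hbd
    (fun x y hxy => by
      have e : (k x y).re = (aTilde a ξ (x - y) - aTilde a 0 (x - y)).re * μ x y := by
        simp only [hk, fiberKernel, ← sub_mul, Complex.re_mul_ofReal]
      rw [e, Complex.ofReal_mul]
      refine (norm_mu_mul_le h x y _).trans ?_
      gcongr
      refine le_trans (le_of_eq ?_) (aTilde_sub_re_enorm_le hxy ξ)
      rw [← ofReal_norm, Complex.norm_real, ofReal_norm])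
  have hre : (inner ℂ ((fiberOp h ξ - fiberOp h 0) F) F).re =
      -∫ q, (((k q.1 q.2).re : ℂ) * F q.2 * (starRingEnd ℂ) (F q.1)).re
        ∂((cellMeasure d).prod (cellMeasure d)) := by
    rw [← inner_conj_symm, Complex.conj_re, fiberOp_sub, _root_.neg_apply, inner_neg_right,
      Complex.neg_re, inner_integralOp]
    have hi := hS.integrable_form (Lp.memLp F)
      (w := fun x => (starRingEnd ℂ) (F x)) (Lp.memLp F).star
    congr 1
    have := integral_re hi
    simp only [RCLike.re_to_complex] at this
    rw [← this]
    have hq1 := Measure.quasiMeasurePreserving_fst (μ := cellMeasure d) (ν := cellMeasure d) |>.ae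
      (realClass_coe hf)
    have hq2 := Measure.quasiMeasurePreserving_snd (μ := cellMeasure d) (ν := cellMeasure d) |>.ae
      (realClass_coe hf)
    refine integral_congr_ae ?_
    filter_upwards [hq1, hq2] with q e1 e2
    rw [← hF] at e1 e2
    rw [e1, e2, Complex.conj_ofReal, Complex.re_mul_ofReal, Complex.re_mul_ofReal,
      Complex.re_mul_ofReal, Complex.re_mul_ofReal, Complex.ofReal_re]
  have hkre : AEStronglyMeasurable (Function.uncurry fun x y => ((k x y).re : ℂ))
      ((cellMeasure d).prod (cellMeasure d)) :=
    (Complex.continuous_ofReal.comp Complex.continuous_re).comp_aestronglyMeasurable hS.aesm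
  have hform := schur_form_le hkre hb.1 hb.2 (Lp.memLp F).1
    (w := fun x => (starRingEnd ℂ) (F x)) (Lp.memLp F).star.1
  have hstar : eLpNorm (fun x => (starRingEnd ℂ) (F x)) 2 (cellMeasure d) =
      eLpNorm F 2 (cellMeasure d) := eLpNorm_congr_norm_ae
        (Filter.Eventually.of_forall fun x => RCLike.norm_conj _)
  rw [hstar] at hform
  rw [hre, abs_neg]
  have h1 : ‖∫ q, (((k q.1 q.2).re : ℂ) * F q.2 * (starRingEnd ℂ) (F q.1)).re
        ∂((cellMeasure d).prod (cellMeasure d))‖ₑ ≤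
      (μp * (‖ξ‖ ^ 2 * moment a 2 / 2)).toNNReal * eLpNorm F 2 (cellMeasure d) *
        eLpNorm F 2 (cellMeasure d) := by
    refine (enorm_integral_le_lintegral_enorm _).trans (le_trans (lintegral_mono fun q => ?_) hform)
    rw [← ofReal_norm, ← ofReal_norm]
    exact ENNReal.ofReal_le_ofReal (Complex.abs_re_le_norm _)
  have h2 := ENNReal.toReal_mono (ENNReal.mul_ne_top (ENNReal.mul_ne_top (by simp)
    (Lp.memLp F).2.ne) (Lp.memLp F).2.ne) h1
  rw [ENNReal.toReal_mul, ENNReal.toReal_mul, ← Lp.norm_def, toReal_enorm, Real.norm_eq_abs,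
    ENNReal.coe_toReal, Real.coe_toNNReal _ (by positivity)] at h2
  refine h2.trans (le_of_eq ?_)
  ring

/-- The density of the quadratic form of `𝔸(ξ)` on `Ω × Ω`. -/
noncomputable def formDensity (a : Rd d → ℝ) (ξ : Rd d) (u : Rd d → ℂ) (q : Rd d × Rd d) : ℝ :=
  (aTilde a 0 (q.1 - q.2)).re * ((‖u q.1‖ ^ 2 + ‖u q.2‖ ^ 2) / 2) -
    (aTilde a ξ (q.1 - q.2) * u q.2 * (starRingEnd ℂ) (u q.1)).re

/-- The inequality |ã(ξ, ·)| ≤ ã(0, ·) together with 2|u(x)||u(y)| ≤ |u(x)|² + |u(y)|². -/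
theorem formDensity_nonneg (h : Admissible a μ μm μp) (ξ : Rd d) (u : Rd d → ℂ) :
    ∀ᵐ q ∂((cellMeasure d).prod (cellMeasure d)), 0 ≤ formDensity a ξ u q := by
  filter_upwards [quasi_sub.ae (aTilde_summable h.integrable)] with q hq
  have h1 := aTilde_norm_le h.nonneg hq ξ
  have h2 : (aTilde a ξ (q.1 - q.2) * u q.2 * (starRingEnd ℂ) (u q.1)).re ≤
      ‖aTilde a ξ (q.1 - q.2)‖ * (‖u q.2‖ * ‖u q.1‖) := by
    refine (Complex.re_le_norm _).trans (le_of_eq ?_)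
    rw [norm_mul, norm_mul, RCLike.norm_conj]; ring
  have h3 : ‖aTilde a ξ (q.1 - q.2)‖ * (‖u q.2‖ * ‖u q.1‖) ≤
      (aTilde a 0 (q.1 - q.2)).re * ((‖u q.1‖ ^ 2 + ‖u q.2‖ ^ 2) / 2) := by
    gcongr
    · exact (norm_nonneg _).trans h1
    · nlinarith [sq_nonneg (‖u q.1‖ - ‖u q.2‖)]
  rw [formDensity]; linarith

/-- The potential is replaced by the integral of the kernel at ξ = 0, and the resulting |u(x)|² is
symmetrised over x and y. Here μ appears as a plain factor. -/
theorem re_inner_fiberOp_eq (h : Admissible a μ μm μp) (ξ : Rd d) (u : L2cell d) :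
    Integrable (fun q : Rd d × Rd d => μ q.1 q.2 * formDensity a ξ u q)
      ((cellMeasure d).prod (cellMeasure d)) ∧
    (inner ℂ (fiberOp h ξ u) u).re =
      ∫ q, μ q.1 q.2 * formDensity a ξ u q ∂((cellMeasure d).prod (cellMeasure d)) := by
  have hsq : Integrable (fun x => ((‖u x‖ ^ 2 : ℝ) : ℂ)) (cellMeasure d) :=
    ((memLp_two_iff_integrable_sq_norm (Lp.memLp u).1).mp (Lp.memLp u)).ofReal
  have hI1 := (fiberKernel_schur h 0).integrable_fst hsq
  have hsym : ∀ q : Rd d × Rd d, (fiberKernel a μ 0 q.2 q.1).re = (fiberKernel a μ 0 q.1 q.2).re :=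
    fun q => by rw [fiberKernel_swap h, Complex.conj_re]
  have hI1r := hI1.re
  have hI2r : Integrable (fun q : Rd d × Rd d =>
      RCLike.re (fiberKernel a μ 0 q.2 q.1 * ((‖u q.2‖ ^ 2 : ℝ) : ℂ)))
      ((cellMeasure d).prod (cellMeasure d)) := hI1r.swap
  have hI12 : Integrable (fun q : Rd d × Rd d =>
      (RCLike.re (fiberKernel a μ 0 q.1 q.2 * ((‖u q.1‖ ^ 2 : ℝ) : ℂ)) +
        RCLike.re (fiberKernel a μ 0 q.2 q.1 * ((‖u q.2‖ ^ 2 : ℝ) : ℂ))) / 2)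
      ((cellMeasure d).prod (cellMeasure d)) := (hI1r.add hI2r).div_const 2
  have hJ := (fiberKernel_schur h ξ).integrable_form (Lp.memLp u)
    (w := fun x => (starRingEnd ℂ) (u x)) (Lp.memLp u).star
  have hJr := hJ.re
  have hdens : (fun q : Rd d × Rd d => μ q.1 q.2 * formDensity a ξ u q) = fun q =>
      (RCLike.re (fiberKernel a μ 0 q.1 q.2 * ((‖u q.1‖ ^ 2 : ℝ) : ℂ)) +
        RCLike.re (fiberKernel a μ 0 q.2 q.1 * ((‖u q.2‖ ^ 2 : ℝ) : ℂ))) / 2 -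
      RCLike.re (fiberKernel a μ ξ q.1 q.2 * u q.2 * (starRingEnd ℂ) (u q.1)) := by
    funext q
    simp only [RCLike.re_to_complex, Complex.re_mul_ofReal, hsym]
    have e : fiberKernel a μ ξ q.1 q.2 * u q.2 * (starRingEnd ℂ) (u q.1) =
      (aTilde a ξ (q.1 - q.2) * u q.2 * (starRingEnd ℂ) (u q.1)) * (μ q.1 q.2 : ℂ) := by
      rw [fiberKernel]; ring
    rw [e, Complex.re_mul_ofReal, fiberKernel, Complex.re_mul_ofReal, formDensity]
    ring
  rw [hdens]
  refine ⟨hI12.sub hJr, ?_⟩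
  rw [integral_sub hI12 hJr]
  -- Both halves of the symmetrised potential have the same integral, by exchange of the variables.
  have hd2 : ∫ q : Rd d × Rd d, (RCLike.re (fiberKernel a μ 0 q.1 q.2 * ((‖u q.1‖ ^ 2 : ℝ) : ℂ)) +
        RCLike.re (fiberKernel a μ 0 q.2 q.1 * ((‖u q.2‖ ^ 2 : ℝ) : ℂ))) / 2
        ∂((cellMeasure d).prod (cellMeasure d)) =
      ∫ q : Rd d × Rd d, RCLike.re (fiberKernel a μ 0 q.1 q.2 * ((‖u q.1‖ ^ 2 : ℝ) : ℂ))
        ∂((cellMeasure d).prod (cellMeasure d)) := by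
    rw [integral_div, integral_add hI1r hI2r]
    have := integral_prod_swap (μ := cellMeasure d) (ν := cellMeasure d)
      (fun q : Rd d × Rd d => RCLike.re (fiberKernel a μ 0 q.1 q.2 * ((‖u q.1‖ ^ 2 : ℝ) : ℂ)))
    simp only [Prod.fst_swap, Prod.snd_swap] at this
    rw [this]; ring
  rw [hd2, integral_re hI1, integral_re hJ, ← inner_conj_symm, Complex.conj_re, fiberOp,
    _root_.sub_apply, inner_sub_right, Complex.sub_re, inner_integralOp]
  congr 2
  rw [integral_prod _ hI1, L2.inner_def]
  refine integral_congr_ae ?_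
  filter_upwards [mulOp_apply (potential_memLp h) u, ae_potential_eq h] with x h1 h2
  rw [h1, h2, RCLike.inner_apply, integral_mul_const, mul_assoc, Complex.mul_conj,
    Complex.normSq_eq_norm_sq]

/-- The constant-coefficient comparison operator, diagonalised below by Fourier series. -/
theorem Admissible.unit (h : Admissible a μ μm μp) : Admissible a (fun _ _ => 1) 1 1 where
  integrable := h.integrable
  support_pos := h.support_pos
  nonneg := h.nonneg
  even := h.even
  aesm := aestronglyMeasurable_const
  pos := one_pos
  lower _ _ := le_rfl
  upper _ _ := le_rfl
  symm _ _ := rfl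
  periodic _ _ _ _ := rfl

/-- Comparison of the quadratic form with the one for `μ = 1`. -/
theorem re_inner_fiberOp_ge (h : Admissible a μ μm μp) (ξ : Rd d) (u : L2cell d) :
    μm * (inner ℂ (fiberOp h.unit ξ u) u).re ≤ (inner ℂ (fiberOp h ξ u) u).re := by
  obtain ⟨i1, e1⟩ := re_inner_fiberOp_eq h ξ u
  obtain ⟨i2, e2⟩ := re_inner_fiberOp_eq h.unit ξ u
  rw [e1, e2, ← integral_const_mul]
  refine integral_mono_ae (i2.const_mul _) i1 ?_
  filter_upwards [formDensity_nonneg h ξ u] with q hq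
  simp only [one_mul]
  exact mul_le_mul_of_nonneg_right (h.lower _ _) hq

end Perturbation

/-! ### Fourier series on the cell, and the constant-coefficient operator. -/

section Fourier

variable {d : ℕ}

/-- The normalised Haar measure on the torus. -/
noncomputable abbrev torusMeasure (d : ℕ) : Measure (UnitAddTorus (Fin d)) :=
  Measure.pi fun _ => (AddCircle.haarAddCircle : Measure UnitAddCircle)

/-- The Fourier basis of the torus, with the measure made explicit. -/
noncomputable def torusBasis (d : ℕ) : HilbertBasis (Fin d → ℤ) ℂ (Lp ℂ 2 (torusMeasure d)) :=
  UnitAddTorus.mFourierBasis (d := Fin d)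

theorem torusBasis_coe (n : Fin d → ℤ) :
    torusBasis d n =ᵐ[torusMeasure d] UnitAddTorus.mFourier n := by
  have h : torusBasis d n = UnitAddTorus.mFourierLp (d := Fin d) 2 n :=
    congrFun UnitAddTorus.coe_mFourierBasis n
  rw [h]
  exact UnitAddTorus.coeFn_mFourierLp 2 n

/-- The quotient map from `ℝ^d` to the torus. -/
noncomputable def toTorus (x : Rd d) : UnitAddTorus (Fin d) := fun i => (x i : UnitAddCircle)

/-- The representative in the cell of a point of the torus. -/
noncomputable def ofTorus (θ : UnitAddTorus (Fin d)) : Rd d :=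
  WithLp.toLp 2 fun i => (AddCircle.equivIco 1 0 (θ i) : ℝ)

theorem ofTorus_toTorus {x : Rd d} (hx : x ∈ cell d) : ofTorus (toTorus x) = x := by
  ext i
  simp only [ofTorus, toTorus]
  rw [AddCircle.coe_equivIco_mk_apply]
  have h1 : x i - 0 = x i := sub_zero _
  simp [Int.fract_eq_self.mpr (hx i)]

theorem measurable_ofTorus : Measurable (ofTorus (d := d)) := by
  refine (WithLp.measurable_toLp 2 _).comp (measurable_pi_lambda _ fun i => ?_)
  exact measurable_subtype_coe.comp
    ((AddCircle.measurableEquivIco 1 0).measurable.comp (measurable_pi_apply i))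

/-- In one variable the quotient map carries Lebesgue measure on [0,1) to the Haar probability
measure; the general case is the product. -/
theorem measurePreserving_toTorus :
    MeasurePreserving (toTorus (d := d)) (cellMeasure d) (torusMeasure d) := by
  have h1 : MeasurePreserving (fun x : ℝ => (x : UnitAddCircle))
      (volume.restrict (Set.Ico 0 1)) AddCircle.haarAddCircle := by
    have := UnitAddCircle.measurePreserving_mk 0
    rw [zero_add, ← restrict_Ico_eq_restrict_Ioc] at this
    have h2 : (volume : Measure UnitAddCircle) = AddCircle.haarAddCircle := by
      rw [AddCircle.volume_eq_smul_haarAddCircle]; simp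
    rwa [h2] at this
  have h3 := measurePreserving_pi (fun _ : Fin d => volume.restrict (Set.Ico (0 : ℝ) 1))
    (fun _ => AddCircle.haarAddCircle) fun _ => h1
  rw [← Measure.restrict_pi_pi] at h3
  have h4 := (PiLp.volume_preserving_ofLp (Fin d)).restrict_preimage
    (s := Set.univ.pi fun _ => Set.Ico (0 : ℝ) 1)
    (MeasurableSet.univ_pi fun _ => measurableSet_Ico)
  have h5 : WithLp.ofLp ⁻¹' (Set.univ.pi fun _ : Fin d => Set.Ico (0 : ℝ) 1) = cell d := by
    ext x; simp [cell]
  rw [h5] at h4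
  exact h3.comp h4

theorem measurePreserving_ofTorus :
    MeasurePreserving (ofTorus (d := d)) (torusMeasure d) (cellMeasure d) := by
  refine ⟨measurable_ofTorus, ?_⟩
  rw [← measurePreserving_toTorus.map_eq,
    Measure.map_map measurable_ofTorus measurePreserving_toTorus.measurable]
  have : ofTorus ∘ toTorus =ᵐ[cellMeasure d] id := by
    filter_upwards [ae_restrict_mem (measurableSet_cell d)] with x hx
    exact ofTorus_toTorus hx
  rw [Measure.map_congr this, Measure.map_id]

/-- Pullback of functions from the torus to the cell. -/
noncomputable def torusPullback (d : ℕ) : Lp ℂ 2 (torusMeasure d) ≃ₗᵢ[ℂ] L2cell d :=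
  LinearIsometryEquiv.ofSurjective
    (Lp.compMeasurePreservingₗᵢ ℂ toTorus measurePreserving_toTorus) (by
      intro u
      refine ⟨Lp.compMeasurePreserving ofTorus measurePreserving_ofTorus u, Lp.ext ?_⟩
      have h1 := Lp.coeFn_compMeasurePreserving
        (Lp.compMeasurePreserving ofTorus measurePreserving_ofTorus u) measurePreserving_toTorus
      have h2 := measurePreserving_toTorus.quasiMeasurePreserving.ae
        (Lp.coeFn_compMeasurePreserving u measurePreserving_ofTorus)
      filter_upwards [h1, h2, ae_restrict_mem (measurableSet_cell d)] with x e1 e2 hx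
      refine e1.trans ?_
      rw [Function.comp_apply, e2, Function.comp_apply, ofTorus_toTorus hx])

/-- The exponential with integer frequency `n`. -/
noncomputable def cellExp (n : Fin d → ℤ) (x : Rd d) : ℂ :=
  Complex.exp (Complex.I * ((2 * Real.pi * ⟪latVec n, x⟫ : ℝ) : ℂ))

theorem mFourier_toTorus (n : Fin d → ℤ) (x : Rd d) :
    UnitAddTorus.mFourier n (toTorus x) = cellExp n x := by
  have h1 : UnitAddTorus.mFourier n (toTorus x) = ∏ i, fourier (n i) (toTorus x i) := rfl
  rw [h1, cellExp]
  simp only [toTorus, fourier_coe_apply]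
  rw [← Complex.exp_sum]
  congr 1
  rw [PiLp.inner_apply]
  simp only [latVec, RCLike.inner_apply, conj_trivial]
  push_cast
  rw [Finset.mul_sum, Finset.mul_sum]
  refine Finset.sum_congr rfl fun i _ => ?_
  ring

/-- The Fourier basis of `L_2(Ω)`. -/
noncomputable def cellBasis (d : ℕ) : HilbertBasis (Fin d → ℤ) ℂ (L2cell d) :=
  HilbertBasis.ofRepr ((torusPullback d).symm.trans (torusBasis d).repr)

theorem cellBasis_coe (n : Fin d → ℤ) : cellBasis d n =ᵐ[cellMeasure d] cellExp n := by
  have h0 : cellBasis d n = torusPullback d (torusBasis d n) := by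
    rw [← HilbertBasis.repr_symm_single, ← HilbertBasis.repr_symm_single]
    rfl
  have h1 : torusPullback d (torusBasis d n) =ᵐ[cellMeasure d] torusBasis d n ∘ toTorus :=
    Lp.coeFn_compMeasurePreserving (torusBasis d n) measurePreserving_toTorus
  have h2 := measurePreserving_toTorus.quasiMeasurePreserving.ae (torusBasis_coe n)
  rw [h0]
  filter_upwards [h1, h2] with x e1 e2
  rw [e1, Function.comp_apply, e2, mFourier_toTorus]

theorem cellBasis_zero : cellBasis d 0 = oneCell d := by
  refine Lp.ext ?_
  filter_upwards [cellBasis_coe (d := d) 0, oneCell_coe] with x h1 h2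
  rw [h1, h2, cellExp, latVec_zero]; simp

theorem norm_oneCell : ‖oneCell d‖ = 1 := by
  rw [← cellBasis_zero]; exact (cellBasis d).orthonormal.1 0

theorem cellExp_add (n m : Fin d → ℤ) (x : Rd d) : cellExp n (x + latVec m) = cellExp n x := by
  rw [cellExp, cellExp, inner_add_right]
  have : ⟪latVec n, latVec m⟫ = ((∑ i, n i * m i : ℤ) : ℝ) := by
    rw [PiLp.inner_apply]
    push_cast
    refine Finset.sum_congr rfl fun i _ => ?_
    simp [latVec, mul_comm]
  rw [this]
  have e : Complex.I * ((2 * Real.pi * (⟪latVec n, x⟫ + ((∑ i, n i * m i : ℤ) : ℝ)) : ℝ) : ℂ) =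
      Complex.I * ((2 * Real.pi * ⟪latVec n, x⟫ : ℝ) : ℂ) +
        ((∑ i, n i * m i : ℤ) : ℂ) * (2 * Real.pi * Complex.I) := by
    push_cast; ring
  rw [e, Complex.exp_add, Complex.exp_int_mul_two_pi_mul_I, mul_one]

theorem cellExp_sub (n : Fin d → ℤ) (x z : Rd d) :
    cellExp n (x - z) = cellExp n x * Complex.exp (-Complex.I *
      ((⟪(2 * Real.pi) • latVec n, z⟫ : ℝ) : ℂ)) := by
  rw [cellExp, cellExp, ← Complex.exp_add, inner_sub_right, inner_smul_left]
  congr 1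
  simp only [conj_trivial]
  push_cast; ring

variable {a : Rd d → ℝ} {μ : Rd d → Rd d → ℝ} {μm μp : ℝ}

/-- Evenness of a makes the integral equal to its conjugate, so the sine part vanishes. -/
theorem integral_one_sub_exp (h : Admissible a μ μm μp) (ζ : Rd d) :
    ∫ z, (a z : ℂ) * (1 - Complex.exp (-Complex.I * ((⟪ζ, z⟫ : ℝ) : ℂ))) = (symbolA a ζ : ℂ) := by
  have hint : Integrable fun z => (a z : ℂ) * (1 - Complex.exp (-Complex.I * ((⟪ζ, z⟫ : ℝ) : ℂ))) := by
    have h1 := integrable_phase (f := fun z => (a z : ℂ)) h.integrable.ofReal (-ζ) 0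
    have h2 := (h.integrable.ofReal (𝕜 := ℂ)).sub h1
    refine h2.congr (Filter.Eventually.of_forall fun z => ?_)
    simp only [Pi.sub_apply, zero_sub, inner_neg_neg, RCLike.ofReal_eq_complex_ofReal]
    ring
  have hswap : ∫ z, (a z : ℂ) * (1 - Complex.exp (-Complex.I * ((⟪ζ, z⟫ : ℝ) : ℂ))) =
      (starRingEnd ℂ) (∫ z, (a z : ℂ) * (1 - Complex.exp (-Complex.I * ((⟪ζ, z⟫ : ℝ) : ℂ)))) := by
    rw [← integral_conj, ← integral_neg_eq_self]
    refine integral_congr_ae (Filter.Eventually.of_forall fun z => ?_)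
    simp only [h.even, map_mul, map_sub, map_one, Complex.conj_ofReal, ← Complex.exp_conj, map_neg,
      Complex.conj_I, inner_neg_right]
    push_cast; ring_nf
  have hre := Complex.conj_eq_iff_re.mp hswap.symm
  rw [← hre]
  congr 1
  have := integral_re hint
  simp only [RCLike.re_to_complex] at this
  rw [← this, symbolA]
  refine integral_congr_ae (Filter.Eventually.of_forall fun z => ?_)
  have e1 : (Complex.exp (-Complex.I * ((⟪ζ, z⟫ : ℝ) : ℂ))).re = Real.cos ⟪z, ζ⟫ := by
    have : -Complex.I * ((⟪ζ, z⟫ : ℝ) : ℂ) = ((-⟪ζ, z⟫ : ℝ) : ℂ) * Complex.I := by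
      push_cast; ring
    rw [this, Complex.exp_ofReal_mul_I_re, Real.cos_neg, real_inner_comm]
  simp only
  rw [Complex.re_ofReal_mul, Complex.sub_re, e1, Complex.one_re, mul_comm]

/-- For `μ = 1` the fiber operator is diagonal in the Fourier basis. -/
theorem fiberOp_unit_cellBasis (h : Admissible a (fun _ _ => 1) 1 1) (ξ : Rd d)
    (n : Fin d → ℤ) :
    fiberOp h ξ (cellBasis d n) =
      (symbolA a (ξ + (2 * Real.pi) • latVec n) : ℂ) • cellBasis d n := by
  refine Lp.ext ?_
  filter_upwards [fiberOp_apply_periodic h ξ (ψ := cellExp n) (fun x m => cellExp_add n m x)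
    (cellBasis_coe n), cellBasis_coe n,
    Lp.coeFn_smul (symbolA a (ξ + (2 * Real.pi) • latVec n) : ℂ) (cellBasis d n)] with x h1 h2 h3
  rw [h1, h3, Pi.smul_apply, h2, smul_eq_mul, ← integral_one_sub_exp h, ← integral_mul_const,
    ← integral_sub_left_eq_self (fun z => (a z : ℂ) * _ * cellExp n x) volume x]
  refine integral_congr_ae (Filter.Eventually.of_forall fun y => ?_)
  have e : cellExp n y = cellExp n x * Complex.exp (-Complex.I *
      ((⟪(2 * Real.pi) • latVec n, x - y⟫ : ℝ) : ℂ)) := by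
    rw [← cellExp_sub, sub_sub_cancel]
  simp only
  rw [e, inner_add_left, Complex.ofReal_add, mul_add, Complex.exp_add]
  push_cast; ring

/-- Parseval's identity in the eigenbasis. -/
theorem hasSum_re_inner_unit (h : Admissible a (fun _ _ => 1) 1 1) (ξ : Rd d) (u : L2cell d) :
    HasSum (fun n : Fin d → ℤ => symbolA a (ξ + (2 * Real.pi) • latVec n) *
      ‖inner ℂ (cellBasis d n) u‖ ^ 2) (inner ℂ (fiberOp h ξ u) u).re := by
  have h1 := (cellBasis d).hasSum_inner_mul_inner (fiberOp h ξ u) u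
  refine (Complex.hasSum_re h1).congr_fun fun n => ?_
  rw [fiberOp_symm, fiberOp_unit_cellBasis, inner_smul_right, mul_assoc, Complex.re_ofReal_mul,
    ← inner_conj_symm u, mul_comm ((starRingEnd ℂ) _), Complex.mul_conj, Complex.normSq_eq_norm_sq,
    Complex.ofReal_re]

theorem hasSum_norm_sq (u : L2cell d) :
    HasSum (fun n : Fin d → ℤ => ‖inner ℂ (cellBasis d n) u‖ ^ 2) (‖u‖ ^ 2) := by
  have h1 := Complex.hasSum_re ((cellBasis d).hasSum_inner_mul_inner u u)
  rw [inner_self_eq_norm_sq_to_K] at h1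
  have e : (((‖u‖ : ℝ) : ℂ) ^ 2).re = ‖u‖ ^ 2 := by norm_cast
  have e2 : (((RCLike.ofReal ‖u‖ : ℂ)) ^ 2).re = ‖u‖ ^ 2 := e
  rw [e2] at h1
  convert h1 using 2 with n
  rw [← inner_conj_symm u, mul_comm ((starRingEnd ℂ) _), Complex.mul_conj,
    Complex.normSq_eq_norm_sq, Complex.ofReal_re]

/-- The symbol has to be bounded only at frequencies present in u. This lets one lemma serve both
the bound on the whole space and the gap on e^⊥, where n = 0 is absent. -/
theorem re_inner_unit_ge (h : Admissible a (fun _ _ => 1) 1 1) (ξ : Rd d) {c : ℝ} (u : L2cell d)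
    (hc : ∀ n : Fin d → ℤ, inner ℂ (cellBasis d n) u ≠ (0 : ℂ) →
      c ≤ symbolA a (ξ + (2 * Real.pi) • latVec n)) :
    c * ‖u‖ ^ 2 ≤ (inner ℂ (fiberOp h ξ u) u).re := by
  refine hasSum_le (fun n => ?_) ((hasSum_norm_sq u).mul_left c) (hasSum_re_inner_unit h ξ u)
  by_cases h0 : inner ℂ (cellBasis d n) u = (0 : ℂ)
  · simp [h0]
  · exact mul_le_mul_of_nonneg_right (hc n h0) (by positivity)

end Fourier

/-! ### Elementary trigonometric inequalities. -/

section Trig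

theorem one_sub_cos_le_abs (s : ℝ) : 1 - Real.cos s ≤ |s| := by
  rcases le_total |s| 2 with h | h
  · have h1 := Real.one_sub_sq_div_two_le_cos (x := s)
    have : s ^ 2 = |s| ^ 2 := (sq_abs s).symm
    nlinarith [abs_nonneg s]
  · linarith [Real.neg_one_le_cos s]

theorem abs_sin_sub_le (s : ℝ) : |Real.sin s - s| ≤ |s| ^ 3 / 6 := by
  wlog hs : 0 ≤ s generalizing s
  · have := this (-s) (by linarith)
    have e : Real.sin s - s = -(Real.sin (-s) - -s) := by rw [Real.sin_neg]; ring
    rwa [abs_neg s, ← abs_neg (_ - _), ← e] at this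
  rw [abs_of_nonneg hs, abs_sub_comm, abs_of_nonneg (by linarith [Real.sin_le hs])]
  linarith [Real.sin_ge_sub_cube hs]

theorem cos_le_quartic (s : ℝ) : Real.cos s ≤ 1 - s ^ 2 / 2 + s ^ 4 / 24 := by
  wlog hs : 0 ≤ s generalizing s
  · have := this (-s) (by linarith)
    have e2 : (-s) ^ 2 = s ^ 2 := by ring
    have e4 : (-s) ^ 4 = s ^ 4 := by ring
    rwa [Real.cos_neg, e2, e4] at this
  -- The derivative is sin x - (x - x³/6), nonnegative for x ≥ 0.
  have hmono : MonotoneOn (fun x : ℝ => 1 - x ^ 2 / 2 + x ^ 4 / 24 - Real.cos x) (Set.Ici 0) := by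
    have hd : ∀ x : ℝ, HasDerivAt (fun x : ℝ => 1 - x ^ 2 / 2 + x ^ 4 / 24 - Real.cos x)
        (-x + x ^ 3 / 6 + Real.sin x) x := fun x => by
      have h1 := ((((hasDerivAt_const x (1 : ℝ)).sub ((hasDerivAt_pow 2 x).div_const 2)).add
        ((hasDerivAt_pow 4 x).div_const 24)).sub (Real.hasDerivAt_cos x))
      refine h1.congr_deriv ?_
      norm_num
      ring
    refine monotoneOn_of_deriv_nonneg (convex_Ici 0)
      (fun x _ => (hd x).continuousAt.continuousWithinAt)
      (fun x _ => (hd x).differentiableAt.differentiableWithinAt) fun x hx => ?_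
    rw [interior_Ici, Set.mem_Ioi] at hx
    rw [(hd x).deriv]
    linarith [Real.sin_ge_sub_cube hx.le]
  have := hmono (Set.mem_Ici.mpr le_rfl) (Set.mem_Ici.mpr hs) hs
  norm_num at this
  linarith

theorem one_sub_cos_ge (s : ℝ) : s ^ 2 / 2 - |s| ^ 3 / 6 ≤ 1 - Real.cos s := by
  have h2 : s ^ 2 = |s| ^ 2 := (sq_abs s).symm
  have h0 := abs_nonneg s
  -- At 3 the left side s²/2 - |s|³/6 becomes nonpositive; below it s⁴/24 ≤ |s|³/8, so the quartic
  -- bound on cos suffices.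
  rcases le_total |s| 3 with h | h
  · have h1 := cos_le_quartic s
    have h4 : s ^ 4 = |s| ^ 4 := by rw [show s ^ 4 = (s ^ 2) ^ 2 by ring, h2]; ring
    have : |s| ^ 4 ≤ 3 * |s| ^ 3 := by
      have := mul_le_mul_of_nonneg_right h (pow_nonneg h0 3)
      nlinarith
    have := pow_nonneg h0 3
    linarith
  · have : |s| ^ 3 ≥ 3 * |s| ^ 2 := by
      have := mul_le_mul_of_nonneg_right h (pow_nonneg h0 2)
      nlinarith
    rw [h2]
    linarith [Real.cos_le_one s]

end Trig

/-! ### Lower bounds for the symbol Â and for the fiber operator. -/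

section Symbol

variable {d : ℕ} {a : Rd d → ℝ} {μ : Rd d → Rd d → ℝ} {μm μp : ℝ}

/-- A nonempty level set is a translate of the kernel of a nonzero functional, a proper subspace. -/
theorem volume_hyperplane {y : Rd d} (hy : y ≠ 0) (c : ℝ) : volume {z : Rd d | ⟪z, y⟫ = c} = 0 := by
  by_cases hne : ∃ z₀ : Rd d, ⟪z₀, y⟫ = c
  · obtain ⟨z₀, hz₀⟩ := hne
    have hK : (LinearMap.ker (innerₗ (Rd d) y) : Submodule ℝ (Rd d)) ≠ ⊤ := by
      intro htop
      have : y ∈ LinearMap.ker (innerₗ (Rd d) y) := by rw [htop]; trivial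
      rw [LinearMap.mem_ker, innerₗ_apply_apply, inner_self_eq_zero] at this
      exact hy this
    have h0 := Measure.addHaar_submodule (volume : Measure (Rd d)) _ hK
    have hset : {z : Rd d | ⟪z, y⟫ = c} =
        (fun z => z + -z₀) ⁻¹' (LinearMap.ker (innerₗ (Rd d) y) : Set (Rd d)) := by
      ext z
      simp only [Set.mem_ofPred_eq, Set.mem_preimage, SetLike.mem_coe, LinearMap.mem_ker,
        innerₗ_apply_apply, inner_add_right, inner_neg_right, real_inner_comm]
      rw [real_inner_comm] at hz₀
      rw [real_inner_comm, ← hz₀]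
      constructor <;> intro h <;> linarith
    rw [hset, measure_preimage_add_right, h0]
  · have : {z : Rd d | ⟪z, y⟫ = c} = ∅ := by
      ext z; simpa using fun h => hne ⟨z, h⟩
    rw [this, measure_empty]

/-- A weighted integral of a nonnegative function with null zero set is positive. -/
theorem integral_weight_pos (h : Admissible a μ μm μp) {g : Rd d → ℝ} (hg : ∀ z, 0 ≤ g z)
    (hi : Integrable fun z => g z * a z) (h0 : volume {z | g z = 0} = 0) :
    0 < ∫ z, g z * a z := by
  rw [integral_pos_iff_support_of_nonneg (fun z => mul_nonneg (hg z) (h.nonneg z)) hi]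
  have hsub : {x | a x ≠ 0} ⊆ Function.support (fun z => g z * a z) ∪ {z | g z = 0} := by
    intro x hx
    by_cases hgx : g x = 0
    · exact Or.inr hgx
    · exact Or.inl (mul_ne_zero hgx hx)
  have := (measure_mono (μ := volume) hsub).trans (measure_union_le _ _)
  rw [h0, add_zero] at this
  exact h.support_pos.trans_le this

theorem integrable_symbol (h : Admissible a μ μm μp) (y : Rd d) :
    Integrable fun z => (1 - Real.cos ⟪z, y⟫) * a z := by
  refine h.integrable.bdd_mul (c := 2) (Continuous.aestronglyMeasurable (by fun_prop))
    (Filter.Eventually.of_forall fun z => ?_)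
  rw [Real.norm_eq_abs, abs_le]
  constructor <;> linarith [Real.cos_le_one ⟪z, y⟫, Real.neg_one_le_cos ⟪z, y⟫]

theorem symbolA_nonneg (h : Admissible a μ μm μp) (y : Rd d) : 0 ≤ symbolA a y :=
  integral_nonneg fun z => mul_nonneg (by linarith [Real.cos_le_one ⟪z, y⟫]) (h.nonneg z)

/-- The factor 1 - cos⟨z, y⟩ vanishes only on countably many hyperplanes, a null set, whereas a is
nonzero on a set of positive measure. -/
theorem symbolA_pos (h : Admissible a μ μm μp) {y : Rd d} (hy : y ≠ 0) : 0 < symbolA a y := by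
  refine integral_weight_pos h (fun z => by linarith [Real.cos_le_one ⟪z, y⟫])
    (integrable_symbol h y) ?_
  have hsub : {z : Rd d | 1 - Real.cos ⟪z, y⟫ = 0} ⊆
      ⋃ k : ℤ, {z : Rd d | ⟪z, y⟫ = k * (2 * Real.pi)} := by
    intro z hz
    have : Real.cos ⟪z, y⟫ = 1 := by
      have : 1 - Real.cos ⟪z, y⟫ = 0 := hz
      linarith
    obtain ⟨k, hk⟩ := (Real.cos_eq_one_iff _).mp this
    exact Set.mem_iUnion.mpr ⟨k, hk.symm⟩
  exact measure_mono_null hsub (measure_iUnion_null fun k => volume_hyperplane hy _)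

theorem continuous_symbolA (h : Admissible a μ μm μp) : Continuous (symbolA a) := by
  refine continuous_of_dominated (bound := fun z => 2 * a z)
    (fun y => (integrable_symbol h y).1) (fun y => Filter.Eventually.of_forall fun z => ?_)
    (h.integrable.const_mul 2) (Filter.Eventually.of_forall fun z => by fun_prop)
  rw [norm_mul, Real.norm_of_nonneg (h.nonneg z)]
  refine mul_le_mul_of_nonneg_right ?_ (h.nonneg z)
  rw [Real.norm_eq_abs, abs_le]
  constructor <;> linarith [Real.cos_le_one ⟪z, y⟫, Real.neg_one_le_cos ⟪z, y⟫]

theorem integral_a_pos (h : Admissible a μ μm μp) : 0 < ∫ z, a z := by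
  have := integral_weight_pos h (g := fun _ => 1) (fun _ => zero_le_one)
    (by simpa using h.integrable) (by simp)
  simpa using this

/-- The Riemann–Lebesgue lemma for the cosine transform of a. -/
theorem tendsto_symbolA (h : Admissible a μ μm μp) :
    Filter.Tendsto (symbolA a) (Filter.cocompact (Rd d)) (nhds (∫ z, a z)) := by
  have h1 := tendsto_integral_exp_inner_smul_cocompact (V := Rd d) (fun z => (a z : ℂ))
  -- The library transform has frequency factor 2π; rescaling y removes it.
  have hscale : Filter.Tendsto (fun y : Rd d => (2 * Real.pi)⁻¹ • y)
      (Filter.cocompact (Rd d)) (Filter.cocompact (Rd d)) :=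
    (Homeomorph.smulOfNeZero ((2 * Real.pi)⁻¹ : ℝ)
      (by positivity)).isClosedEmbedding.tendsto_cocompact
  have h2 := (Complex.continuous_re.tendsto _).comp (h1.comp hscale)
  have h3 : symbolA a = fun y => (∫ z, a z) - (Complex.re ∘ ((fun w : Rd d =>
      ∫ v, Real.fourierChar (-⟪v, w⟫) • (a v : ℂ)) ∘ fun y => (2 * Real.pi)⁻¹ • y)) y := by
    funext y
    have hi : Integrable fun z => Real.cos ⟪z, y⟫ * a z := by
      refine h.integrable.bdd_mul (c := 1) (Continuous.aestronglyMeasurable (by fun_prop))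
        (Filter.Eventually.of_forall fun z => ?_)
      rw [Real.norm_eq_abs]
      exact Real.abs_cos_le_one _
    have hci : Integrable fun v => Real.fourierChar (-⟪v, (2 * Real.pi)⁻¹ • y⟫) • (a v : ℂ) := by
      simp only [Circle.smul_def, Real.fourierChar_apply]
      refine (h.integrable.ofReal (𝕜 := ℂ)).bdd_mul (c := 1)
        (Continuous.aestronglyMeasurable (by fun_prop)) (Filter.Eventually.of_forall fun z => ?_)
      rw [Complex.norm_exp_ofReal_mul_I]
    have e := integral_re hci
    simp only [RCLike.re_to_complex] at e
    simp only [Function.comp_apply]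
    rw [← e, ← integral_sub h.integrable]
    · refine integral_congr_ae (Filter.Eventually.of_forall fun z => ?_)
      simp only [Circle.smul_def, Real.fourierChar_apply, smul_eq_mul, Complex.re_mul_ofReal,
        Complex.exp_ofReal_mul_I_re, inner_smul_right]
      have : 2 * Real.pi * -((2 * Real.pi)⁻¹ * ⟪z, y⟫) = -⟪z, y⟫ := by
        field_simp
      rw [this, Real.cos_neg]; ring
    · exact hci.re
  rw [h3]
  simpa using h2.const_sub (∫ z, a z)

theorem exists_norm_eq (hd : 0 < d) {r : ℝ} (hr : 0 ≤ r) : ∃ y : Rd d, ‖y‖ = r := by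
  refine ⟨EuclideanSpace.single ⟨0, hd⟩ r, ?_⟩
  rw [PiLp.norm_single, Real.norm_of_nonneg hr]

theorem tailMin_le (h : Admissible a μ μm μp) {r : ℝ} {y : Rd d} (hy : r ≤ ‖y‖) :
    tailMin a r ≤ symbolA a y :=
  ciInf_le (f := fun y : {y : Rd d // r ≤ ‖y‖} => symbolA a y)
    ⟨0, by rintro _ ⟨y, rfl⟩; exact symbolA_nonneg h _⟩ ⟨y, hy⟩

/-- Near infinity the symbol exceeds half of ∫ a; on the remaining compact part of {|y| ≥ r} it
attains a positive minimum. The condition d > 0 ensures that the infimum is over a nonempty set. -/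
theorem tailMin_pos (hd : 0 < d) (h : Admissible a μ μm μp) {r : ℝ} (hr : 0 < r) :
    0 < tailMin a r := by
  have hI := integral_a_pos h
  have hev := (tendsto_symbolA h).eventually (lt_mem_nhds (half_lt_self hI))
  obtain ⟨K, hK, hKs⟩ := Filter.mem_cocompact.mp hev
  obtain ⟨y₀, hy₀⟩ := exists_norm_eq hd hr.le
  have hcl : IsClosed {y : Rd d | r ≤ ‖y‖} := isClosed_le continuous_const continuous_norm
  have hne : Nonempty {y : Rd d // r ≤ ‖y‖} := ⟨⟨y₀, hy₀.ge⟩⟩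
  have hex : ∃ c : ℝ, 0 < c ∧ ∀ y ∈ K ∩ {y : Rd d | r ≤ ‖y‖}, c ≤ symbolA a y := by
    rcases (K ∩ {y : Rd d | r ≤ ‖y‖}).eq_empty_or_nonempty with he | hne'
    · exact ⟨1, one_pos, fun y hy => by rw [he] at hy; exact hy.elim⟩
    · obtain ⟨y₁, hy₁, hmin⟩ := (hK.inter_right hcl).exists_isMinOn hne'
        (continuous_symbolA h).continuousOn
      refine ⟨symbolA a y₁, symbolA_pos h ?_, fun y hy => hmin hy⟩
      rintro rfl
      have h2 : r ≤ ‖(0 : Rd d)‖ := hy₁.2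
      rw [norm_zero] at h2
      linarith
  obtain ⟨c, hc, hcK⟩ := hex
  refine lt_of_lt_of_le (lt_min hc (half_pos hI)) (le_ciInf fun y => ?_)
  by_cases hyK : (y : Rd d) ∈ K
  · exact (min_le_left _ _).trans (hcK y ⟨hyK, y.2⟩)
  · exact (min_le_right _ _).trans (le_of_lt (hKs hyK))

theorem moment_pos (hd : 0 < d) (h : Admissible a μ μm μp)
    (hM : Integrable fun x : Rd d => ‖x‖ ^ 4 * a x) {k : ℕ} (hk : k ≤ 4) : 0 < moment a k := by
  refine integral_weight_pos h (g := fun z => ‖z‖ ^ k) (fun z => by positivity)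
    (integrable_moment h hM hk) ?_
  obtain ⟨y, hy⟩ := exists_norm_eq hd zero_le_one
  have hy0 : y ≠ 0 := by rintro rfl; simp at hy
  refine measure_mono_null (fun z hz => ?_) (volume_hyperplane hy0 0)
  have hz : ‖z‖ ^ k = 0 := hz
  have : z = 0 := by
    by_contra h0
    exact pow_ne_zero k (norm_ne_zero_iff.mpr h0) hz
  simp [this]

theorem continuous_integral_inner_sq (h : Admissible a μ μm μp)
    (hM : Integrable fun x : Rd d => ‖x‖ ^ 4 * a x) :
    ContinuousOn (fun θ : Rd d => ∫ z, a z * ⟪z, θ⟫ ^ 2) (Metric.sphere 0 1) := by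
  refine continuousOn_of_dominated (bound := fun z => ‖z‖ ^ 2 * a z)
    (fun θ _ => h.integrable.1.mul (Continuous.aestronglyMeasurable (by fun_prop)))
    (fun θ hθ => Filter.Eventually.of_forall fun z => ?_)
    (integrable_moment h hM (by norm_num))
    (Filter.Eventually.of_forall fun z => Continuous.continuousOn (by fun_prop))
  rw [mem_sphere_zero_iff_norm] at hθ
  rw [norm_mul, Real.norm_of_nonneg (h.nonneg z), norm_pow, mul_comm]
  have := norm_inner_le_norm (𝕜 := ℝ) z θ
  rw [hθ, mul_one] at this
  have ha := h.nonneg z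
  gcongr

theorem sphereMin_bdd (h : Admissible a μ μm μp) : BddBelow (Set.range
    fun θ : Metric.sphere (0 : Rd d) 1 => ∫ z, a z * ⟪z, (θ : Rd d)⟫ ^ 2) :=
  ⟨0, by rintro _ ⟨θ, rfl⟩; exact integral_nonneg fun z => mul_nonneg (h.nonneg z) (sq_nonneg _)⟩

/-- Compactness of the sphere; at a minimising θ the weight ⟨z, θ⟩² vanishes only on a hyperplane.
-/
theorem sphereMin_pos (hd : 0 < d) (h : Admissible a μ μm μp)
    (hM : Integrable fun x : Rd d => ‖x‖ ^ 4 * a x) : 0 < sphereMin a := by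
  obtain ⟨y₀, hy₀⟩ := exists_norm_eq hd zero_le_one
  obtain ⟨θ, hθ, hmin⟩ := (isCompact_sphere (0 : Rd d) 1).exists_isMinOn
    ⟨y₀, by simpa using hy₀⟩ (continuous_integral_inner_sq h hM)
  have hne : Nonempty (Metric.sphere (0 : Rd d) 1) := ⟨⟨y₀, by simpa using hy₀⟩⟩
  have hθ0 : θ ≠ 0 := by rintro rfl; simp at hθ
  have hpos : 0 < ∫ z, a z * ⟪z, θ⟫ ^ 2 := by
    have hi : Integrable fun z => ⟪z, θ⟫ ^ 2 * a z :=
      (integrable_inner_pow h hM θ (k := 2) (by norm_num)).congr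
        (Filter.Eventually.of_forall fun z => by simp only [real_inner_comm]; ring)
    have := integral_weight_pos h (g := fun z => ⟪z, θ⟫ ^ 2) (fun z => sq_nonneg _)
      hi
      (measure_mono_null (fun z hz => by simpa using hz) (volume_hyperplane hθ0 0))
    simpa only [mul_comm] using this
  exact hpos.trans_le (le_ciInf fun θ' => hmin θ'.2)

theorem sphereMin_mul_le (h : Admissible a μ μm μp) (ξ : Rd d) :
    sphereMin a * ‖ξ‖ ^ 2 ≤ ∫ z, a z * ⟪ξ, z⟫ ^ 2 := by
  by_cases hξ : ξ = 0
  · simp [hξ]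
  have hn : 0 < ‖ξ‖ := norm_pos_iff.mpr hξ
  have hθ : ‖ξ‖⁻¹ • ξ ∈ Metric.sphere (0 : Rd d) 1 := by
    rw [mem_sphere_zero_iff_norm, norm_smul, norm_inv, norm_norm, inv_mul_cancel₀ hn.ne']
  have h1 := ciInf_le (sphereMin_bdd h) ⟨_, hθ⟩
  have h2 : ∫ z, a z * ⟪z, ‖ξ‖⁻¹ • ξ⟫ ^ 2 = (‖ξ‖ ^ 2)⁻¹ * ∫ z, a z * ⟪ξ, z⟫ ^ 2 := by
    rw [← integral_const_mul]
    refine integral_congr_ae (Filter.Eventually.of_forall fun z => ?_)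
    simp only
    rw [inner_smul_right, real_inner_comm, mul_pow, inv_pow]; ring
  have h3 : sphereMin a ≤ (‖ξ‖ ^ 2)⁻¹ * ∫ z, a z * ⟪ξ, z⟫ ^ 2 := h2 ▸ h1
  calc sphereMin a * ‖ξ‖ ^ 2 ≤ ((‖ξ‖ ^ 2)⁻¹ * ∫ z, a z * ⟪ξ, z⟫ ^ 2) * ‖ξ‖ ^ 2 := by gcongr
    _ = _ := by field_simp

/-- The choice of `radius` makes the cubic error M₃|ξ|³/6 at most ℳ|ξ|²/4, half of the quadratic
lower bound ℳ|ξ|²/2. -/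
theorem symbolA_ge_quadratic (hd : 0 < d) (h : Admissible a μ μm μp)
    (hM : Integrable fun x : Rd d => ‖x‖ ^ 4 * a x) {ξ : Rd d} (hξ : ‖ξ‖ ≤ radius a) :
    sphereMin a / 4 * ‖ξ‖ ^ 2 ≤ symbolA a ξ := by
  have hM3 := moment_pos hd h hM (k := 3) (by norm_num)
  have h1 : ∫ z, (a z * ⟪ξ, z⟫ ^ 2 / 2 - |a z * ⟪ξ, z⟫ ^ 3| / 6) ≤ symbolA a ξ := by
    refine integral_mono (((integrable_inner_pow h hM ξ (by norm_num)).div_const 2).sub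
      ((integrable_inner_pow h hM ξ (by norm_num)).abs.div_const 6)) (integrable_symbol h ξ)
      fun z => ?_
    have := mul_le_mul_of_nonneg_right (one_sub_cos_ge ⟪z, ξ⟫) (h.nonneg z)
    simp only
    rw [abs_mul, abs_of_nonneg (h.nonneg z), abs_pow, real_inner_comm]
    linarith
  rw [integral_sub ((integrable_inner_pow h hM ξ (by norm_num)).div_const 2)
    ((integrable_inner_pow h hM ξ (by norm_num)).abs.div_const 6), integral_div, integral_div] at h1
  have h2 := sphereMin_mul_le h ξ
  have h3 := integral_abs_inner_pow_le h hM ξ (k := 3) (by norm_num)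
  have h4 : ‖ξ‖ * (2 * moment a 3) ≤ 3 * sphereMin a := by
    rw [radius, le_div_iff₀ (by positivity)] at hξ; exact hξ
  have h5 : ‖ξ‖ ^ 3 * moment a 3 ≤ 3 / 2 * sphereMin a * ‖ξ‖ ^ 2 := by
    have := mul_le_mul_of_nonneg_right h4 (sq_nonneg ‖ξ‖)
    nlinarith
  linarith

theorem one_le_norm_latVec {n : Fin d → ℤ} (hn : n ≠ 0) : 1 ≤ ‖(latVec n : Rd d)‖ := by
  obtain ⟨i, hi⟩ := Function.ne_iff.mp hn
  have h1 : ‖(latVec n : Rd d) i‖ ≤ ‖(latVec n : Rd d)‖ := PiLp.norm_apply_le _ i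
  refine le_trans ?_ h1
  simp only [latVec, Real.norm_eq_abs]
  have : 1 ≤ |n i| := Int.one_le_abs hi
  exact_mod_cast this

/-- A nonzero dual lattice vector has length at least 2π, and ξ takes away at most π. -/
theorem pi_le_norm_shift {ξ : Rd d} (hξ : ‖ξ‖ ≤ Real.pi) {n : Fin d → ℤ} (hn : n ≠ 0) :
    Real.pi ≤ ‖ξ + (2 * Real.pi) • latVec n‖ := by
  have h1 := one_le_norm_latVec hn
  have h2 : ‖(2 * Real.pi) • (latVec n : Rd d)‖ = 2 * Real.pi * ‖(latVec n : Rd d)‖ := by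
    rw [norm_smul, Real.norm_of_nonneg (by positivity)]
  have h3 := norm_sub_le (ξ + (2 * Real.pi) • latVec n) ξ
  rw [add_sub_cancel_left, h2] at h3
  nlinarith [Real.pi_pos]

/-- The constant `C(a)`. -/
noncomputable abbrev bandConst (a : Rd d → ℝ) : ℝ :=
  constC d (sphereMin a) (tailMin a Real.pi) (tailMin a (radius a))

theorem radius_pos (hd : 0 < d) (h : Admissible a μ μm μp)
    (hM : Integrable fun x : Rd d => ‖x‖ ^ 4 * a x) : 0 < radius a := by
  have h1 := sphereMin_pos hd h hM
  have h2 := moment_pos hd h hM (k := 3) (by norm_num)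
  rw [radius]; positivity

theorem bandConst_pos (hd : 0 < d) (h : Admissible a μ μm μp)
    (hM : Integrable fun x : Rd d => ‖x‖ ^ 4 * a x) : 0 < bandConst a := by
  have h1 := sphereMin_pos hd h hM
  have h2 := tailMin_pos hd h (radius_pos hd h hM)
  have h3 := tailMin_pos hd h Real.pi_pos
  have hd' : (0 : ℝ) < d := by exact_mod_cast hd
  rw [bandConst, constC]
  refine lt_min (by positivity) (lt_min (by positivity) (by positivity))

/-- The three entries of the minimum defining C(a) serve the three cases n = 0 with |ξ| ≤ r, n = 0
with |ξ| ≥ r, and n ≠ 0; in the last two |ξ|² ≤ π²d turns a constant into a quadratic bound. -/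
theorem symbolA_shift_ge (hd : 0 < d) (h : Admissible a μ μm μp)
    (hM : Integrable fun x : Rd d => ‖x‖ ^ 4 * a x) {ξ : Rd d} (hξ : ‖ξ‖ ≤ Real.pi)
    (n : Fin d → ℤ) : bandConst a * ‖ξ‖ ^ 2 ≤ symbolA a (ξ + (2 * Real.pi) • latVec n) := by
  have hd' : (1 : ℝ) ≤ d := by exact_mod_cast hd
  have hC := bandConst_pos hd h hM
  have hsq : ‖ξ‖ ^ 2 ≤ Real.pi ^ 2 * d := by
    have : ‖ξ‖ ^ 2 ≤ Real.pi ^ 2 := by gcongr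
    nlinarith [sq_nonneg Real.pi]
  have hbig : ∀ {c : ℝ}, bandConst a ≤ c / (Real.pi ^ 2 * d) → bandConst a * ‖ξ‖ ^ 2 ≤ c := by
    intro c hc
    rw [le_div_iff₀ (by positivity)] at hc
    exact (mul_le_mul_of_nonneg_left hsq hC.le).trans hc
  by_cases hn : n = 0
  · subst hn
    rw [latVec_zero, smul_zero, add_zero]
    rcases le_total ‖ξ‖ (radius a) with hr | hr
    · refine le_trans ?_ (symbolA_ge_quadratic hd h hM hr)
      gcongr
      exact min_le_left _ _
    · exact (hbig ((min_le_right _ _).trans (min_le_left _ _))).trans (tailMin_le h hr)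
  · exact (hbig ((min_le_right _ _).trans (min_le_right _ _))).trans
      (tailMin_le h (pi_le_norm_shift hξ hn))

theorem fiberOp_lower (hd : 0 < d) (h : Admissible a μ μm μp)
    (hM : Integrable fun x : Rd d => ‖x‖ ^ 4 * a x) {ξ : Rd d} (hξ : ‖ξ‖ ≤ Real.pi)
    (u : L2cell d) :
    μm * bandConst a * ‖ξ‖ ^ 2 * ‖u‖ ^ 2 ≤ (inner ℂ (fiberOp h ξ u) u).re := by
  refine le_trans ?_ (re_inner_fiberOp_ge h ξ u)
  have := re_inner_unit_ge h.unit ξ u (c := bandConst a * ‖ξ‖ ^ 2)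
    fun n _ => symbolA_shift_ge hd h hM hξ n
  have := mul_le_mul_of_nonneg_left this h.pos.le
  linarith

/-- At ξ = 0 and u ⊥ e only frequencies 2πn with n ≠ 0 occur, and the symbol there is at least 𝒞_π.
-/
theorem fiberOp_gap (h : Admissible a μ μm μp) (u : L2cell d)
    (hu : inner ℂ (oneCell d) u = (0 : ℂ)) :
    μm * tailMin a Real.pi * ‖u‖ ^ 2 ≤ (inner ℂ (fiberOp h 0 u) u).re := by
  refine le_trans ?_ (re_inner_fiberOp_ge h 0 u)
  have := re_inner_unit_ge h.unit 0 u (c := tailMin a Real.pi) fun n hn => by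
    refine tailMin_le h (pi_le_norm_shift (by simp [Real.pi_pos.le]) ?_)
    rintro rfl
    rw [cellBasis_zero] at hn
    exact hn hu
  have := mul_le_mul_of_nonneg_left this h.pos.le
  linarith

/-- The form gap bounds every nonzero spectral point. The punctured spectrum is nonempty because
𝔸(0) ≠ 0, as the gap shows on a nonconstant exponential. -/
theorem spectralGap_ge (hd : 0 < d) (h : Admissible a μ μm μp) :
    μm * tailMin a Real.pi ≤ spectralGap h := by
  have hpos : 0 < μm * tailMin a Real.pi := mul_pos h.pos (tailMin_pos hd h Real.pi_pos)
  have hA0 : fiberOp h 0 ≠ 0 := by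
    intro h0
    set n : Fin d → ℤ := fun _ => 1 with hn
    have hn0 : n ≠ 0 := fun h => by
      have := congrFun h ⟨0, hd⟩
      simp [hn] at this
    have h1 := fiberOp_gap h (cellBasis d n) (by
      rw [← cellBasis_zero]; exact (cellBasis d).orthonormal.2 hn0.symm)
    rw [h0, (cellBasis d).orthonormal.1 n] at h1
    simp only [_root_.zero_apply, inner_zero_left, Complex.zero_re] at h1
    linarith
  rw [spectralGap, Metric.le_infDist (spectrum_diff_zero_nonempty (fiberOp_symm h 0) hA0)]
  intro z hz
  rw [dist_zero_left]
  exact le_norm_of_mem_spectrum (fiberOp_symm h 0) norm_oneCell (fiberOp_zero_one h)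
    (fiberOp_gap h) hz.1 hz.2

/-- From 1 - cos s ≤ |s|, the symbol on |y| = π is at most πM₁, so in fact δ₀ ≤ π/3. This places ξ
in the range of the Fourier bounds. -/
theorem delta0_le_pi (hd : 0 < d) (h : Admissible a μ μm μp)
    (hM : Integrable fun x : Rd d => ‖x‖ ^ 4 * a x) : delta0 a μm μp ≤ Real.pi := by
  obtain ⟨y, hy⟩ := exists_norm_eq hd Real.pi_pos.le
  have hM1 := moment_pos hd h hM (k := 1) (by norm_num)
  have hT := tailMin_pos hd h Real.pi_pos
  have hμ : μm ≤ μp := (h.lower 0 0).trans (h.upper 0 0)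
  have hμm := h.pos
  have h1 : symbolA a y ≤ Real.pi * moment a 1 := by
    have h2 := integral_abs_inner_pow_le h hM y (k := 1) (by norm_num)
    rw [hy, pow_one] at h2
    refine le_trans (integral_mono (integrable_symbol h y)
      (integrable_inner_pow h hM y (by norm_num)).abs fun z => ?_) h2
    simp only
    rw [abs_mul, abs_of_nonneg (h.nonneg z), pow_one, mul_comm, real_inner_comm]
    exact mul_le_mul_of_nonneg_left (one_sub_cos_le_abs _) (h.nonneg z)
  have h3 := (tailMin_le h hy.ge).trans h1
  rw [delta0, div_le_iff₀ (by have := hμm.trans_le hμ; positivity)]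
  calc μm * tailMin a Real.pi ≤ μp * (Real.pi * moment a 1) := by
        gcongr
        exact h.upper_nonneg
    _ ≤ _ := by
        have : 0 ≤ μp * (Real.pi * moment a 1) :=
          mul_nonneg h.upper_nonneg (mul_nonneg Real.pi_pos.le hM1.le)
        linarith

end Symbol

/-! ### The action of the fiber operator on constants. -/

section Weighted

variable {d : ℕ} {a : Rd d → ℝ} {μ : Rd d → Rd d → ℝ} {μm μp : ℝ}

theorem cellMeasure_univ : cellMeasure d Set.univ = 1 := by
  have h := (measurePreserving_toTorus (d := d)).measure_preimage
    (s := Set.univ) MeasurableSet.univ.nullMeasurableSet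
  rw [Set.preimage_univ] at h
  rw [h, measure_univ]

/-- The weighted jump integral `∫ a(x - y) μ(x, y) φ(x - y) dy`. -/
noncomputable def jumpIntegral (a : Rd d → ℝ) (μ : Rd d → Rd d → ℝ) (φ : Rd d → ℝ) (x : Rd d) : ℝ :=
  ∫ y, a (x - y) * μ x y * φ (x - y)

theorem abs_jumpIntegral_le (h : Admissible a μ μm μp) {φ : Rd d → ℝ}
    (hi : Integrable fun z => a z * φ z) (x : Rd d) :
    |jumpIntegral a μ φ x| ≤ μp * ∫ z, |a z * φ z| := by
  rw [← integral_sub_left_eq_self (fun z => |a z * φ z|) volume x, ← integral_const_mul,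
    ← Real.norm_eq_abs]
  refine norm_integral_le_of_norm_le ((hi.abs.comp_sub_left x).const_mul μp)
    (Filter.Eventually.of_forall fun y => ?_)
  have e : a (x - y) * μ x y * φ (x - y) = μ x y * (a (x - y) * φ (x - y)) := by ring
  rw [e, norm_mul, ← Real.norm_eq_abs]
  exact mul_le_mul_of_nonneg_right (h.abs_le x y) (norm_nonneg _)

theorem jumpIntegral_aesm (h : Admissible a μ μm μp) {φ : Rd d → ℝ} (hφ : Continuous φ) :
    AEStronglyMeasurable (jumpIntegral a μ φ) (cellMeasure d) := by
  have h1 : AEStronglyMeasurable (fun q : Rd d × Rd d => a (q.1 - q.2)) (volume.prod volume) :=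
    h.integrable.1.comp_quasiMeasurePreserving (quasiMeasurePreserving_sub volume volume)
  have h2 : AEStronglyMeasurable (fun q : Rd d × Rd d => φ (q.1 - q.2)) (volume.prod volume) :=
    (hφ.comp (continuous_fst.sub continuous_snd)).aestronglyMeasurable
  exact (((h1.mul h.aesm).mul h2).integral_prod_right').restrict

theorem jumpIntegral_memLp (h : Admissible a μ μm μp) {φ : Rd d → ℝ} (hφ : Continuous φ)
    (hi : Integrable fun z => a z * φ z) : MemLp (jumpIntegral a μ φ) 2 (cellMeasure d) :=
  MemLp.of_bound (jumpIntegral_aesm h hφ) (μp * ∫ z, |a z * φ z|)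
    (Filter.Eventually.of_forall fun x => abs_jumpIntegral_le h hi x)

theorem jumpIntegral_sub (h : Admissible a μ μm μp) {φ ψ : Rd d → ℝ}
    (hφ : Integrable fun z => a z * φ z) (hψ : Integrable fun z => a z * ψ z) :
    ∀ᵐ x ∂cellMeasure d, jumpIntegral a μ (fun z => φ z - ψ z) x =
      jumpIntegral a μ φ x - jumpIntegral a μ ψ x := by
  filter_upwards [aesm_mu h] with x hx
  rw [jumpIntegral, jumpIntegral, jumpIntegral, ← integral_sub (integrable_kernel_of_aesm h hx hφ)
    (integrable_kernel_of_aesm h hx hψ)]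
  simp only [mul_sub]

theorem jumpIntegral_sum (h : Admissible a μ μm μp) {ι : Type*} (s : Finset ι) (c : ι → ℝ)
    {φ : ι → Rd d → ℝ} (hφ : ∀ i, Integrable fun z => a z * φ i z) :
    ∀ᵐ x ∂cellMeasure d, jumpIntegral a μ (fun z => ∑ i ∈ s, c i * φ i z) x =
      ∑ i ∈ s, c i * jumpIntegral a μ (φ i) x := by
  filter_upwards [aesm_mu h] with x hx
  simp only [jumpIntegral, ← integral_const_mul]
  rw [← integral_finsetSum _ fun i _ => (integrable_kernel_of_aesm h hx (hφ i)).const_mul _]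
  refine integral_congr_ae (Filter.Eventually.of_forall fun y => ?_)
  simp only
  rw [Finset.mul_sum]
  exact Finset.sum_congr rfl fun i _ => by ring

theorem norm_realClass_le {f : Rd d → ℝ} (hf : MemLp f 2 (cellMeasure d)) {C : ℝ} (hC : 0 ≤ C)
    (hb : ∀ᵐ x ∂cellMeasure d, |f x| ≤ C) : ‖realClass hf‖ ≤ C := by
  rw [Lp.norm_def, eLpNorm_congr_ae (realClass_coe hf)]
  refine ENNReal.toReal_le_of_le_ofReal hC ?_
  have := eLpNorm_le_of_ae_bound (p := 2) (μ := cellMeasure d) (f := fun x => (f x : ℂ)) (C := C)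
    (by filter_upwards [hb] with x hx; rwa [Complex.norm_real, Real.norm_eq_abs])
  rwa [cellMeasure_univ, ENNReal.one_rpow, one_mul] at this

theorem norm_jumpClass_le (h : Admissible a μ μm μp) {φ : Rd d → ℝ} (hφ : Continuous φ)
    (hi : Integrable fun z => a z * φ z) {C : ℝ} (hC : ∫ z, |a z * φ z| ≤ C) :
    ‖realClass (jumpIntegral_memLp h hφ hi)‖ ≤ μp * C := by
  have h0 : 0 ≤ ∫ z, |a z * φ z| := integral_nonneg fun z => abs_nonneg _
  refine norm_realClass_le _ (mul_nonneg h.upper_nonneg (h0.trans hC))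
    (Filter.Eventually.of_forall fun x => ?_)
  exact (abs_jumpIntegral_le h hi x).trans (mul_le_mul_of_nonneg_left hC h.upper_nonneg)

theorem realClass_sub_congr {f g k : Rd d → ℝ} (hf : MemLp f 2 (cellMeasure d))
    (hg : MemLp g 2 (cellMeasure d)) (hk : MemLp k 2 (cellMeasure d))
    (hfg : ∀ᵐ x ∂cellMeasure d, k x = f x - g x) :
    realClass hk = realClass hf - realClass hg := by
  refine Lp.ext ?_
  filter_upwards [realClass_coe hf, realClass_coe hg, realClass_coe hk, hfg,
    Lp.coeFn_sub (realClass hf) (realClass hg)] with x h1 h2 h3 h4 h5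
  rw [h3, h4, h5, Pi.sub_apply, h1, h2]; push_cast; ring

theorem inner_realClass {f g : Rd d → ℝ} (hf : MemLp f 2 (cellMeasure d))
    (hg : MemLp g 2 (cellMeasure d)) :
    inner ℂ (realClass hf) (realClass hg) = ((∫ x in cell d, f x * g x : ℝ) : ℂ) := by
  rw [L2.inner_def, ← integral_complex_ofReal]
  refine integral_congr_ae ?_
  filter_upwards [realClass_coe hf, realClass_coe hg] with x h1 h2
  rw [h1, h2, RCLike.inner_apply, Complex.conj_ofReal]; push_cast; ring

theorem oneCell_eq_realClass :
    oneCell d = realClass (memLp_const (1 : ℝ) : MemLp (fun _ => (1 : ℝ)) 2 (cellMeasure d)) := by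
  refine Lp.ext ?_
  filter_upwards [oneCell_coe,
    realClass_coe (memLp_const (1 : ℝ) : MemLp (fun _ => (1 : ℝ)) 2 (cellMeasure d))] with x h1 h2
  rw [h1, h2]; simp

theorem inner_oneCell_realClass {f : Rd d → ℝ} (hf : MemLp f 2 (cellMeasure d)) :
    inner ℂ (oneCell d) (realClass hf) = ((∫ x in cell d, f x : ℝ) : ℂ) := by
  rw [oneCell_eq_realClass, inner_realClass]; simp

/-! ### The action of `𝔸(ξ)` on constants -/

theorem integrable_one_sub_cos (h : Admissible a μ μm μp) (ξ : Rd d) :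
    Integrable fun z => a z * (1 - Real.cos ⟪ξ, z⟫) :=
  (integrable_symbol h ξ).congr (Filter.Eventually.of_forall fun z => by
    simp only [real_inner_comm]; ring)

theorem integrable_sin (h : Admissible a μ μm μp) (ξ : Rd d) :
    Integrable fun z => a z * Real.sin ⟪ξ, z⟫ := by
  have : Integrable fun z => Real.sin ⟪ξ, z⟫ * a z := by
    refine h.integrable.bdd_mul (c := 1) (Continuous.aestronglyMeasurable (by fun_prop))
      (Filter.Eventually.of_forall fun z => ?_)
    rw [Real.norm_eq_abs]
    exact Real.abs_sin_le_one _
  exact this.congr (Filter.Eventually.of_forall fun z => mul_comm _ _)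

theorem integrable_inner (h : Admissible a μ μm μp)
    (hM : Integrable fun x : Rd d => ‖x‖ ^ 4 * a x) (ξ : Rd d) :
    Integrable fun z => a z * ⟪ξ, z⟫ := by
  simpa using integrable_inner_pow h hM ξ (k := 1) (by norm_num)

/-- The class of `∫ a μ (1 - cos⟨ξ, x - y⟩) dy`. -/
noncomputable def cosClass (h : Admissible a μ μm μp) (ξ : Rd d) : L2cell d :=
  realClass (jumpIntegral_memLp h (by fun_prop) (integrable_one_sub_cos h ξ))

/-- The class of `∫ a μ sin⟨ξ, x - y⟩ dy`. -/
noncomputable def sinClass (h : Admissible a μ μm μp) (ξ : Rd d) : L2cell d :=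
  realClass (jumpIntegral_memLp h (by fun_prop) (integrable_sin h ξ))

/-- The class of `∫ a μ ⟨ξ, x - y⟩ dy`. -/
noncomputable def linClass (h : Admissible a μ μm μp)
    (hM : Integrable fun x : Rd d => ‖x‖ ^ 4 * a x) (ξ : Rd d) : L2cell d :=
  realClass (jumpIntegral_memLp h (by fun_prop) (integrable_inner h hM ξ))

/-- Euler's formula separates real and imaginary parts: the cosine class is of order |ξ|², the sine
class of order |ξ|. -/
theorem fiberOp_one (h : Admissible a μ μm μp) (ξ : Rd d) :
    fiberOp h ξ (oneCell d) = cosClass h ξ + Complex.I • sinClass h ξ := by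
  refine Lp.ext ?_
  filter_upwards [fiberOp_apply_periodic h ξ (ψ := fun _ => 1) (fun _ _ => rfl) oneCell_coe,
    Lp.coeFn_add (cosClass h ξ) (Complex.I • sinClass h ξ),
    Lp.coeFn_smul Complex.I (sinClass h ξ),
    realClass_coe (jumpIntegral_memLp h (by fun_prop) (integrable_one_sub_cos h ξ)),
    realClass_coe (jumpIntegral_memLp h (by fun_prop) (integrable_sin h ξ)),
    aesm_mu h] with x h1 h2 h3 h4 h5 hx
  have i1 := (integrable_kernel_of_aesm h hx (integrable_one_sub_cos h ξ)).ofReal (𝕜 := ℂ)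
  have i2 := ((integrable_kernel_of_aesm h hx (integrable_sin h ξ)).ofReal (𝕜 := ℂ)).const_mul
    Complex.I
  rw [h1, h2, Pi.add_apply, h3, Pi.smul_apply, cosClass, sinClass, h4, h5, jumpIntegral,
    jumpIntegral, ← integral_complex_ofReal, ← integral_complex_ofReal, smul_eq_mul,
    ← integral_const_mul]
  refine Eq.trans ?_ (integral_add i1 i2)
  refine integral_congr_ae (Filter.Eventually.of_forall fun y => ?_)
  have e : Complex.exp (-Complex.I * ((⟪ξ, x - y⟫ : ℝ) : ℂ)) =
      (Real.cos ⟪ξ, x - y⟫ : ℂ) - Complex.I * (Real.sin ⟪ξ, x - y⟫ : ℂ) := by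
    have : -Complex.I * ((⟪ξ, x - y⟫ : ℝ) : ℂ) = ((-⟪ξ, x - y⟫ : ℝ) : ℂ) * Complex.I := by
      push_cast; ring
    rw [this, Complex.exp_mul_I, ← Complex.ofReal_cos, ← Complex.ofReal_sin, Real.cos_neg,
      Real.sin_neg]
    push_cast; ring
  simp only
  rw [e]
  push_cast; ring

theorem norm_linClass_le (h : Admissible a μ μm μp)
    (hM : Integrable fun x : Rd d => ‖x‖ ^ 4 * a x) (ξ : Rd d) :
    ‖linClass h hM ξ‖ ≤ μp * moment a 1 * ‖ξ‖ := by
  have h1 := integral_abs_inner_pow_le h hM ξ (k := 1) (by norm_num)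
  simp only [pow_one] at h1
  refine (norm_jumpClass_le h (by fun_prop) (integrable_inner h hM ξ) h1).trans (le_of_eq ?_)
  ring

theorem norm_cosClass_le (h : Admissible a μ μm μp)
    (hM : Integrable fun x : Rd d => ‖x‖ ^ 4 * a x) (ξ : Rd d) :
    ‖cosClass h ξ‖ ≤ μp * moment a 2 * ‖ξ‖ ^ 2 / 2 := by
  have h1 := integral_abs_inner_pow_le h hM ξ (k := 2) (by norm_num)
  have h2 : ∫ z, |a z * (1 - Real.cos ⟪ξ, z⟫)| ≤ ‖ξ‖ ^ 2 * moment a 2 / 2 := by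
    refine le_trans ?_ (div_le_div_of_nonneg_right h1 zero_le_two)
    rw [← integral_div]
    refine integral_mono (integrable_one_sub_cos h ξ).abs
      ((integrable_inner_pow h hM ξ (by norm_num)).abs.div_const 2) fun z => ?_
    simp only
    rw [abs_mul, abs_mul, mul_div_assoc]
    refine mul_le_mul_of_nonneg_left ?_ (abs_nonneg _)
    rw [abs_of_nonneg (by linarith [Real.cos_le_one ⟪ξ, z⟫]), abs_of_nonneg (sq_nonneg _)]
    linarith [Real.one_sub_sq_div_two_le_cos (x := ⟪ξ, z⟫)]
  refine (norm_jumpClass_le h (by fun_prop) (integrable_one_sub_cos h ξ) h2).trans (le_of_eq ?_)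
  ring

/-- The exponent is left free: k = 2 is used for the residual of the first-order equation, k = 3 for
the form, where a fourth-order total is needed. -/
theorem norm_sinClass_sub_le_of (h : Admissible a μ μm μp)
    (hM : Integrable fun x : Rd d => ‖x‖ ^ 4 * a x) (ξ : Rd d) {k : ℕ} (hk : k ≤ 4) {c : ℝ}
    (hc : ∀ s : ℝ, |Real.sin s - s| ≤ c * |s| ^ k) :
    ‖sinClass h ξ - linClass h hM ξ‖ ≤ μp * (c * (‖ξ‖ ^ k * moment a k)) := by
  have hc0 : 0 ≤ c := by simpa using (abs_nonneg _).trans (hc 1)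
  have h1 := integral_abs_inner_pow_le h hM ξ hk
  have hi : Integrable fun z => a z * (Real.sin ⟪ξ, z⟫ - ⟪ξ, z⟫) :=
    ((integrable_sin h ξ).sub (integrable_inner h hM ξ)).congr
      (Filter.Eventually.of_forall fun z => by simp only [Pi.sub_apply]; ring)
  have h2 : ∫ z, |a z * (Real.sin ⟪ξ, z⟫ - ⟪ξ, z⟫)| ≤ c * (‖ξ‖ ^ k * moment a k) := by
    refine le_trans ?_ (mul_le_mul_of_nonneg_left h1 hc0)
    rw [← integral_const_mul]
    refine integral_mono hi.abs ((integrable_inner_pow h hM ξ hk).abs.const_mul c) fun z => ?_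
    simp only
    rw [abs_mul, abs_mul, mul_left_comm, abs_pow]
    exact mul_le_mul_of_nonneg_left (hc _) (abs_nonneg _)
  rw [sinClass, linClass, ← realClass_sub_congr _ _ (jumpIntegral_memLp h (by fun_prop) hi)
    (jumpIntegral_sub h (integrable_sin h ξ) (integrable_inner h hM ξ))]
  exact norm_jumpClass_le h (by fun_prop) hi h2

/-- For |s| ≤ 3 this follows from the cubic bound; for |s| ≥ 3 from 1 + |s| ≤ |s|²/2. -/
theorem abs_sin_sub_le_sq (s : ℝ) : |Real.sin s - s| ≤ 1 / 2 * |s| ^ 2 := by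
  have h0 := abs_nonneg s
  rcases le_total |s| 3 with h | h
  · have h1 := abs_sin_sub_le s
    have := mul_le_mul_of_nonneg_right h (pow_nonneg h0 2)
    nlinarith
  · have h1 := abs_sub (Real.sin s) s
    have h2 := Real.abs_sin_le_one s
    nlinarith

theorem norm_sinClass_sub_le (h : Admissible a μ μm μp)
    (hM : Integrable fun x : Rd d => ‖x‖ ^ 4 * a x) (ξ : Rd d) :
    ‖sinClass h ξ - linClass h hM ξ‖ ≤ μp * moment a 2 * ‖ξ‖ ^ 2 / 2 := by
  refine (norm_sinClass_sub_le_of h hM ξ (k := 2) (by norm_num) abs_sin_sub_le_sq).trans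
    (le_of_eq ?_)
  ring

theorem norm_sinClass_sub_le' (h : Admissible a μ μm μp)
    (hM : Integrable fun x : Rd d => ‖x‖ ^ 4 * a x) (ξ : Rd d) :
    ‖sinClass h ξ - linClass h hM ξ‖ ≤ μp * moment a 3 * ‖ξ‖ ^ 3 / 6 := by
  refine (norm_sinClass_sub_le_of h hM ξ (k := 3) (c := 1 / 6) (by norm_num) fun s => ?_).trans
    (le_of_eq ?_)
  · linarith [abs_sin_sub_le s]
  · ring

/-- Solvability of the cell problem: the right-hand side has zero mean. -/
theorem inner_oneCell_linClass (h : Admissible a μ μm μp)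
    (hM : Integrable fun x : Rd d => ‖x‖ ^ 4 * a x) (ξ : Rd d) :
    inner ℂ (oneCell d) (linClass h hM ξ) = (0 : ℂ) := by
  -- Symmetry makes (𝔸(ζ)e, e) real, while the mean of the sine class is its imaginary part.
  have hsin : ∀ ζ : Rd d, inner ℂ (oneCell d) (sinClass h ζ) = (0 : ℂ) := fun ζ => by
    have h1 := fiberOp_symm h ζ (oneCell d) (oneCell d)
    rw [fiberOp_one, inner_add_left, inner_add_right, inner_smul_left, inner_smul_right,
      ← inner_conj_symm (sinClass h ζ), ← inner_conj_symm (cosClass h ζ)] at h1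
    rw [cosClass, sinClass, inner_oneCell_realClass, inner_oneCell_realClass, Complex.conj_ofReal,
      Complex.conj_ofReal, Complex.conj_I] at h1
    rw [sinClass, inner_oneCell_realClass]
    have h2 := add_left_cancel h1
    have h3 : (2 * Complex.I) * ((∫ x in cell d, jumpIntegral a μ
        (fun z => Real.sin ⟪ζ, z⟫) x : ℝ) : ℂ) = 0 := by linear_combination -h2
    simpa using h3
  have hscale : ∀ t : ℝ, linClass h hM (t • ξ) = (t : ℂ) • linClass h hM ξ := fun t => by
    refine Lp.ext ?_
    filter_upwards [realClass_coe (jumpIntegral_memLp h (by fun_prop) (integrable_inner h hM ξ)),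
      realClass_coe (jumpIntegral_memLp h (by fun_prop) (integrable_inner h hM (t • ξ))),
      Lp.coeFn_smul (t : ℂ) (linClass h hM ξ)] with x h1 h2 h3
    rw [h3, Pi.smul_apply, linClass, linClass, h1, h2, smul_eq_mul, ← Complex.ofReal_mul,
      jumpIntegral, jumpIntegral, ← integral_const_mul]
    congr 1
    refine integral_congr_ae (Filter.Eventually.of_forall fun y => ?_)
    simp only [inner_smul_left, conj_trivial]; ring
  set B : ℝ := μp * moment a 3 * ‖ξ‖ ^ 3 / 6 with hB
  -- The sine class at tξ has mean zero and is t times the linear class up to O(t³); dividing by t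
  -- and letting t → 0 kills the mean of the linear class.
  have hbound : ∀ t : ℝ, 0 < t → ‖inner ℂ (oneCell d) (linClass h hM ξ)‖ ≤ B * t ^ 2 := by
    intro t ht
    have h1 : t * ‖inner ℂ (oneCell d) (linClass h hM ξ)‖ ≤ B * t ^ 3 := by
      calc t * ‖inner ℂ (oneCell d) (linClass h hM ξ)‖
          = ‖inner ℂ (oneCell d) (sinClass h (t • ξ) - linClass h hM (t • ξ))‖ := by
            rw [inner_sub_right, hsin, hscale, inner_smul_right, zero_sub, norm_neg, norm_mul,
              Complex.norm_real, Real.norm_of_nonneg ht.le]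
        _ ≤ ‖oneCell d‖ * ‖sinClass h (t • ξ) - linClass h hM (t • ξ)‖ := norm_inner_le_norm _ _
        _ ≤ 1 * (μp * moment a 3 * ‖t • ξ‖ ^ 3 / 6) := by
            rw [norm_oneCell]; gcongr; exact norm_sinClass_sub_le' h hM _
        _ = _ := by rw [norm_smul, Real.norm_of_nonneg ht.le, hB]; ring
    have h2 : t * ‖inner ℂ (oneCell d) (linClass h hM ξ)‖ ≤ t * (B * t ^ 2) := by linarith
    exact le_of_mul_le_mul_left h2 ht
  have hlim : Filter.Tendsto (fun t : ℝ => B * t ^ 2) (nhdsWithin 0 (Set.Ioi 0)) (nhds 0) := by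
    have : Filter.Tendsto (fun t : ℝ => B * t ^ 2) (nhds 0) (nhds (B * 0 ^ 2)) :=
      (Continuous.tendsto (by fun_prop) _)
    simpa using this.mono_left nhdsWithin_le_nhds
  have := ge_of_tendsto hlim (Filter.eventually_of_mem self_mem_nhdsWithin hbound)
  exact norm_le_zero_iff.mp this

end Weighted

/-! ### Solutions of the cell problems and the corrector. -/

section CellProblem

variable {d : ℕ} {a : Rd d → ℝ} {μ : Rd d → Rd d → ℝ} {μm μp : ℝ}

/-- The `j`-th coordinate direction. -/
noncomputable abbrev coordVec (j : Fin d) : Rd d := EuclideanSpace.single j (1 : ℝ)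

theorem inner_coordVec (j : Fin d) (z : Rd d) : ⟪coordVec j, z⟫ = z j := by
  simp [coordVec, EuclideanSpace.inner_single_left]

theorem jumpIntegral_coordVec (j : Fin d) (x : Rd d) :
    jumpIntegral a μ (fun z => ⟪coordVec j, z⟫) x = ∫ y, a (x - y) * μ x y * (x j - y j) := by
  simp only [jumpIntegral, inner_coordVec, PiLp.sub_apply]

theorem fiberOp_zero_realClass (h : Admissible a μ μm μp) {v : Rd d → ℝ}
    (hp : ∀ x (n : Fin d → ℤ), v (x + latVec n) = v x) (hv : MemLp v 2 (cellMeasure d)) :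
    fiberOp h 0 (realClass hv) =ᵐ[cellMeasure d] fun x =>
      ((∫ y, a (x - y) * μ x y * (v x - v y) : ℝ) : ℂ) := by
  filter_upwards [fiberOp_apply_periodic h 0 (ψ := fun x => (v x : ℂ))
    (fun x n => by rw [hp]) (realClass_coe hv)] with x hx
  rw [hx, ← integral_complex_ofReal]
  refine integral_congr_ae (Filter.Eventually.of_forall fun y => ?_)
  simp

/-- Turns the cell problem into an equation for 𝔸(0) in L₂(Ω), to which the gap applies. -/
theorem IsCellSolution.fiberOp_eq {v : Rd d → ℝ} {j : Fin d} (hv : IsCellSolution a μ j v)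
    (h : Admissible a μ μm μp) (hM : Integrable fun x : Rd d => ‖x‖ ^ 4 * a x) :
    fiberOp h 0 (realClass hv.memLp) = linClass h hM (coordVec j) := by
  refine Lp.ext ?_
  filter_upwards [fiberOp_zero_realClass h hv.periodic hv.memLp, hv.eqn,
    realClass_coe (jumpIntegral_memLp h (by fun_prop) (integrable_inner h hM (coordVec j)))]
    with x h1 h2 h3
  rw [h1, h2, linClass, h3, jumpIntegral_coordVec]

theorem IsCellSolution.inner_one {v : Rd d → ℝ} {j : Fin d} (hv : IsCellSolution a μ j v) :
    inner ℂ (oneCell d) (realClass hv.memLp) = (0 : ℂ) := by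
  rw [inner_oneCell_realClass, hv.mean_zero, Complex.ofReal_zero]

theorem gap_pos (hd : 0 < d) (h : Admissible a μ μm μp) : 0 < μm * tailMin a Real.pi :=
  mul_pos h.pos (tailMin_pos hd h Real.pi_pos)

/-- The difference of two solutions is orthogonal to e and annihilated by 𝔸(0), so the gap makes it
zero on the cell; periodicity carries this to the whole space. -/
theorem IsCellSolution.ae_eq (hd : 0 < d) (h : Admissible a μ μm μp)
    (hM : Integrable fun x : Rd d => ‖x‖ ^ 4 * a x) {v v' : Rd d → ℝ} {j : Fin d}
    (hv : IsCellSolution a μ j v) (hv' : IsCellSolution a μ j v') : v' =ᵐ[volume] v := by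
  have h1 : fiberOp h 0 (realClass hv'.memLp - realClass hv.memLp) = 0 := by
    rw [map_sub, hv.fiberOp_eq h hM, hv'.fiberOp_eq h hM, sub_self]
  have h2 := fiberOp_gap h (realClass hv'.memLp - realClass hv.memLp) (by
    rw [inner_sub_right, hv.inner_one, hv'.inner_one, sub_self])
  rw [h1, inner_zero_left, Complex.zero_re] at h2
  have h3 : realClass hv'.memLp = realClass hv.memLp := by
    rw [← sub_eq_zero, ← norm_eq_zero]
    have hg := gap_pos hd h
    have : ‖realClass hv'.memLp - realClass hv.memLp‖ ^ 2 ≤ 0 := by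
      by_contra! hlt
      nlinarith
    exact pow_eq_zero_iff (two_ne_zero) |>.mp (le_antisymm this (sq_nonneg _))
  refine ae_of_ae_cell (fun x n => by rw [hv.periodic, hv'.periodic]) ?_
  filter_upwards [realClass_coe hv.memLp, realClass_coe hv'.memLp] with x e1 e2
  rw [h3, e1] at e2
  exact_mod_cast e2.symm

/-- The gap yields a complex solution on the cell. It is extended periodically, and its real part
solves the problem because at ξ = 0 the kernel and the right-hand side are real. -/
theorem exists_isCellSolution (hd : 0 < d) (h : Admissible a μ μm μp)
    (hM : Integrable fun x : Rd d => ‖x‖ ^ 4 * a x) (j : Fin d) :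
    ∃ v : Rd d → ℝ, IsCellSolution a μ j v := by
  obtain ⟨u, hu, hue⟩ := exists_solution_of_gap (fiberOp_symm h 0) norm_oneCell
    (fiberOp_zero_one h) (gap_pos hd h) (fiberOp_gap h) (inner_oneCell_linClass h hM (coordVec j))
  set ψ : Rd d → ℂ := periodize u with hψ
  have hψp : ∀ x (n : Fin d → ℤ), ψ (x + latVec n) = ψ x := periodize_add _
  have hψu : u =ᵐ[cellMeasure d] ψ := by
    filter_upwards [ae_restrict_mem (measurableSet_cell d)] with x hx
    exact (periodize_of_mem _ hx).symm
  have hψm : MemLp ψ 2 (cellMeasure d) := (memLp_congr_ae hψu).mp (Lp.memLp u)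
  refine ⟨fun x => (ψ x).re, fun x n => by rw [hψp], hψm.re, ?_, ?_⟩
  · have hA := fiberOp_apply_periodic h 0 hψp hψu
    rw [hu] at hA
    filter_upwards [hA, aesm_mu h, integrable_mul_periodic h hψp hψm,
      realClass_coe (jumpIntegral_memLp h (by fun_prop) (integrable_inner h hM (coordVec j)))]
      with x h1 h2 h3 h4
    rw [linClass, h4, jumpIntegral_coordVec] at h1
    have hax : Integrable fun y => ((a (x - y) * μ x y : ℝ) : ℂ) := by
      have := integrable_kernel_of_aesm h h2 (φ := fun _ => 1) (by simpa using h.integrable)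
      simp only [mul_one] at this
      exact this.ofReal
    have hi : Integrable fun y => ((a (x - y) * μ x y : ℝ) : ℂ) *
        (ψ x - Complex.exp (-Complex.I * ((⟪(0 : Rd d), x - y⟫ : ℝ) : ℂ)) * ψ y) :=
      ((hax.mul_const (ψ x)).sub h3).congr (Filter.Eventually.of_forall fun y => by
        simp only [Pi.sub_apply, inner_zero_left, Complex.ofReal_zero, mul_zero, Complex.exp_zero]
        ring)
    have h5 := integral_re hi
    simp only [RCLike.re_to_complex] at h5
    rw [← h1, Complex.ofReal_re] at h5
    rw [← h5]
    refine integral_congr_ae (Filter.Eventually.of_forall fun y => ?_)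
    simp
  · have h1 : inner ℂ (oneCell d) u = ∫ x in cell d, ψ x := by
      rw [L2.inner_def]
      refine integral_congr_ae ?_
      filter_upwards [oneCell_coe, hψu] with x e1 e2
      rw [e1, e2]; simp
    have h2 := integral_re (hψm.integrable (by norm_num) : Integrable ψ (cellMeasure d))
    simp only [RCLike.re_to_complex] at h2
    rw [h2, ← h1, hue, Complex.zero_re]

/-! ### The corrector in direction `ξ` -/

variable {v : Fin d → Rd d → ℝ}

/-- The corrector `∑_j ξ_j v_j`. -/
noncomputable def corrector (v : Fin d → Rd d → ℝ) (ξ x : Rd d) : ℝ := ∑ j, ξ j * v j x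

theorem corrector_memLp (hv : ∀ j, IsCellSolution a μ j (v j)) (ξ : Rd d) :
    MemLp (corrector v ξ) 2 (cellMeasure d) :=
  memLp_finsetSum _ fun j _ => (hv j).memLp.const_mul (ξ j)

/-- The class of the corrector. -/
noncomputable def corrClass (hv : ∀ j, IsCellSolution a μ j (v j)) (ξ : Rd d) : L2cell d :=
  realClass (corrector_memLp hv ξ)

theorem realClass_sum {ι : Type*} (s : Finset ι) (c : ι → ℝ) {f : ι → Rd d → ℝ}
    (hf : ∀ i, MemLp (f i) 2 (cellMeasure d)) {g : Rd d → ℝ} (hg : MemLp g 2 (cellMeasure d))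
    (hgf : ∀ᵐ x ∂cellMeasure d, g x = ∑ i ∈ s, c i * f i x) :
    realClass hg = ∑ i ∈ s, (c i : ℂ) • realClass (hf i) := by
  refine Lp.ext ?_
  have hs : ∀ᵐ x ∂cellMeasure d, ∀ i ∈ s, ((c i : ℂ) • realClass (hf i) : L2cell d) x =
      (c i : ℂ) * (f i x : ℂ) := by
    rw [Finset.eventually_all]
    intro i _
    filter_upwards [Lp.coeFn_smul (c i : ℂ) (realClass (hf i)), realClass_coe (hf i)] with x e1 e2
    rw [e1, Pi.smul_apply, e2, smul_eq_mul]
  filter_upwards [realClass_coe hg, hgf, hs,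
    Lp.coeFn_finsetSum s fun i => (c i : ℂ) • realClass (hf i)] with x e1 e2 e3 e4
  rw [e1, e2, e4, Finset.sum_apply, Finset.sum_congr rfl e3]
  push_cast; rfl

theorem corrClass_eq_sum (hv : ∀ j, IsCellSolution a μ j (v j)) (ξ : Rd d) :
    corrClass hv ξ = ∑ j, (ξ j : ℂ) • realClass (hv j).memLp :=
  realClass_sum _ _ (fun j => (hv j).memLp) _ (Filter.Eventually.of_forall fun _ => rfl)

theorem inner_eq_sum_coord (ξ z : Rd d) : ⟪ξ, z⟫ = ∑ j, ξ j * ⟪coordVec j, z⟫ := by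
  rw [PiLp.inner_apply]
  refine Finset.sum_congr rfl fun j _ => ?_
  rw [inner_coordVec]; simp [mul_comm]

theorem linClass_eq_sum (h : Admissible a μ μm μp)
    (hM : Integrable fun x : Rd d => ‖x‖ ^ 4 * a x) (ξ : Rd d) :
    linClass h hM ξ = ∑ j, (ξ j : ℂ) • linClass h hM (coordVec j) := by
  refine realClass_sum _ _ (fun j => jumpIntegral_memLp h (by fun_prop)
    (integrable_inner h hM (coordVec j))) _ ?_
  have := jumpIntegral_sum h Finset.univ (fun j => ξ j) (φ := fun j z => ⟪coordVec j, z⟫)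
    fun j => integrable_inner h hM (coordVec j)
  filter_upwards [this] with x hx
  rw [← hx]
  congr 1
  funext z
  exact inner_eq_sum_coord ξ z

theorem fiberOp_corrClass (h : Admissible a μ μm μp)
    (hM : Integrable fun x : Rd d => ‖x‖ ^ 4 * a x) (hv : ∀ j, IsCellSolution a μ j (v j))
    (ξ : Rd d) : fiberOp h 0 (corrClass hv ξ) = linClass h hM ξ := by
  rw [corrClass_eq_sum, map_sum, linClass_eq_sum]
  refine Finset.sum_congr rfl fun j _ => ?_
  rw [map_smul, (hv j).fiberOp_eq h hM]

theorem inner_one_corrClass (hv : ∀ j, IsCellSolution a μ j (v j)) (ξ : Rd d) :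
    inner ℂ (oneCell d) (corrClass hv ξ) = (0 : ℂ) := by
  rw [corrClass_eq_sum, inner_sum]
  refine Finset.sum_eq_zero fun j _ => ?_
  rw [inner_smul_right, (hv j).inner_one, mul_zero]

/-- With b₁ = -i ∑ ξ_j v_j, the operator [F]₁(ξ) is the symmetric rank-two operator built from e and
b₁; conjugation of -i in the first slot of the inner product produces the opposite sign. -/
theorem firstOrder_eq (hv : ∀ j, IsCellSolution a μ j (v j)) (ξ : Rd d) :
    firstOrder hv ξ =
      InnerProductSpace.rankOne ℂ (oneCell d) (-Complex.I • corrClass hv ξ) +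
      InnerProductSpace.rankOne ℂ (-Complex.I • corrClass hv ξ) (oneCell d) := by
  have h1 : ∀ j, corrOp (hv j).memLp =
      Complex.I • InnerProductSpace.rankOne ℂ (oneCell d) (realClass (hv j).memLp) -
      Complex.I • InnerProductSpace.rankOne ℂ (realClass (hv j).memLp) (oneCell d) := fun j => rfl
  ext1 u
  rw [firstOrder, corrClass_eq_sum, _root_.sum_apply, _root_.add_apply,
    InnerProductSpace.rankOne_apply, InnerProductSpace.rankOne_apply, inner_smul_left, sum_inner,
    Finset.smul_sum, Finset.smul_sum, Finset.mul_sum, Finset.sum_smul, ← Finset.sum_add_distrib]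
  refine Finset.sum_congr rfl fun j _ => ?_
  rw [h1, _root_.smul_apply, _root_.sub_apply, _root_.smul_apply, _root_.smul_apply,
    InnerProductSpace.rankOne_apply, InnerProductSpace.rankOne_apply, inner_smul_left,
    Complex.conj_ofReal, map_neg, Complex.conj_I, neg_neg]
  module

theorem projConst_eq : projConst d = InnerProductSpace.rankOne ℂ (oneCell d) (oneCell d) := by
  ext1 u
  rw [projConst, Submodule.starProjection_unit_singleton ℂ norm_oneCell,
    InnerProductSpace.rankOne_apply]

/-- One of the two rank-one terms dies because the corrector has zero mean. -/
theorem firstOrder_mul_projConst (hv : ∀ j, IsCellSolution a μ j (v j)) (ξ : Rd d) :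
    firstOrder hv ξ * projConst d =
      InnerProductSpace.rankOne ℂ (-Complex.I • corrClass hv ξ) (oneCell d) := by
  have h0 : inner ℂ (corrClass hv ξ) (oneCell d) = (0 : ℂ) := by
    rw [← inner_conj_symm, inner_one_corrClass, map_zero]
  ext1 u
  rw [firstOrder_eq, projConst_eq, mul_apply_eq_comp, InnerProductSpace.rankOne_apply,
    InnerProductSpace.rankOne_apply, _root_.add_apply, InnerProductSpace.rankOne_apply,
    InnerProductSpace.rankOne_apply, inner_smul_left, inner_smul_right, h0, inner_smul_right,
    inner_self_eq_norm_sq_to_K, norm_oneCell]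
  simp

theorem projConst_mul_firstOrder (hv : ∀ j, IsCellSolution a μ j (v j)) (ξ : Rd d) :
    projConst d * firstOrder hv ξ =
      InnerProductSpace.rankOne ℂ (oneCell d) (-Complex.I • corrClass hv ξ) := by
  ext1 u
  rw [firstOrder_eq, projConst_eq, mul_apply_eq_comp, InnerProductSpace.rankOne_apply,
    InnerProductSpace.rankOne_apply, _root_.add_apply, InnerProductSpace.rankOne_apply,
    InnerProductSpace.rankOne_apply, inner_add_right, inner_smul_right, inner_smul_right,
    inner_smul_right, inner_one_corrClass, inner_self_eq_norm_sq_to_K, norm_oneCell]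
  simp

end CellProblem

/-! ### The corrected quadratic form and the effective matrix. -/

section Form

variable {d : ℕ} {a : Rd d → ℝ} {μ : Rd d → Rd d → ℝ} {μm μp : ℝ} {v : Fin d → Rd d → ℝ}

theorem integrable_inner_sq_half (h : Admissible a μ μm μp)
    (hM : Integrable fun x : Rd d => ‖x‖ ^ 4 * a x) (ξ : Rd d) :
    Integrable fun z => a z * (⟪ξ, z⟫ ^ 2 / 2) :=
  ((integrable_inner_pow h hM ξ (k := 2) (by norm_num)).div_const 2).congr
    (Filter.Eventually.of_forall fun z => by simp only; ring)

/-- The class of `½ ∫ a μ ⟨ξ, x - y⟩² dy`. -/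
noncomputable def quadClass (h : Admissible a μ μm μp)
    (hM : Integrable fun x : Rd d => ‖x‖ ^ 4 * a x) (ξ : Rd d) : L2cell d :=
  realClass (jumpIntegral_memLp h (by fun_prop) (integrable_inner_sq_half h hM ξ))

theorem norm_cosClass_sub_le (h : Admissible a μ μm μp)
    (hM : Integrable fun x : Rd d => ‖x‖ ^ 4 * a x) (ξ : Rd d) :
    ‖cosClass h ξ - quadClass h hM ξ‖ ≤ μp * moment a 4 * ‖ξ‖ ^ 4 / 24 := by
  have h1 := integral_abs_inner_pow_le h hM ξ (k := 4) le_rfl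
  have hi : Integrable fun z => a z * ((1 - Real.cos ⟪ξ, z⟫) - ⟪ξ, z⟫ ^ 2 / 2) :=
    ((integrable_one_sub_cos h ξ).sub (integrable_inner_sq_half h hM ξ)).congr
      (Filter.Eventually.of_forall fun z => by simp only [Pi.sub_apply]; ring)
  have h2 : ∫ z, |a z * ((1 - Real.cos ⟪ξ, z⟫) - ⟪ξ, z⟫ ^ 2 / 2)| ≤ ‖ξ‖ ^ 4 * moment a 4 / 24 := by
    refine le_trans ?_ (div_le_div_of_nonneg_right h1 (by norm_num))
    rw [← integral_div]
    refine integral_mono hi.abs ((integrable_inner_pow h hM ξ le_rfl).abs.div_const 24) fun z => ?_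
    simp only
    rw [abs_mul, abs_mul, mul_div_assoc]
    refine mul_le_mul_of_nonneg_left ?_ (abs_nonneg _)
    have e4 : 0 ≤ ⟪ξ, z⟫ ^ 4 := by positivity
    rw [abs_of_nonneg e4, abs_le]
    constructor <;>
      linarith [Real.one_sub_sq_div_two_le_cos (x := ⟪ξ, z⟫), cos_le_quartic ⟪ξ, z⟫]
  rw [cosClass, quadClass, ← realClass_sub_congr _ _ (jumpIntegral_memLp h (by fun_prop) hi)
    (jumpIntegral_sub h (integrable_one_sub_cos h ξ) (integrable_inner_sq_half h hM ξ))]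
  refine (norm_jumpClass_le h (by fun_prop) hi h2).trans (le_of_eq ?_)
  ring

theorem integrable_coord (h : Admissible a μ μm μp)
    (hM : Integrable fun x : Rd d => ‖x‖ ^ 4 * a x) (k : Fin d) :
    Integrable fun z => a z * z k := by
  simpa only [inner_coordVec] using integrable_inner h hM (coordVec k)

theorem integrable_coord_mul (h : Admissible a μ μm μp)
    (hM : Integrable fun x : Rd d => ‖x‖ ^ 4 * a x) (k l : Fin d) :
    Integrable fun z => a z * (z k * z l) := by
  refine (integrable_moment h hM (k := 2) (by norm_num)).mono
    (h.integrable.1.mul (Continuous.aestronglyMeasurable (by fun_prop)))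
    (Filter.Eventually.of_forall fun z => ?_)
  have ha := h.nonneg z
  rw [norm_mul, norm_mul, Real.norm_of_nonneg ha, norm_mul, norm_pow, norm_norm,
    Real.norm_of_nonneg ha, mul_comm, sq]
  gcongr
  · exact PiLp.norm_apply_le z k
  · exact PiLp.norm_apply_le z l

theorem jumpIntegral_inner (h : Admissible a μ μm μp)
    (hM : Integrable fun x : Rd d => ‖x‖ ^ 4 * a x) (ξ : Rd d) :
    ∀ᵐ x ∂cellMeasure d, jumpIntegral a μ (fun z => ⟪ξ, z⟫) x =
      ∑ k, ξ k * jumpIntegral a μ (fun z => z k) x := by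
  filter_upwards [jumpIntegral_sum h Finset.univ (fun k => ξ k) (φ := fun k z => z k)
    (integrable_coord h hM)] with x hx
  rw [← hx]
  congr 1
  funext z
  rw [inner_eq_sum_coord]
  simp only [inner_coordVec]

theorem jumpIntegral_inner_sq_half (h : Admissible a μ μm μp)
    (hM : Integrable fun x : Rd d => ‖x‖ ^ 4 * a x) (ξ : Rd d) :
    ∀ᵐ x ∂cellMeasure d, 2 * jumpIntegral a μ (fun z => ⟪ξ, z⟫ ^ 2 / 2) x =
      ∑ k, ∑ l, ξ k * ξ l * jumpIntegral a μ (fun z => z k * z l) x := by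
  filter_upwards [jumpIntegral_sum h Finset.univ (fun p : Fin d × Fin d => ξ p.1 * ξ p.2)
    (φ := fun p z => z p.1 * z p.2) (fun p => integrable_coord_mul h hM p.1 p.2)] with x hx
  rw [← Fintype.sum_prod_type' (fun k l => ξ k * ξ l * jumpIntegral a μ (fun z => z k * z l) x),
    ← hx, jumpIntegral, jumpIntegral, ← integral_const_mul]
  refine integral_congr_ae (Filter.Eventually.of_forall fun y => ?_)
  simp only
  have e : ⟪ξ, x - y⟫ ^ 2 = ∑ p : Fin d × Fin d, ξ p.1 * ξ p.2 * ((x - y) p.1 * (x - y) p.2) := by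
    rw [sq, inner_eq_sum_coord, Finset.sum_mul_sum, Fintype.sum_prod_type]
    refine Finset.sum_congr rfl fun k _ => Finset.sum_congr rfl fun l _ => ?_
    rw [inner_coordVec, inner_coordVec]; ring
  rw [← e]; ring

/-- The two corrector terms in g⁰ coincide after exchanging the summation indices, which removes
their factor ½. -/
theorem effForm_eq (h : Admissible a μ μm μp)
    (hM : Integrable fun x : Rd d => ‖x‖ ^ 4 * a x) (hv : ∀ j, IsCellSolution a μ j (v j))
    (ξ : Rd d) :
    effForm a μ v ξ = (∫ x in cell d, jumpIntegral a μ (fun z => ⟪ξ, z⟫ ^ 2 / 2) x) -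
      ∫ x in cell d, corrector v ξ x * jumpIntegral a μ (fun z => ⟪ξ, z⟫) x := by
  set Φ : Fin d → Rd d → ℝ := fun k => jumpIntegral a μ (fun z => z k) with hΦ
  set Ψ : Fin d → Fin d → Rd d → ℝ := fun k l => jumpIntegral a μ (fun z => z k * z l) with hΨ
  have hΦm : ∀ k, MemLp (Φ k) 2 (cellMeasure d) := fun k =>
    jumpIntegral_memLp h (by fun_prop) (integrable_coord h hM k)
  have hΨi : ∀ k l, Integrable (Ψ k l) (cellMeasure d) := fun k l =>
    (jumpIntegral_memLp h (by fun_prop) (integrable_coord_mul h hM k l)).integrable (by norm_num)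
  have hvΦ : ∀ k l, Integrable (fun x => v k x * Φ l x) (cellMeasure d) := fun k l =>
    (hv k).memLp.integrable_mul (hΦm l)
  have hin : ∀ k l, effMatrix a μ v k l =
      1 / 2 * ∫ x in cell d, (Ψ k l x - v k x * Φ l x - v l x * Φ k x) := by
    intro k l
    rw [effMatrix, Matrix.of_apply]
    congr 1
    refine integral_congr_ae ?_
    filter_upwards [aesm_mu h] with x hx
    have i0 := integrable_kernel_of_aesm h hx (integrable_coord_mul h hM k l)
    have i1 := (integrable_kernel_of_aesm h hx (integrable_coord h hM l)).const_mul (v k x)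
    have i2 := (integrable_kernel_of_aesm h hx (integrable_coord h hM k)).const_mul (v l x)
    have i01 : Integrable fun y => a (x - y) * μ x y * ((x - y) k * (x - y) l) -
        v k x * (a (x - y) * μ x y * (x - y) l) := i0.sub i1
    simp only [hΦ, hΨ, jumpIntegral]
    rw [← integral_const_mul, ← integral_const_mul, ← integral_sub i0 i1,
      ← integral_sub i01 i2]
    refine integral_congr_ae (Filter.Eventually.of_forall fun y => ?_)
    simp only [PiLp.sub_apply]; ring
  have hGi : ∀ k l, Integrable (fun x => ξ k * ξ l * (1 / 2 * (Ψ k l x - v k x * Φ l x -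
      v l x * Φ k x))) (cellMeasure d) := fun k l =>
    ((((hΨi k l).sub (hvΦ k l)).sub (hvΦ l k)).const_mul (1 / 2)).const_mul (ξ k * ξ l)
  have hE : effForm a μ v ξ = ∫ x in cell d, ∑ k, ∑ l, ξ k * ξ l *
      (1 / 2 * (Ψ k l x - v k x * Φ l x - v l x * Φ k x)) := by
    rw [integral_finsetSum _ fun k _ => integrable_finsetSum _ fun l _ => hGi k l, effForm]
    refine Finset.sum_congr rfl fun k _ => ?_
    rw [integral_finsetSum _ fun l _ => hGi k l]
    refine Finset.sum_congr rfl fun l _ => ?_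
    rw [integral_const_mul, integral_const_mul, hin]; ring
  have hq : Integrable (jumpIntegral a μ fun z => ⟪ξ, z⟫ ^ 2 / 2) (cellMeasure d) :=
    (jumpIntegral_memLp h (by fun_prop) (integrable_inner_sq_half h hM ξ)).integrable (by norm_num)
  have hf : Integrable (fun x => corrector v ξ x * jumpIntegral a μ (fun z => ⟪ξ, z⟫) x)
      (cellMeasure d) :=
    (corrector_memLp hv ξ).integrable_mul
      (jumpIntegral_memLp h (by fun_prop) (integrable_inner h hM ξ))
  rw [hE, ← integral_sub hq hf]
  refine integral_congr_ae ?_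
  filter_upwards [jumpIntegral_inner h hM ξ, jumpIntegral_inner_sq_half h hM ξ] with x h1 h2
  have e1 : corrector v ξ x * jumpIntegral a μ (fun z => ⟪ξ, z⟫) x =
      ∑ k, ∑ l, ξ k * ξ l * (v k x * Φ l x) := by
    rw [h1, corrector, Finset.sum_mul_sum]
    exact Finset.sum_congr rfl fun k _ => Finset.sum_congr rfl fun l _ => by ring
  have e2 : ∑ k, ∑ l, ξ k * ξ l * (v l x * Φ k x) = ∑ k, ∑ l, ξ k * ξ l * (v k x * Φ l x) := by
    rw [Finset.sum_comm]
    exact Finset.sum_congr rfl fun k _ => Finset.sum_congr rfl fun l _ => by ring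
  have e3 : ∑ k, ∑ l, ξ k * ξ l * (1 / 2 * (Ψ k l x - v k x * Φ l x - v l x * Φ k x)) =
      1 / 2 * (∑ k, ∑ l, ξ k * ξ l * Ψ k l x) - 1 / 2 * (∑ k, ∑ l, ξ k * ξ l * (v k x * Φ l x)) -
        1 / 2 * (∑ k, ∑ l, ξ k * ξ l * (v l x * Φ k x)) := by
    simp only [Finset.mul_sum, ← Finset.sum_sub_distrib]
    exact Finset.sum_congr rfl fun k _ => Finset.sum_congr rfl fun l _ => by ring
  rw [e3, e2, e1, ← h2]
  ring

theorem effForm_eq_inner (h : Admissible a μ μm μp)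
    (hM : Integrable fun x : Rd d => ‖x‖ ^ 4 * a x) (hv : ∀ j, IsCellSolution a μ j (v j))
    (ξ : Rd d) :
    effForm a μ v ξ = (inner ℂ (oneCell d) (quadClass h hM ξ)).re -
      (inner ℂ (corrClass hv ξ) (linClass h hM ξ)).re := by
  rw [effForm_eq h hM hv, quadClass, inner_oneCell_realClass, corrClass, linClass,
    inner_realClass, Complex.ofReal_re, Complex.ofReal_re]

/-- The corrector is the preimage of the linear class under 𝔸(0) in e^⊥. The gap D stays a parameter
because it is taken as μ₋𝒞_π for coercivity of g⁰ and as d₀ in the final estimate. -/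
theorem norm_corrClass_le {D : ℝ} (h : Admissible a μ μm μp)
    (hM : Integrable fun x : Rd d => ‖x‖ ^ 4 * a x) (hv : ∀ j, IsCellSolution a μ j (v j))
    (hD : 0 < D) (hgap : ∀ u : L2cell d, inner ℂ (oneCell d) u = (0 : ℂ) →
      D * ‖u‖ ^ 2 ≤ (inner ℂ (fiberOp h 0 u) u).re) (ξ : Rd d) :
    ‖corrClass hv ξ‖ ≤ μp * moment a 1 * ‖ξ‖ / D := by
  have h1 := hgap _ (inner_one_corrClass hv ξ)
  rw [fiberOp_corrClass h hM] at h1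
  exact norm_le_of_coercive hD h1 (norm_linClass_le h hM ξ)

/-- The quartic error coefficient of the corrected quadratic form. -/
noncomputable def quarticCoeff (m₁ m₂ m₃ m₄ D : ℝ) : ℝ :=
  m₄ / 24 + m₁ * m₃ / (3 * D) + m₁ ^ 2 * m₂ / (2 * D ^ 2)

/-- The quadratic form on corrected constants agrees with the effective form to fourth order. -/
theorem abs_form_sub_effForm_le {D : ℝ} (h : Admissible a μ μm μp)
    (hM : Integrable fun x : Rd d => ‖x‖ ^ 4 * a x) (hv : ∀ j, IsCellSolution a μ j (v j))
    (hD : 0 < D) (hgap : ∀ u : L2cell d, inner ℂ (oneCell d) u = (0 : ℂ) →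
      D * ‖u‖ ^ 2 ≤ (inner ℂ (fiberOp h 0 u) u).re) (ξ : Rd d) :
    |(inner ℂ (fiberOp h ξ (oneCell d + -Complex.I • corrClass hv ξ))
        (oneCell d + -Complex.I • corrClass hv ξ)).re - effForm a μ v ξ| ≤
      quarticCoeff (μp * moment a 1) (μp * moment a 2) (μp * moment a 3) (μp * moment a 4) D *
        ‖ξ‖ ^ 4 := by
  have hM1 := moment_nonneg h 1
  have hM2 := moment_nonneg h 2
  have hM3 := moment_nonneg h 3
  have hμp := h.upper_nonneg
  have hFn := norm_corrClass_le h hM hv hD hgap ξ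
  have hΔ := abs_re_inner_fiberOp_sub_le h hM ξ (corrector_memLp hv ξ)
  have hFdef : realClass (corrector_memLp hv ξ) = corrClass hv ξ := rfl
  have hcF : ∃ r : ℝ, inner ℂ (cosClass h ξ) (corrClass hv ξ) = (r : ℂ) :=
    ⟨_, inner_realClass _ _⟩
  have hsF : ∃ r : ℝ, inner ℂ (sinClass h ξ) (corrClass hv ξ) = (r : ℂ) :=
    ⟨_, inner_realClass _ _⟩
  have h1s : ∃ r : ℝ, inner ℂ (oneCell d) (sinClass h ξ) = (r : ℂ) :=
    ⟨_, inner_oneCell_realClass _⟩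
  obtain ⟨r₁, hr₁⟩ := hcF
  obtain ⟨r₂, hr₂⟩ := hsF
  obtain ⟨r₃, hr₃⟩ := h1s
  rw [hFdef] at hΔ
  set F := corrClass hv ξ with hF
  set e := oneCell d with he
  have hsymF : inner ℂ F (sinClass h ξ) = (r₂ : ℂ) := by
    rw [← inner_conj_symm, hr₂, Complex.conj_ofReal]
  -- All pairings of real classes are real, so the factor -i selects the sine class here and
  -- discards the cosine class.
  have hcross : (inner ℂ (fiberOp h ξ e) (-Complex.I • F)).re = -r₂ := by
    rw [fiberOp_one, inner_smul_right, inner_add_left, inner_smul_left, hr₁, hr₂, Complex.conj_I]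
    simp
  have h11 : (inner ℂ (fiberOp h ξ e) e).re = (inner ℂ e (cosClass h ξ)).re := by
    rw [fiberOp_symm, fiberOp_one, inner_add_right, inner_smul_right, hr₃]
    simp
  have hFF : inner ℂ (fiberOp h ξ (-Complex.I • F)) (-Complex.I • F) =
      inner ℂ (fiberOp h ξ F) F := by
    rw [map_smul, inner_smul_left, inner_smul_right, ← mul_assoc]
    simp
  have hexp : (inner ℂ (fiberOp h ξ (e + -Complex.I • F)) (e + -Complex.I • F)).re =
      (inner ℂ e (cosClass h ξ)).re - 2 * r₂ + (inner ℂ (fiberOp h ξ F) F).re := by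
    have h2 : (inner ℂ (fiberOp h ξ (-Complex.I • F)) e).re = -r₂ := by
      rw [fiberOp_symm, ← inner_conj_symm, Complex.conj_re, hcross]
    rw [map_add, inner_add_left, inner_add_right, inner_add_right, hFF, Complex.add_re,
      Complex.add_re, Complex.add_re, hcross, h2, h11]
    ring
  have hsplit : (inner ℂ (fiberOp h ξ F) F).re =
      (inner ℂ ((fiberOp h ξ - fiberOp h 0) F) F).re + (inner ℂ F (linClass h hM ξ)).re := by
    rw [_root_.sub_apply, inner_sub_left, Complex.sub_re, hF, fiberOp_corrClass h hM,
      ← inner_conj_symm (linClass h hM ξ), Complex.conj_re]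
    ring
  have hr₂' : r₂ = (inner ℂ F (sinClass h ξ)).re := by rw [hsymF, Complex.ofReal_re]
  -- Subtracting the effective form cancels the linear class once: the three remaining terms have
  -- orders 4, 1 + 3 and 2 + 2 in |ξ|, matching the summands of `quarticCoeff`.
  have key : (inner ℂ (fiberOp h ξ (e + -Complex.I • F)) (e + -Complex.I • F)).re -
      effForm a μ v ξ = (inner ℂ e (cosClass h ξ - quadClass h hM ξ)).re -
        2 * (inner ℂ F (sinClass h ξ - linClass h hM ξ)).re +
        (inner ℂ ((fiberOp h ξ - fiberOp h 0) F) F).re := by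
    rw [hexp, hsplit, effForm_eq_inner h hM hv, inner_sub_right, inner_sub_right, Complex.sub_re,
      Complex.sub_re, hr₂']
    ring
  have b1 : |(inner ℂ e (cosClass h ξ - quadClass h hM ξ)).re| ≤
      μp * moment a 4 * ‖ξ‖ ^ 4 / 24 := by
    refine (Complex.abs_re_le_norm _).trans ((norm_inner_le_norm _ _).trans ?_)
    rw [he, norm_oneCell, one_mul]
    exact norm_cosClass_sub_le h hM ξ
  have b2 : |(inner ℂ F (sinClass h ξ - linClass h hM ξ)).re| ≤
      (μp * moment a 1 * ‖ξ‖ / D) * (μp * moment a 3 * ‖ξ‖ ^ 3 / 6) := by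
    refine (Complex.abs_re_le_norm _).trans ((norm_inner_le_norm _ _).trans ?_)
    exact mul_le_mul hFn (norm_sinClass_sub_le' h hM ξ) (norm_nonneg _) (by positivity)
  have b3 : |(inner ℂ ((fiberOp h ξ - fiberOp h 0) F) F).re| ≤
      μp * moment a 2 * ‖ξ‖ ^ 2 / 2 * (μp * moment a 1 * ‖ξ‖ / D) ^ 2 := by
    refine hΔ.trans ?_
    gcongr
  rw [key]
  calc _ ≤ |(inner ℂ e (cosClass h ξ - quadClass h hM ξ)).re| +
        2 * |(inner ℂ F (sinClass h ξ - linClass h hM ξ)).re| +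
        |(inner ℂ ((fiberOp h ξ - fiberOp h 0) F) F).re| := by
        refine (abs_add_le _ _).trans (add_le_add_left ((abs_sub _ _).trans (le_of_eq ?_)) _)
        rw [abs_mul]; norm_num
    _ ≤ μp * moment a 4 * ‖ξ‖ ^ 4 / 24 +
        2 * ((μp * moment a 1 * ‖ξ‖ / D) * (μp * moment a 3 * ‖ξ‖ ^ 3 / 6)) +
        μp * moment a 2 * ‖ξ‖ ^ 2 / 2 * (μp * moment a 1 * ‖ξ‖ / D) ^ 2 := by gcongr
    _ = _ := by rw [quarticCoeff]; field_simp; ring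

theorem effForm_smul (ξ : Rd d) (s : ℝ) : effForm a μ v (s • ξ) = s ^ 2 * effForm a μ v ξ := by
  simp only [effForm, Finset.mul_sum]
  refine Finset.sum_congr rfl fun k _ => Finset.sum_congr rfl fun l _ => ?_
  simp only [PiLp.smul_apply, smul_eq_mul]; ring

theorem quarticCoeff_nonneg {m₁ m₂ m₃ m₄ D : ℝ} (h₁ : 0 ≤ m₁) (h₂ : 0 ≤ m₂) (h₃ : 0 ≤ m₃)
    (h₄ : 0 ≤ m₄) (hD : 0 < D) : 0 ≤ quarticCoeff m₁ m₂ m₃ m₄ D := by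
  unfold quarticCoeff; positivity

/-- Coercivity of the effective form. -/
theorem effForm_ge (hd : 0 < d) (h : Admissible a μ μm μp)
    (hM : Integrable fun x : Rd d => ‖x‖ ^ 4 * a x) (hv : ∀ j, IsCellSolution a μ j (v j))
    {ξ : Rd d} (hξ : ‖ξ‖ ≤ Real.pi) :
    μm * bandConst a * ‖ξ‖ ^ 2 ≤ effForm a μ v ξ := by
  have hD := gap_pos hd h
  set D := μm * tailMin a Real.pi
  set η := quarticCoeff (μp * moment a 1) (μp * moment a 2) (μp * moment a 3) (μp * moment a 4) D
  have hK : 0 ≤ μm * bandConst a := (mul_pos h.pos (bandConst_pos hd h hM)).le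
  -- Apply the lower bound for 𝔸(sξ) to the trial vector, whose norm is at least 1, and divide by
  -- s². The quartic error becomes O(s²) and disappears as s → 0, so no constant is lost.
  have hs : ∀ s : ℝ, 0 < s → s ≤ 1 →
      μm * bandConst a * ‖ξ‖ ^ 2 ≤ effForm a μ v ξ + η * ‖ξ‖ ^ 4 * s ^ 2 := by
    intro s hs0 hs1
    have hn : ‖s • ξ‖ = s * ‖ξ‖ := by rw [norm_smul, Real.norm_of_nonneg hs0.le]
    have hsξ : ‖s • ξ‖ ≤ Real.pi := by
      rw [hn]; nlinarith [norm_nonneg ξ]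
    have h1 := fiberOp_lower hd h hM hsξ (oneCell d + -Complex.I • corrClass hv (s • ξ))
    have h2 := (abs_le.mp (abs_form_sub_effForm_le h hM hv hD (fiberOp_gap h) (s • ξ))).2
    have h3 : 1 ≤ ‖oneCell d + -Complex.I • corrClass hv (s • ξ)‖ ^ 2 := by
      have := norm_add_sq (𝕜 := ℂ) (oneCell d) (-Complex.I • corrClass hv (s • ξ))
      rw [inner_smul_right, inner_one_corrClass, mul_zero, norm_oneCell] at this
      simp only [map_zero, mul_zero, add_zero, one_pow] at this
      rw [this]
      linarith [sq_nonneg ‖-Complex.I • corrClass hv (s • ξ)‖]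
    rw [effForm_smul, hn] at h2
    rw [hn] at h1
    have h4 : 0 ≤ μm * bandConst a * (s * ‖ξ‖) ^ 2 := by positivity
    have h5 : s ^ 2 * (μm * bandConst a * ‖ξ‖ ^ 2) ≤
        s ^ 2 * (effForm a μ v ξ + η * ‖ξ‖ ^ 4 * s ^ 2) := by nlinarith
    exact le_of_mul_le_mul_left h5 (by positivity)
  have hlim : Filter.Tendsto (fun s : ℝ => effForm a μ v ξ + η * ‖ξ‖ ^ 4 * s ^ 2)
      (nhdsWithin 0 (Set.Ioi 0)) (nhds (effForm a μ v ξ)) := by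
    have : Filter.Tendsto (fun s : ℝ => effForm a μ v ξ + η * ‖ξ‖ ^ 4 * s ^ 2) (nhds 0)
        (nhds (effForm a μ v ξ + η * ‖ξ‖ ^ 4 * 0 ^ 2)) := Continuous.tendsto (by fun_prop) _
    simpa using this.mono_left nhdsWithin_le_nhds
  refine ge_of_tendsto hlim ?_
  filter_upwards [Ioc_mem_nhdsGT (zero_lt_one' ℝ)] with s hs' using hs s hs'.1 hs'.2

end Form

/-! ### Comparison of constants. -/

section Constants

/-- Comparison of the obtained remainder bound with the explicit constant. -/
theorem remainder_le_constC6 {d : ℕ} {μm μp M₁ M₂ M₃ M₄ Ms Cpi Cr D : ℝ} (hμp : 0 ≤ μp)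
    (h₁ : 0 ≤ M₁) (h₂ : 0 ≤ M₂) (h₃ : 0 ≤ M₃) (h₄ : 0 ≤ M₄) (hD : 0 < D)
    (hK : 0 < μm * constC d Ms Cpi Cr) :
    5 / (2 * D) + (45 / 4 * (μp * M₁) ^ 2 / D ^ 2 + 3 / 2 * (2 * (μp * M₂)) / D) /
        (μm * constC d Ms Cpi Cr) +
      2 * (quarticCoeff (μp * M₁) (μp * M₂) (μp * M₃) (μp * M₄) D +
        3 / D * ((μp * M₁) ^ 2 / D + 2 * (μp * M₂) / 2) ^ 2) / (μm * constC d Ms Cpi Cr) ^ 2 ≤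
      constC6 d μm μp M₁ M₂ M₃ M₄ Ms Cpi Cr D := by
  set K := μm * constC d Ms Cpi Cr
  have hπ := Real.pi_pos
  have hπ3 : Real.pi < 3.15 := Real.pi_lt_d2
  have hp1 : 1 ≤ (Real.pi + 2) / Real.pi := by rw [le_div_iff₀ hπ]; linarith
  -- The only numerical information on π that is used; it turns the prefactor of C₄ into a rational
  -- number.
  have hp2 : 4 / 5 ≤ (Real.pi + 2) / (2 * Real.pi) := by
    rw [le_div_iff₀ (by positivity)]; linarith
  have hC1 : 0 ≤ constC1 μp M₁ D := by unfold constC1; positivity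
  have hC3 : 0 ≤ constC3 μp M₁ M₂ M₃ D := by unfold constC3; positivity
  have hC2 : 36 * μp ^ 2 * M₁ ^ 2 / D ^ 2 + 3 * μp * M₂ / D ≤ constC2 μp M₁ M₂ D := by
    unfold constC2
    exact le_mul_of_one_le_left (by positivity) hp1
  have hC4 : 4 / 5 * (6 ^ 4 * μp ^ 4 * M₁ ^ 4 / D ^ 3 + μp * M₄ / 4 +
      μp ^ 2 * (12 * M₁ * M₃ + 9 * M₂ ^ 2) / D + 6 ^ 4 * μp ^ 3 * M₁ ^ 2 * M₂ / (4 * D ^ 2)) ≤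
      constC4 μp M₁ M₂ M₃ M₄ D := by
    unfold constC4
    gcongr
  have t1 : 5 / (2 * D) ≤ 3 / D := by
    rw [div_le_div_iff₀ (by positivity) hD]; linarith
  have t2 : 45 / 4 * (μp * M₁) ^ 2 / D ^ 2 + 3 / 2 * (2 * (μp * M₂)) / D ≤
      2 * constC1 μp M₁ D ^ 2 + 2 * constC2 μp M₁ M₂ D := by
    have e1 : 45 / 4 * (μp * M₁) ^ 2 / D ^ 2 + 3 / 2 * (2 * (μp * M₂)) / D ≤
        2 * (36 * μp ^ 2 * M₁ ^ 2 / D ^ 2 + 3 * μp * M₂ / D) := by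
      have p1 : 0 ≤ μp ^ 2 * M₁ ^ 2 / D ^ 2 := by positivity
      have p2 : 0 ≤ μp * M₂ / D := by positivity
      have q1 : 45 / 4 * (μp * M₁) ^ 2 / D ^ 2 = 45 / 4 * (μp ^ 2 * M₁ ^ 2 / D ^ 2) := by ring
      have q2 : 3 / 2 * (2 * (μp * M₂)) / D = 3 * (μp * M₂ / D) := by ring
      have q3 : 36 * μp ^ 2 * M₁ ^ 2 / D ^ 2 = 36 * (μp ^ 2 * M₁ ^ 2 / D ^ 2) := by ring
      have q4 : 3 * μp * M₂ / D = 3 * (μp * M₂ / D) := by ring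
      rw [q1, q2, q3, q4]; linarith
    -- The term 2C₁² is not needed; likewise C₁C₃ and C₃² are discarded below.
    have : 0 ≤ constC1 μp M₁ D ^ 2 := sq_nonneg _
    linarith
  have t3 : 2 * (quarticCoeff (μp * M₁) (μp * M₂) (μp * M₃) (μp * M₄) D +
        3 / D * ((μp * M₁) ^ 2 / D + 2 * (μp * M₂) / 2) ^ 2) ≤
      3 * constC1 μp M₁ D * constC3 μp M₁ M₂ M₃ D + constC4 μp M₁ M₂ M₃ M₄ D := by
    have e1 : 2 * (quarticCoeff (μp * M₁) (μp * M₂) (μp * M₃) (μp * M₄) D +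
        3 / D * ((μp * M₁) ^ 2 / D + 2 * (μp * M₂) / 2) ^ 2) =
        6 * (μp ^ 4 * M₁ ^ 4 / D ^ 3) + 1 / 12 * (μp * M₄) + 2 / 3 * (μp ^ 2 * (M₁ * M₃) / D) +
          6 * (μp ^ 2 * M₂ ^ 2 / D) + 13 * (μp ^ 3 * M₁ ^ 2 * M₂ / D ^ 2) := by
      rw [quarticCoeff]; field_simp; ring
    have e2 : 4 / 5 * (6 ^ 4 * μp ^ 4 * M₁ ^ 4 / D ^ 3 + μp * M₄ / 4 +
        μp ^ 2 * (12 * M₁ * M₃ + 9 * M₂ ^ 2) / D + 6 ^ 4 * μp ^ 3 * M₁ ^ 2 * M₂ / (4 * D ^ 2)) =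
        5184 / 5 * (μp ^ 4 * M₁ ^ 4 / D ^ 3) + 1 / 5 * (μp * M₄) +
          48 / 5 * (μp ^ 2 * (M₁ * M₃) / D) + 36 / 5 * (μp ^ 2 * M₂ ^ 2 / D) +
          1296 / 5 * (μp ^ 3 * M₁ ^ 2 * M₂ / D ^ 2) := by
      field_simp; ring
    have p1 : 0 ≤ μp ^ 4 * M₁ ^ 4 / D ^ 3 := by positivity
    have p2 : 0 ≤ μp * M₄ := by positivity
    have p3 : 0 ≤ μp ^ 2 * (M₁ * M₃) / D := by positivity
    have p4 : 0 ≤ μp ^ 2 * M₂ ^ 2 / D := by positivity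
    have p5 : 0 ≤ μp ^ 3 * M₁ ^ 2 * M₂ / D ^ 2 := by positivity
    have p6 : 0 ≤ 3 * constC1 μp M₁ D * constC3 μp M₁ M₂ M₃ D := by positivity
    rw [e2] at hC4
    rw [e1]; linarith
  have t4 : 0 ≤ constC3 μp M₁ M₂ M₃ D ^ 2 / K ^ 3 := by positivity
  rw [constC6]
  have u2 := div_le_div_of_nonneg_right t2 hK.le
  have u3 := div_le_div_of_nonneg_right t3 (sq_nonneg K)
  linarith

/-- Every occurrence of d₀ is in a denominator under a nonnegative numerator. -/
theorem constC6_anti {d : ℕ} {μm μp M₁ M₂ M₃ M₄ Ms Cpi Cr D D' : ℝ} (hμp : 0 ≤ μp)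
    (h₁ : 0 ≤ M₁) (h₂ : 0 ≤ M₂) (h₃ : 0 ≤ M₃) (hD : 0 < D) (hDD : D ≤ D')
    (hK : 0 < μm * constC d Ms Cpi Cr) :
    constC6 d μm μp M₁ M₂ M₃ M₄ Ms Cpi Cr D' ≤ constC6 d μm μp M₁ M₂ M₃ M₄ Ms Cpi Cr D := by
  have hD' : 0 < D' := hD.trans_le hDD
  have hπ := Real.pi_pos
  have c1 : constC1 μp M₁ D' ≤ constC1 μp M₁ D := by unfold constC1; gcongr
  have c2 : constC2 μp M₁ M₂ D' ≤ constC2 μp M₁ M₂ D := by unfold constC2; gcongr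
  have c3 : constC3 μp M₁ M₂ M₃ D' ≤ constC3 μp M₁ M₂ M₃ D := by unfold constC3; gcongr
  have c4 : constC4 μp M₁ M₂ M₃ M₄ D' ≤ constC4 μp M₁ M₂ M₃ M₄ D := by unfold constC4; gcongr
  have p1 : 0 ≤ constC1 μp M₁ D' := by unfold constC1; positivity
  have p3 : 0 ≤ constC3 μp M₁ M₂ M₃ D' := by unfold constC3; positivity
  have q1 : 0 ≤ constC1 μp M₁ D := p1.trans c1
  unfold constC6
  gcongr

end Constants

end NonlocalHom

/-! ### The theorem. -/

theorem theorem3p4 {d : ℕ} (hd : 0 < d) (a : Rd d → ℝ) (μ : Rd d → Rd d → ℝ) (μm μp : ℝ)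
    (h : Admissible a μ μm μp) (hM : Integrable (fun x : Rd d => ‖x‖ ^ 4 * a x)) :
    -- each cell problem has a solution, unique almost everywhere
    (∀ j : Fin d, ∃ v : Rd d → ℝ, IsCellSolution a μ j v ∧
      ∀ v' : Rd d → ℝ, IsCellSolution a μ j v' → v' =ᵐ[volume] v) ∧
    -- the constant is controlled by the admissible quantities alone
    (0 < μm * tailMin a Real.pi ∧ μm * tailMin a Real.pi ≤ spectralGap h ∧
      C6 a μm μp (spectralGap h) ≤ C6 a μm μp (μm * tailMin a Real.pi)) ∧
    -- the approximation of the resolvent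
    ∀ (v : Fin d → Rd d → ℝ) (hv : ∀ j, IsCellSolution a μ j (v j)) (ξ : Rd d) (ε : ℝ),
      ‖ξ‖ ≤ delta0 a μm μp → 0 < ε →
      IsUnit (fiberOp h ξ + ((ε ^ 2 : ℝ) : ℂ) • (1 : L2cell d →L[ℂ] L2cell d)) ∧
      0 < effForm a μ v ξ + ε ^ 2 ∧
      ∃ Y : L2cell d →L[ℂ] L2cell d,
        Ring.inverse (fiberOp h ξ + ((ε ^ 2 : ℝ) : ℂ) • (1 : L2cell d →L[ℂ] L2cell d)) =
          (((effForm a μ v ξ + ε ^ 2)⁻¹ : ℝ) : ℂ) • projConst d +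
          (((effForm a μ v ξ + ε ^ 2)⁻¹ : ℝ) : ℂ) • (firstOrder hv ξ * projConst d) +
          (((effForm a μ v ξ + ε ^ 2)⁻¹ : ℝ) : ℂ) • (projConst d * firstOrder hv ξ) + Y ∧
        ‖Y‖ ≤ C6 a μm μp (spectralGap h) := by
  have hγ := gap_pos hd h
  have hγD := spectralGap_ge hd h
  have hD : 0 < spectralGap h := hγ.trans_le hγD
  have hK : 0 < μm * bandConst a := mul_pos h.pos (bandConst_pos hd h hM)
  have hμp := h.upper_nonneg
  have hm := moment_nonneg h
  refine ⟨fun j => ?_, ⟨hγ, hγD, ?_⟩, fun v hv ξ ε hξ hε => ?_⟩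
  · obtain ⟨v, hv⟩ := exists_isCellSolution hd h hM j
    exact ⟨v, hv, fun v' hv' => hv.ae_eq hd h hM hv'⟩
  · exact constC6_anti hμp (hm 1) (hm 2) (hm 3) hγ hγD hK
  · have hgap : ∀ u : L2cell d, inner ℂ (oneCell d) u = (0 : ℂ) →
        spectralGap h * ‖u‖ ^ 2 ≤ (inner ℂ (fiberOp h 0 u) u).re :=
      infDist_spectrum_gap (fiberOp_symm h 0) norm_oneCell (fiberOp_zero_one h) hγ (fiberOp_gap h)
    have hξπ : ‖ξ‖ ≤ Real.pi := hξ.trans (delta0_le_pi hd h hM)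
    -- This is the purpose of δ₀: it gives μ₊M₁|ξ| ≤ μ₋𝒞_π/3 ≤ d₀/3.
    have hsmall : μp * moment a 1 * ‖ξ‖ ≤ spectralGap h / 3 := by
      have hM1 := moment_pos hd h hM (k := 1) (by norm_num)
      have hμ0 : 0 < μp := h.pos.trans_le ((h.lower 0 0).trans (h.upper 0 0))
      rw [delta0, le_div_iff₀ (by positivity)] at hξ
      linarith
    have hAb : fiberOp h 0 (-Complex.I • corrClass hv ξ) = -Complex.I • linClass h hM ξ := by
      rw [map_smul, fiberOp_corrClass h hM]
    -- The corrector cancels the linear part of the sine class. What remains of sine and of cosine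
    -- is each at most μ₊M₂|ξ|²/2, which is why m₂ below is twice μ₊M₂.
    have hfirst : ‖fiberOp h ξ (oneCell d) + fiberOp h 0 (-Complex.I • corrClass hv ξ)‖ ≤
        2 * (μp * moment a 2) * ‖ξ‖ ^ 2 / 2 := by
      have e : fiberOp h ξ (oneCell d) + fiberOp h 0 (-Complex.I • corrClass hv ξ) =
          cosClass h ξ + Complex.I • (sinClass h ξ - linClass h hM ξ) := by
        rw [hAb, fiberOp_one]; module
      rw [e]
      refine (norm_add_le _ _).trans ?_
      rw [norm_smul, Complex.norm_I, one_mul]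
      linarith [norm_cosClass_le h hM ξ, norm_sinClass_sub_le h hM ξ]
    have hη := quarticCoeff_nonneg (mul_nonneg hμp (hm 1)) (mul_nonneg hμp (hm 2))
      (mul_nonneg hμp (hm 3)) (mul_nonneg hμp (hm 4)) hD
    have hg := effForm_ge hd h hM hv hξπ
    obtain ⟨hunit, hbound⟩ := resolvent_approx (fiberOp h ξ) (fiberOp h 0) (fiberOp_symm h ξ)
      norm_oneCell (b₁ := -Complex.I • corrClass hv ξ)
      (by rw [inner_smul_right, inner_one_corrClass, mul_zero]) hD (mul_nonneg hμp (hm 1))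
      (m₂ := 2 * (μp * moment a 2)) (by have := mul_nonneg hμp (hm 2); positivity) (norm_nonneg ξ)
      hK hη hε (fiberOp_zero_one h) hgap
      (norm_fiberOp_sub_le h hM ξ) hsmall (fiberOp_lower hd h hM hξπ)
      (by rw [hAb, norm_smul, norm_neg, Complex.norm_I, one_mul]; exact norm_linClass_le h hM ξ)
      hfirst (abs_form_sub_effForm_le h hM hv hD hgap ξ) hg
    -- Y is by definition the difference of the two sides; only its norm has to be estimated.
    refine ⟨hunit, by nlinarith [mul_nonneg hK.le (sq_nonneg ‖ξ‖), pow_pos hε 2], _, (add_sub_cancel _ _).symm, ?_⟩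
    rw [firstOrder_mul_projConst, projConst_mul_firstOrder, projConst_eq, ← smul_add, ← smul_add]
    exact hbound.trans (remainder_le_constC6 hμp (hm 1) (hm 2) (hm 3) (hm 4) hD hK)
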